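/- Let $A\neq 0$ and $\gamma>1$ be real constants. For a smooth nowhere vanishing function $S(s)$ consider, for functions $\varphi>0,\psi,\chi$ of $(t,s)$ with $\varphi_s>0$, the system $$\varphi_{tt}-\varphi\psi_t^2=-\varphi\Bigl(\frac{S}{\varphi^\gamma\varphi_s^\gamma}\Bigr)_s-\frac{A^2}{2\varphi}\Bigl(\frac{\varphi^2\psi_s^2}{\varphi_s^2}\Bigr)_s-\frac{A^2\varphi}{2}\Bigl(\frac{\chi_s^2}{\varphi^2\varphi_s^2}\Bigr)_s,$$ $$(\varphi\psi_t)_t+\varphi_t\psi_t=\frac{A^2}{\varphi}\Bigl(\frac{\varphi\psi_s}{\varphi_s}\Bigr)_s,\qquad \chi_{tt}=A^2\Bigl(\frac{\chi_s}{\varphi\varphi_s}\Bigr)_s .$$ On every nonempty connected open set $\Omega$ of points $(t,s,\varphi,\psi,\chi)$ with $\varphi>0$ the following holds. Here $I$ is the set of values of $s$ on $\Omega$, $S$ is smooth and nowhere zero on $I$, and $S_0\neq0$, $s_0\notin I$ and $q$ are real constants. Symmetries are smooth vector fields $X=\xi^t\partial_t+\xi^s\partial_s+\eta^\varphi\partial_\varphi+\eta^\psi\partial_\psi+\eta^\chi\partial_\chi$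 on $\Omega$, with coefficients depending on $(t,s,\varphi,\psi,\chi)$, whose second prolongation annihilates the equations on their solution set in the jets over $\Omega$ with $\varphi_s>0$. (1) The system is equivalent to the Euler--Lagrange equations of $$L=\tfrac12(\varphi_t^2+\varphi^2\psi_t^2+\chi_t^2)-\frac{S}{\gamma-1}\varphi^{1-\gamma}\varphi_s^{1-\gamma}-\frac{A^2}{2}\Bigl(\frac{\varphi\psi_s^2}{\varphi_s}+\frac{\chi_s^2}{\varphi\varphi_s}\Bigr).$$ (2) The vector fields that are symmetries for every $S$ are exactly the linear combinations (with constant coefficients) of $\partial_t,\ \partial_\psi,\ \partial_\chi,\ t\partial_\chi$ (the kernel). (3) For a given $S$ there is a symmetry outside the kernel if and only if, on $I$, $S=S_0$, or $S=S_0|s-s_0|^q$ with $q\ne0$, or $S=S_0e^{qs}$ with $q\neq0$. In these cases the symmetries are exactly the linear combinations of the kernel and, respectively, - $S=S_0$: $\ \partial_s$ and $(2\gamma-1)t\partial_t+2(\gamma-1)s\partial_s+\gamma(\varphi\partial_\varphi+\chi\partial_\chi)$; - $S=S_0|s-s_0|^q$: $\ (2\gamma+q-1)t\partial_t+2(\gamma-1)(s-s_0)\partial_s+(\gamma+q)(\varphi\partial_\varphi+\chi\partial_\chi)$;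 - $S=S_0e^{qs}$: $\ qt\partial_t+2(\gamma-1)\partial_s+q(\varphi\partial_\varphi+\chi\partial_\chi)$. (4) Call $X$ a variational symmetry if $XL+L(D_t\xi^t+D_s\xi^s)=0$, and a divergence symmetry if $XL+L(D_t\xi^t+D_s\xi^s)=D_tB_1+D_sB_2$ for some smooth functions $B_1,B_2$ of $(t,s,\varphi,\psi,\chi)$. For every $S$ the fields $\partial_t,\partial_\psi,\partial_\chi$ are variational symmetries and $t\partial_\chi$ is a divergence symmetry with $(B_1,B_2)=(\chi,0)$. There is a variational symmetry that is not a linear combination of $\partial_t,\partial_\psi,\partial_\chi$ if and only if $S=S_0$ or $S=S_0|s-s_0|^{1-2\gamma}$, and the same condition is necessary and sufficient for the existence of a divergence symmetry outside the kernel. In these two cases the variational symmetries are exactly the linear combinations of $\partial_t,\partial_\psi,\partial_\chi$ and, respectively, $\partial_s$ or $2(s-s_0)\partial_s-(\varphi\partial_\varphi+\chi\partial_\chi)$; the divergence symmetries are obtained by adding $t\partial_\chi$ to the list. (5) Put $r=\varphi$, $z=\chi$, $u=\varphi_t$, $v=\varphi\psi_t$, $w=\chi_t$, $\rho=1/(\varphi\varphi_s)$,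 $H^r=A/\varphi$, $H^\theta=A\psi_s/\varphi_s$, $H^z=A\chi_s/(\varphi\varphi_s)$. In the two cases of (4), the Noether conservation law $D_t(N^tL)+D_s(N^sL)=0$ of the additional variational symmetry $X$, where $N^iL=\xi^iL+\sum_k(\eta^k-\xi^tu^k_t-\xi^su^k_s)\,\partial L/\partial u^k_i$ with $(u^1,u^2,u^3)=(\varphi,\psi,\chi)$, holds on the system, and $(N^tL,N^sL)=-(T^t,T^s)$, where $D_tT^t+D_sT^s=0$ is, for $S=S_0$ and $X=\partial_s$, $$D_t\Bigl(\frac{uH^r+vH^\theta+wH^z}{r\rho H^r}\Bigr)+D_s\Bigl(-\tfrac12(u^2+v^2+w^2)+\frac{\gamma S}{\gamma-1}\rho^{\gamma-1}\Bigr)=0,\tag{a}$$ and for $S=S_0|s-s_0|^{1-2\gamma}$ and $X=2(s-s_0)\partial_s-(\varphi\partial_\varphi+\chi\partial_\chi)$ $$D_t\Bigl\{2(s-s_0)\frac{uH^r+vH^\theta+wH^z}{r\rho H^r}+ru+zw\Bigr\}+D_s\Bigl\{2(s-s_0)\Bigl(-\tfrac12(u^2+v^2+w^2)+\frac{\gamma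 S}{\gamma-1}\rho^{\gamma-1}\Bigr)+r^2\Bigl(S\rho^\gamma+\tfrac12\bigl((H^\theta)^2+(H^z)^2\bigr)\Bigr)-rH^rzH^z\Bigr\}=0.\tag{b}$$ (6) Moreover, let $r>0$, $\theta$, $z$, $u$, $v$, $w$, $\rho>0$, $S$, $H^\theta$, $H^z$ be $C^1$ functions on an open set of the $(t,s)$-plane that satisfy, with $H^r=A/r$ and $p=S\rho^\gamma$, the equations of one-dimensional magnetohydrodynamic flows with cylindrical symmetry and infinite conductivity in mass Lagrangian coordinates $$\Bigl(\frac1\rho\Bigr)_t=(ru)_s,\quad u_t-\frac{v^2}{r}=-rp_s-\frac1{2r}\bigl(r^2(H^\theta)^2\bigr)_s-\frac r2\bigl((H^z)^2\bigr)_s,\quad v_t+\frac{uv}{r}=H^r(rH^\theta)_s,\quad w_t=rH^rH^z_s,$$ $$S_t=0,\quad \Bigl(\frac{H^\theta}{r\rho}\Bigr)_t=(vH^r)_s,\quad \Bigl(\frac{H^z}{\rho}\Bigr)_t=(rwH^r)_s,\quad r_t=u,\quad r_s=\frac1{r\rho},\quad \theta_t=\frac vr,\quad z_t=w .$$ If $S=S_0$,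 then (a) holds. If $S=S_0|s-s_0|^{1-2\gamma}$ with $s\neq s_0$ on the open set, and also $z_s=H^z/(r\rho H^r)$, then (b) holds. -/

import Mathlib

open scoped ContDiff

noncomputable section

namespace CylMHD

/-! ### Jets of maps `(t, s) ↦ (φ, ψ, χ)` -/

/-- The space of `(t, s, φ, ψ, χ)`: the first factor is `![t, s]`, the second is `![φ, ψ, χ]`. -/
abbrev J0 := (Fin 2 → ℝ) × (Fin 3 → ℝ)

/-- First-order jets; `z.2 k i` is the derivative of the `k`-th dependent variable with respect
to the `i`-th independent one. -/
abbrev J1 := J0 × (Fin 3 → Fin 2 → ℝ)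

/-- Second-order jets; `w.2 k i j` is the second derivative of the `k`-th dependent variable with
respect to the `i`-th and the `j`-th independent ones. Symmetry in `i`, `j` is imposed in `adm2`. -/
abbrev J2 := J1 × (Fin 3 → Fin 2 → Fin 2 → ℝ)

abbrev tt (z : J1) : ℝ := z.1.1 0
abbrev ss (z : J1) : ℝ := z.1.1 1
abbrev phi (z : J1) : ℝ := z.1.2 0
abbrev psi (z : J1) : ℝ := z.1.2 1
abbrev chi (z : J1) : ℝ := z.1.2 2
abbrev phi_t (z : J1) : ℝ := z.2 0 0
abbrev phi_s (z : J1) : ℝ := z.2 0 1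
abbrev psi_t (z : J1) : ℝ := z.2 1 0
abbrev psi_s (z : J1) : ℝ := z.2 1 1
abbrev chi_t (z : J1) : ℝ := z.2 2 0
abbrev chi_s (z : J1) : ℝ := z.2 2 1
abbrev phi_tt (w : J2) : ℝ := w.2 0 0 0
abbrev chi_tt (w : J2) : ℝ := w.2 2 0 0

/-- Total derivative `D_i f` of a function on `J0` (`i = 0` is `D_t`, `i = 1` is `D_s`). -/
def D0 (i : Fin 2) (f : J0 → ℝ) (z : J1) : ℝ :=
  fderiv ℝ f z.1 (Pi.single i 1, fun k => z.2 k i)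

/-- Total derivative `D_i f` of a function on `J1`. -/
def D1 (i : Fin 2) (f : J1 → ℝ) (w : J2) : ℝ :=
  fderiv ℝ f w.1 ((Pi.single i 1, fun k => w.1.2 k i), fun k j => w.2 k j i)

/-! ### Point vector fields and their prolongations -/

/-- A vector field `ξ^t ∂_t + ξ^s ∂_s + η^φ ∂_φ + η^ψ ∂_ψ + η^χ ∂_χ` on `J0`:
`X y = (![ξ^t, ξ^s], ![η^φ, η^ψ, η^χ])`. -/
abbrev VF := J0 → J0

abbrev VF.xi (X : VF) (i : Fin 2) (y : J0) : ℝ := (X y).1 i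
abbrev VF.eta (X : VF) (k : Fin 3) (y : J0) : ℝ := (X y).2 k

/-- `ζ^k_i = D_i η^k - ∑_j u^k_j D_i ξ^j`. -/
def zeta1 (X : VF) (k : Fin 3) (i : Fin 2) (z : J1) : ℝ :=
  D0 i (VF.eta X k) z - ∑ j, z.2 k j * D0 i (VF.xi X j) z

/-- `ζ^k_{ij} = D_j ζ^k_i - ∑_l u^k_{il} D_j ξ^l`. -/
def zeta2 (X : VF) (k : Fin 3) (i j : Fin 2) (w : J2) : ℝ :=
  D1 j (zeta1 X k i) w - ∑ l, w.2 k i l * D0 j (VF.xi X l) w.1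

/-- First prolongation. -/
def pr1 (X : VF) (z : J1) : J1 := (X z.1, fun k i => zeta1 X k i z)

/-- Second prolongation. -/
def pr2 (X : VF) (w : J2) : J2 := (pr1 X w.1, fun k i j => zeta2 X k i j w)

/-! ### Domains -/

/-- A region of `J0` on which `φ > 0` (`φ` is the distance from the axis). -/
structure IsRegion (Ω : Set J0) : Prop where
  isOpen : IsOpen Ω
  isConnected : IsConnected Ω
  pos : ∀ y ∈ Ω, 0 < y.2 0

/-- The values of the mass coordinate `s` that occur in `Ω`. -/
def sRange (Ω : Set J0) : Set ℝ := (fun y : J0 => y.1 1) '' Ω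

/-- First-order jets over `Ω` with `φ_s > 0` (so that the density `1 / (φ φ_s)` is positive). -/
def adm1 (Ω : Set J0) : Set J1 := {z | z.1 ∈ Ω ∧ 0 < phi_s z}

/-- Second-order jets over `Ω` with `φ_s > 0`. -/
def adm2 (Ω : Set J0) : Set J2 := {w | w.1 ∈ adm1 Ω ∧ ∀ k i j, w.2 k i j = w.2 k j i}

/-- Admissible entropy functions: smooth and without zeros. -/
def IsEntropy (Ω : Set J0) (S : ℝ → ℝ) : Prop :=
  ContDiffOn ℝ ∞ S (sRange Ω) ∧ ∀ s ∈ sRange Ω, S s ≠ 0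

/-! ### The variational system -/

/-- The three second-order equations for `φ`, `ψ`, `χ`, as left-hand side minus right-hand side. -/
def system (A γ : ℝ) (S : ℝ → ℝ) : Fin 3 → J2 → ℝ :=
  ![fun w => (phi_tt w - phi w.1 * psi_t w.1 ^ 2) -
      (- phi w.1 * D1 1 (fun z => S (ss z) / (phi z ^ γ * phi_s z ^ γ)) w
        - A ^ 2 / (2 * phi w.1) * D1 1 (fun z => phi z ^ 2 * psi_s z ^ 2 / phi_s z ^ 2) w
        - A ^ 2 * phi w.1 / 2 * D1 1 (fun z => chi_s z ^ 2 / (phi z ^ 2 * phi_s z ^ 2)) w),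
    fun w => (D1 0 (fun z => phi z * psi_t z) w + phi_t w.1 * psi_t w.1) -
      A ^ 2 / phi w.1 * D1 1 (fun z => phi z * psi_s z / phi_s z) w,
    fun w => chi_tt w - A ^ 2 * D1 1 (fun z => chi_s z / (phi z * phi_s z)) w]

/-- The Lagrangian function. -/
def lagrangian (A γ : ℝ) (S : ℝ → ℝ) (z : J1) : ℝ :=
  1 / 2 * (phi_t z ^ 2 + phi z ^ 2 * psi_t z ^ 2 + chi_t z ^ 2)
    - S (ss z) / (γ - 1) * phi z ^ (1 - γ) * phi_s z ^ (1 - γ)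
    - A ^ 2 / 2 * (phi z * psi_s z ^ 2 / phi_s z + chi_s z ^ 2 / (phi z * phi_s z))

/-- `∂L/∂u^k`. -/
def dU (L : J1 → ℝ) (k : Fin 3) (z : J1) : ℝ := fderiv ℝ L z ((0, Pi.single k 1), 0)

/-- `∂L/∂u^k_i`. -/
def dP (L : J1 → ℝ) (k : Fin 3) (i : Fin 2) (z : J1) : ℝ :=
  fderiv ℝ L z (0, Pi.single k (Pi.single i 1))

/-- The variational derivative `δL/δu^k`. -/
def eulerLagrange (L : J1 → ℝ) (k : Fin 3) (w : J2) : ℝ :=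
  dU L k w.1 - ∑ i, D1 i (dP L k i) w

/-- Infinitesimal criterion: the second prolongation of `X`, applied to the equations, vanishes
on the solution manifold of the system in the jet space. -/
def IsSymmetry (Ω : Set J0) (F : Fin 3 → J2 → ℝ) (X : VF) : Prop :=
  ContDiffOn ℝ ∞ X Ω ∧
    ∀ w ∈ adm2 Ω, (∀ k, F k w = 0) → ∀ k, fderiv ℝ (F k) w (pr2 X w) = 0

/-- `X L + L (D_t ξ^t + D_s ξ^s)`. -/
def actionVariation (L : J1 → ℝ) (X : VF) (z : J1) : ℝ :=
  fderiv ℝ L z (pr1 X z) + L z * ∑ i, D0 i (VF.xi X i) z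

/-- `X` is a variational symmetry of `L`. -/
def IsVariational (Ω : Set J0) (L : J1 → ℝ) (X : VF) : Prop :=
  ContDiffOn ℝ ∞ X Ω ∧ ∀ z ∈ adm1 Ω, actionVariation L X z = 0

/-- `X` is a divergence symmetry of `L`, with functions `B 0`, `B 1` of `(t, s, φ, ψ, χ)`. -/
def IsDivergenceWith (Ω : Set J0) (L : J1 → ℝ) (X : VF) (B : Fin 2 → J0 → ℝ) : Prop :=
  ContDiffOn ℝ ∞ X Ω ∧ (∀ i, ContDiffOn ℝ ∞ (B i) Ω) ∧
    ∀ z ∈ adm1 Ω, actionVariation L X z = ∑ i, D0 i (B i) z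

/-- The Noether vector `(N^t L, N^s L)` of `X`. -/
def noether (L : J1 → ℝ) (X : VF) (i : Fin 2) (z : J1) : ℝ :=
  VF.xi X i z.1 * L z +
    ∑ k, (VF.eta X k z.1 - ∑ j, VF.xi X j z.1 * z.2 k j) * dP L k i z

/-- `D_t (T 0) + D_s (T 1) = 0` on the solution manifold of the system. -/
def IsConserved (Ω : Set J0) (F : Fin 3 → J2 → ℝ) (T : Fin 2 → J1 → ℝ) : Prop :=
  ∀ w ∈ adm2 Ω, (∀ k, F k w = 0) → ∑ i, D1 i (T i) w = 0

/-! ### Generators -/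

/-- On `Ω` the field `X` is a linear combination, with constant coefficients, of the `G i`. -/
def SpannedOn (Ω : Set J0) {n : ℕ} (G : Fin n → VF) (X : VF) : Prop :=
  ∃ c : Fin n → ℝ, ∀ y ∈ Ω, X y = ∑ i, c i • G i y

/-- `∂_t` -/
def dt : VF := fun _ => (![1, 0], ![0, 0, 0])
/-- `∂_s` -/
def ds : VF := fun _ => (![0, 1], ![0, 0, 0])
/-- `∂_ψ` -/
def dpsi : VF := fun _ => (![0, 0], ![0, 1, 0])
/-- `∂_χ` -/
def dchi : VF := fun _ => (![0, 0], ![0, 0, 1])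
/-- `t ∂_χ` -/
def tdchi : VF := fun y => (![0, 0], ![0, 0, y.1 0])
/-- `t ∂_t` -/
def tdt : VF := fun y => (![y.1 0, 0], ![0, 0, 0])
/-- `(s - s₀) ∂_s` -/
def sds (s₀ : ℝ) : VF := fun y => (![0, y.1 1 - s₀], ![0, 0, 0])
/-- `φ ∂_φ + χ ∂_χ` -/
def scl : VF := fun y => (![0, 0], ![y.2 0, 0, y.2 2])

/-- The additional symmetry for constant entropy (besides `∂_s`). -/
def extConst (γ : ℝ) : VF := (2 * γ - 1) • tdt + (2 * (γ - 1)) • sds 0 + γ • scl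

/-- The additional symmetry for `S = S₀ |s - s₀| ^ q`. -/
def extPow (γ q s₀ : ℝ) : VF :=
  (2 * γ + q - 1) • tdt + (2 * (γ - 1)) • sds s₀ + (γ + q) • scl

/-- The additional symmetry for `S = S₀ e ^ (q s)`. -/
def extExp (γ q : ℝ) : VF := q • tdt + (2 * (γ - 1)) • ds + q • scl

/-- The additional variational symmetry for `S = S₀ |s - s₀| ^ (1 - 2 γ)`. -/
def extVar (s₀ : ℝ) : VF := (2 : ℝ) • sds s₀ - scl

/-- `S = S₀` on `I`. -/
def IsConstOn (I : Set ℝ) (S : ℝ → ℝ) (S₀ : ℝ) : Prop := S₀ ≠ 0 ∧ ∀ s ∈ I, S s = S₀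

/-- `S = S₀ |s - s₀| ^ q` on `I`. -/
def IsPowOn (I : Set ℝ) (S : ℝ → ℝ) (S₀ s₀ q : ℝ) : Prop :=
  S₀ ≠ 0 ∧ s₀ ∉ I ∧ ∀ s ∈ I, S s = S₀ * |s - s₀| ^ q

/-- `S = S₀ e ^ (q s)` on `I`. -/
def IsExpOn (I : Set ℝ) (S : ℝ → ℝ) (S₀ q : ℝ) : Prop :=
  S₀ ≠ 0 ∧ ∀ s ∈ I, S s = S₀ * Real.exp (q * s)

/-! ### Physical variables -/

/-- Values of the physical variables at a point `(t, s)`. -/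
structure Phys where
  (r θ z u v w ρ S Hθ Hz : ℝ)

/-- `H^r = A / r`. -/
def Phys.Hr (A : ℝ) (f : Phys) : ℝ := A / f.r

/-- The physical variables expressed through `φ`, `ψ`, `χ`. -/
def physOfJet (A : ℝ) (S : ℝ → ℝ) (j : J1) : Phys where
  r := phi j
  θ := psi j
  z := chi j
  u := phi_t j
  v := phi j * psi_t j
  w := chi_t j
  ρ := 1 / (phi j * phi_s j)
  S := S (ss j)
  Hθ := A * psi_s j / phi_s j
  Hz := A * chi_s j / (phi j * phi_s j)

/-- Density and flux of the conservation law given by `∂_s`. -/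
def law1 (A γ : ℝ) (f : Phys) : Fin 2 → ℝ :=
  ![(f.u * f.Hr A + f.v * f.Hθ + f.w * f.Hz) / (f.r * f.ρ * f.Hr A),
    - (1 / 2) * (f.u ^ 2 + f.v ^ 2 + f.w ^ 2) + γ * f.S / (γ - 1) * f.ρ ^ (γ - 1)]

/-- Density and flux of the conservation law given by `2 s ∂_s - (φ ∂_φ + χ ∂_χ)`;
`s` is measured from the point `s₀`. -/
def law2 (A γ s : ℝ) (f : Phys) : Fin 2 → ℝ :=
  ![2 * s * ((f.u * f.Hr A + f.v * f.Hθ + f.w * f.Hz) / (f.r * f.ρ * f.Hr A))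
      + f.r * f.u + f.z * f.w,
    2 * s * (- (1 / 2) * (f.u ^ 2 + f.v ^ 2 + f.w ^ 2) + γ * f.S / (γ - 1) * f.ρ ^ (γ - 1))
      + f.r ^ 2 * (f.S * f.ρ ^ γ + (f.Hθ ^ 2 + f.Hz ^ 2) / 2)
      - f.r * f.Hr A * f.z * f.Hz]

/-- Lagrangian time derivative. -/
def pt (f : ℝ → ℝ → ℝ) (t s : ℝ) : ℝ := deriv (fun τ => f τ s) t
/-- Derivative in the mass coordinate. -/
def ps (f : ℝ → ℝ → ℝ) (t s : ℝ) : ℝ := deriv (fun σ => f t σ) s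

/-- All components are continuously differentiable on `D`. -/
def PhysC1 (D : Set (ℝ × ℝ)) (f : ℝ → ℝ → Phys) : Prop :=
  ∀ g ∈ ([Phys.r, Phys.θ, Phys.z, Phys.u, Phys.v, Phys.w, Phys.ρ, Phys.S, Phys.Hθ, Phys.Hz] :
      List (Phys → ℝ)),
    ContDiffOn ℝ 1 (fun x : ℝ × ℝ => g (f x.1 x.2)) D

/-- The flow `f` solves, on the open set `D` of the `(t, s)`-plane, the equations of
one-dimensional magnetohydrodynamic flows with cylindrical symmetry, infinite conductivity,
`H^r = A / r` and pressure `p = S ρ ^ γ`, in mass Lagrangian coordinates. -/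
structure IsFlow (A γ : ℝ) (D : Set (ℝ × ℝ)) (f : ℝ → ℝ → Phys) : Prop where
  isOpen : IsOpen D
  c1 : PhysC1 D f
  r_pos : ∀ t s, (t, s) ∈ D → 0 < (f t s).r
  rho_pos : ∀ t s, (t, s) ∈ D → 0 < (f t s).ρ
  eq_rho : ∀ t s, (t, s) ∈ D →
    pt (fun t s => 1 / (f t s).ρ) t s = ps (fun t s => (f t s).r * (f t s).u) t s
  eq_u : ∀ t s, (t, s) ∈ D →
    pt (fun t s => (f t s).u) t s - (f t s).v ^ 2 / (f t s).r =
      - (f t s).r * ps (fun t s => (f t s).S * (f t s).ρ ^ γ) t s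
        - 1 / (2 * (f t s).r) * ps (fun t s => (f t s).r ^ 2 * (f t s).Hθ ^ 2) t s
        - (f t s).r / 2 * ps (fun t s => (f t s).Hz ^ 2) t s
  eq_v : ∀ t s, (t, s) ∈ D →
    pt (fun t s => (f t s).v) t s + (f t s).u * (f t s).v / (f t s).r =
      (f t s).Hr A * ps (fun t s => (f t s).r * (f t s).Hθ) t s
  eq_w : ∀ t s, (t, s) ∈ D →
    pt (fun t s => (f t s).w) t s =
      (f t s).r * (f t s).Hr A * ps (fun t s => (f t s).Hz) t s
  eq_S : ∀ t s, (t, s) ∈ D → pt (fun t s => (f t s).S) t s = 0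
  eq_Hθ : ∀ t s, (t, s) ∈ D →
    pt (fun t s => (f t s).Hθ / ((f t s).r * (f t s).ρ)) t s =
      ps (fun t s => (f t s).v * (f t s).Hr A) t s
  eq_Hz : ∀ t s, (t, s) ∈ D →
    pt (fun t s => (f t s).Hz / (f t s).ρ) t s =
      ps (fun t s => (f t s).r * (f t s).w * (f t s).Hr A) t s
  r_t : ∀ t s, (t, s) ∈ D → pt (fun t s => (f t s).r) t s = (f t s).u
  θ_t : ∀ t s, (t, s) ∈ D → pt (fun t s => (f t s).θ) t s = (f t s).v / (f t s).r
  z_t : ∀ t s, (t, s) ∈ D → pt (fun t s => (f t s).z) t s = (f t s).w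
  r_s : ∀ t s, (t, s) ∈ D → ps (fun t s => (f t s).r) t s = 1 / ((f t s).r * (f t s).ρ)

end CylMHD

end

set_option linter.unusedSimpArgs false

noncomputable section

namespace CylMHD

/-! ### Directional derivatives of real functions -/

/-! Total derivatives, prolongations, variational derivatives and the action of a prolonged field
are all values of a Fréchet derivative in one direction. `HasDir` computes such values, and every
claim about jets becomes a rational identity in the jet coordinates, `S`, `S'`, `S''` and the atoms
`φ ^ γ`, `φ_s ^ γ`.

Symmetries. The equations can be solved for the second `t`-derivatives, so on the solution manifold
the first-order jet and the mixed and pure `s`-derivatives of second order are free. The symmetry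
criterion is affine in these second derivatives, and comparing coefficients gives linear
differential equations for the field. The mixed derivatives force `ξ^t = ξ^t(t)` and `ξ^s = ξ^s(s)`
(`IsSymmetry.separated`). The pure `s`-derivatives (the `coeff_` lemmas), together with a few terms
of lower order, leave only translations, `t ∂_χ` and a scaling (`IsSymmetry.exists_affineField`). If
`t` and `s` have weights `a` and `b`, the magnetic terms give `φ` and `χ` the weight `a - b / 2` and
`ψ` the weight `0`. The pressure term then demands `S' (b s + d) = m S` with `m = (2 γ - 2) (a - b /
2) - γ b`, which is `EntropyCondition`. Conversely each such field is a symmetry because the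
equations are homogeneous (`isSymmetry_affineField`). If `b` and `d` do not both vanish, integrating
this equation for `S` gives constants, powers and exponentials (`entropy_cases`); if both vanish,
then `a = 0` and only the kernel remains.

The Lagrangian. Under the same scaling `L dt ds` has weight `a`, so `a = 0` is needed and the
condition becomes `S' (b s + d) = (1 - 2 γ) b S`; this singles out the exponent `1 - 2 γ`. That
nothing else occurs is shown independently of the symmetry classification, by reading off the
dependence of the action variation on the first derivatives (`IsDivergenceWith.exists_affineField`).

Conservation laws. `sum_D1_noether_ds` and `sum_D1_noether_extVar` are Noether identities valid off
the solution manifold and for variable entropy: the divergence is the action variation minus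
characteristics times Euler-Lagrange expressions. For flows in physical variables, which are only
`C^1`, the laws are derived directly from the first-order equations (`IsFlow.exists_law1`,
`IsFlow.exists_law2`). -/

section HasDir

variable {E : Type*} [NormedAddCommGroup E] [NormedSpace ℝ E]

/-- `f` is differentiable at `x` and its derivative in the direction `v` is `d`. -/
def HasDir (f : E → ℝ) (x v : E) (d : ℝ) : Prop :=
  ∃ f' : E →L[ℝ] ℝ, HasFDerivAt f f' x ∧ f' v = d

variable {f g : E → ℝ} {x v : E} {d d' : ℝ}

theorem HasDir.fderiv_eq (h : HasDir f x v d) : fderiv ℝ f x v = d := by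
  obtain ⟨f', hf, rfl⟩ := h
  rw [hf.fderiv]

theorem HasDir.of_differentiableAt (h : DifferentiableAt ℝ f x) (v : E) :
    HasDir f x v (fderiv ℝ f x v) :=
  ⟨_, h.hasFDerivAt, rfl⟩

theorem HasDir.congr_val (h : HasDir f x v d) (e : d = d') : HasDir f x v d' := e ▸ h

theorem HasDir.congr_fun (h : HasDir f x v d) (e : g =ᶠ[nhds x] f) : HasDir g x v d := by
  obtain ⟨f', hf, hd⟩ := h
  exact ⟨f', hf.congr_of_eventuallyEq e, hd⟩

theorem HasDir.const (c : ℝ) (x v : E) : HasDir (fun _ => c) x v 0 :=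
  ⟨0, hasFDerivAt_const c x, rfl⟩

theorem HasDir.clm (L : E →L[ℝ] ℝ) (x v : E) : HasDir (fun y => L y) x v (L v) :=
  ⟨L, L.hasFDerivAt, rfl⟩

theorem HasDir.add (hf : HasDir f x v d) (hg : HasDir g x v d') :
    HasDir (fun y => f y + g y) x v (d + d') := by
  obtain ⟨f', hf, rfl⟩ := hf
  obtain ⟨g', hg, rfl⟩ := hg
  exact ⟨_, hf.add hg, rfl⟩

theorem HasDir.neg (hf : HasDir f x v d) : HasDir (fun y => -f y) x v (-d) := by
  obtain ⟨f', hf, rfl⟩ := hf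
  exact ⟨_, hf.neg, rfl⟩

theorem HasDir.sub (hf : HasDir f x v d) (hg : HasDir g x v d') :
    HasDir (fun y => f y - g y) x v (d - d') := by
  obtain ⟨f', hf, rfl⟩ := hf
  obtain ⟨g', hg, rfl⟩ := hg
  exact ⟨_, hf.sub hg, rfl⟩

theorem HasDir.mul (hf : HasDir f x v d) (hg : HasDir g x v d') :
    HasDir (fun y => f y * g y) x v (d * g x + f x * d') := by
  obtain ⟨f', hf, rfl⟩ := hf
  obtain ⟨g', hg, rfl⟩ := hg
  refine ⟨_, hf.mul hg, ?_⟩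
  simp only [add_apply, smul_apply, smul_eq_mul]
  ring

theorem HasDir.comp {G : ℝ → ℝ} {G' : ℝ} (hf : HasDir f x v d) (hG : HasDerivAt G G' (f x)) :
    HasDir (fun y => G (f y)) x v (G' * d) := by
  obtain ⟨f', hf, rfl⟩ := hf
  exact ⟨_, hG.comp_hasFDerivAt x hf, rfl⟩

theorem HasDir.div (hf : HasDir f x v d) (hg : HasDir g x v d') (h0 : g x ≠ 0) :
    HasDir (fun y => f y / g y) x v ((d * g x - f x * d') / g x ^ 2) := by
  have h := hf.mul (hg.comp (hasDerivAt_inv h0))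
  simp only [div_eq_mul_inv]
  refine h.congr_val ?_
  field_simp
  ring

theorem HasDir.pow (hf : HasDir f x v d) (n : ℕ) :
    HasDir (fun y => f y ^ n) x v (n * f x ^ (n - 1) * d) :=
  hf.comp (hasDerivAt_pow n (f x))

theorem HasDir.sq (hf : HasDir f x v d) : HasDir (fun y => f y ^ 2) x v (2 * f x * d) :=
  (hf.pow 2).congr_val (by norm_num)

/-- The exponent `q - 1` is avoided by writing `f ^ q / f`. All later identities then contain a
single power of each base and are rational in it, within reach of `field_simp` and `ring`. -/
theorem HasDir.rpow (hf : HasDir f x v d) (h0 : 0 < f x) (q : ℝ) :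
    HasDir (fun y => f y ^ q) x v (q * (f x ^ q / f x) * d) := by
  have h := hf.comp (Real.hasDerivAt_rpow_const (p := q) (Or.inl h0.ne'))
  rwa [Real.rpow_sub_one h0.ne'] at h

theorem HasDir.sum {ι : Type*} (s : Finset ι) {F : ι → E → ℝ} {D : ι → ℝ}
    (h : ∀ i ∈ s, HasDir (F i) x v (D i)) :
    HasDir (fun y => ∑ i ∈ s, F i y) x v (∑ i ∈ s, D i) := by
  classical
  choose! F' hF hD using h
  refine ⟨∑ i ∈ s, F' i, HasFDerivAt.fun_sum hF, ?_⟩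
  rw [sum_apply]
  exact Finset.sum_congr rfl hD

end HasDir

/-! ### Coordinates -/

/-- The value of `∂_k` on the jet coordinates: coordinate functions on `J1` are linear. -/
theorem hasDir_x (i : Fin 2) (z v : J1) : HasDir (fun z : J1 => z.1.1 i) z v (v.1.1 i) :=
  HasDir.clm ((ContinuousLinearMap.proj i).comp
    ((ContinuousLinearMap.fst ℝ _ _).comp (ContinuousLinearMap.fst ℝ _ _))) z v

theorem hasDir_u (k : Fin 3) (z v : J1) : HasDir (fun z : J1 => z.1.2 k) z v (v.1.2 k) :=
  HasDir.clm ((ContinuousLinearMap.proj k).comp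
    ((ContinuousLinearMap.snd ℝ _ _).comp (ContinuousLinearMap.fst ℝ _ _))) z v

theorem hasDir_p (k : Fin 3) (i : Fin 2) (z v : J1) :
    HasDir (fun z : J1 => z.2 k i) z v (v.2 k i) :=
  HasDir.clm ((ContinuousLinearMap.proj i).comp ((ContinuousLinearMap.proj k).comp
    (ContinuousLinearMap.snd ℝ J0 (Fin 3 → Fin 2 → ℝ)))) z v

theorem hasDir_q (k : Fin 3) (i j : Fin 2) (w v : J2) :
    HasDir (fun w : J2 => w.2 k i j) w v (v.2 k i j) :=
  HasDir.clm ((ContinuousLinearMap.proj j).comp ((ContinuousLinearMap.proj i).comp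
    ((ContinuousLinearMap.proj k).comp
      (ContinuousLinearMap.snd ℝ J1 (Fin 3 → Fin 2 → Fin 2 → ℝ))))) w v

theorem HasDir.lift {f : J1 → ℝ} {w v : J2} {d : ℝ} (h : HasDir f w.1 v.1 d) :
    HasDir (fun w : J2 => f w.1) w v d := by
  obtain ⟨f', hf, rfl⟩ := h
  exact ⟨f'.comp (ContinuousLinearMap.fst ℝ _ _),
    hf.comp w hasFDerivAt_fst, rfl⟩

theorem HasDir.lift0 {f : J0 → ℝ} {z v : J1} {d : ℝ} (h : HasDir f z.1 v.1 d) :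
    HasDir (fun z : J1 => f z.1) z v d := by
  obtain ⟨f', hf, rfl⟩ := h
  exact ⟨f'.comp (ContinuousLinearMap.fst ℝ _ _),
    hf.comp z hasFDerivAt_fst, rfl⟩

theorem hasDir_ss (z v : J1) : HasDir ss z v (ss v) := hasDir_x 1 z v
theorem hasDir_phi (z v : J1) : HasDir phi z v (phi v) := hasDir_u 0 z v
theorem hasDir_chi (z v : J1) : HasDir chi z v (chi v) := hasDir_u 2 z v
theorem hasDir_phi_t (z v : J1) : HasDir phi_t z v (phi_t v) := hasDir_p 0 0 z v
theorem hasDir_phi_s (z v : J1) : HasDir phi_s z v (phi_s v) := hasDir_p 0 1 z v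
theorem hasDir_psi_t (z v : J1) : HasDir psi_t z v (psi_t v) := hasDir_p 1 0 z v
theorem hasDir_psi_s (z v : J1) : HasDir psi_s z v (psi_s v) := hasDir_p 1 1 z v
theorem hasDir_chi_t (z v : J1) : HasDir chi_t z v (chi_t v) := hasDir_p 2 0 z v
theorem hasDir_chi_s (z v : J1) : HasDir chi_s z v (chi_s v) := hasDir_p 2 1 z v

/-- The direction of the total derivative `D_i` in `J0`. -/
def dir0 (i : Fin 2) (z : J1) : J0 := (Pi.single i 1, fun k => z.2 k i)

/-- The direction of the total derivative `D_i` in `J1`. -/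
def dir1 (i : Fin 2) (w : J2) : J1 := (dir0 i w.1, fun k j => w.2 k j i)

theorem ss_dir1_zero (w : J2) : ss (dir1 0 w) = 0 := by simp [dir1, dir0, ss]
theorem ss_dir1_one (w : J2) : ss (dir1 1 w) = 1 := by simp [dir1, dir0, ss]
theorem phi_dir1 (i : Fin 2) (w : J2) : phi (dir1 i w) = w.1.2 0 i := rfl
theorem psi_dir1 (i : Fin 2) (w : J2) : psi (dir1 i w) = w.1.2 1 i := rfl
theorem chi_dir1 (i : Fin 2) (w : J2) : chi (dir1 i w) = w.1.2 2 i := rfl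
theorem phi_t_dir1 (i : Fin 2) (w : J2) : phi_t (dir1 i w) = w.2 0 0 i := rfl
theorem phi_s_dir1 (i : Fin 2) (w : J2) : phi_s (dir1 i w) = w.2 0 1 i := rfl
theorem psi_t_dir1 (i : Fin 2) (w : J2) : psi_t (dir1 i w) = w.2 1 0 i := rfl
theorem psi_s_dir1 (i : Fin 2) (w : J2) : psi_s (dir1 i w) = w.2 1 1 i := rfl
theorem chi_t_dir1 (i : Fin 2) (w : J2) : chi_t (dir1 i w) = w.2 2 0 i := rfl
theorem chi_s_dir1 (i : Fin 2) (w : J2) : chi_s (dir1 i w) = w.2 2 1 i := rfl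

theorem HasDir.D1_eq {i : Fin 2} {f : J1 → ℝ} {w : J2} {d : ℝ}
    (h : HasDir f w.1 (dir1 i w) d) : D1 i f w = d := h.fderiv_eq

/-! ### Points at which the system is regular -/

/-- `φ > 0`, `φ_s > 0` and `S` is twice continuously differentiable near `s`. -/
structure Regular (S : ℝ → ℝ) (z : J1) : Prop where
  phi_pos : 0 < phi z
  phi_s_pos : 0 < phi_s z
  contDiffAt : ContDiffAt ℝ 2 S (ss z)

/-- Closed formulas for the equations and for `∂L/∂u^k_i` hold only at regular jets. Openness is
what allows them to be differentiated. -/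
theorem Regular.eventually {S : ℝ → ℝ} {z : J1} (h : Regular S z) :
    ∀ᶠ y in nhds z, Regular S y := by
  have h1 : ∀ᶠ y in nhds z, 0 < phi y :=
    (show Continuous phi by fun_prop).continuousAt.eventually_const_lt h.phi_pos
  have h2 : ∀ᶠ y in nhds z, 0 < phi_s y :=
    (show Continuous phi_s by fun_prop).continuousAt.eventually_const_lt h.phi_s_pos
  -- Being `C^n` at a point is an open condition for `n ≠ ∞`; the finite order `2` suffices for
  -- `S''`.
  have h3 : ∀ᶠ y in nhds z, ContDiffAt ℝ 2 S (ss y) :=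
    (show Continuous ss by fun_prop).continuousAt.eventually
      (h.contDiffAt.eventually (by decide))
  filter_upwards [h1, h2, h3] with y a b c using ⟨a, b, c⟩

theorem Regular.eventually_jet {S : ℝ → ℝ} {w : J2} (h : Regular S w.1) :
    ∀ᶠ y in nhds w, Regular S y.1 :=
  continuous_fst.continuousAt.eventually h.eventually

theorem Regular.hasDerivAt {S : ℝ → ℝ} {z : J1} (h : Regular S z) :
    HasDerivAt S (deriv S (ss z)) (ss z) :=
  (h.contDiffAt.differentiableAt (by norm_num)).hasDerivAt

theorem Regular.hasDerivAt_deriv {S : ℝ → ℝ} {z : J1} (h : Regular S z) :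
    HasDerivAt (deriv S) (deriv (deriv S) (ss z)) (ss z) := by
  have h1 : ContDiffAt ℝ 1 (deriv S) (ss z) := by
    have h2 : ContDiffAt ℝ 1 (fderiv ℝ S) (ss z) :=
      h.contDiffAt.fderiv_right (by norm_num)
    have h3 : deriv S = fun s => fderiv ℝ S s 1 := by ext s; exact (fderiv_apply_one_eq_deriv).symm
    rw [h3]
    exact h2.clm_apply contDiffAt_const
  exact (h1.differentiableAt (by norm_num)).hasDerivAt

variable {A γ : ℝ} {S : ℝ → ℝ} {w v : J2} {z : J1}

/-! ### The system in explicit form -/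

/-- The equations of `system` with the total derivatives expanded. -/
def explicitSystem (A γ : ℝ) (S : ℝ → ℝ) : Fin 3 → J2 → ℝ :=
  ![fun w => w.2 0 0 0 - phi w.1 * psi_t w.1 ^ 2
      + phi w.1 / (phi w.1 ^ γ * phi_s w.1 ^ γ) * (deriv S (ss w.1)
        - γ * S (ss w.1) * (phi_s w.1 / phi w.1 + w.2 0 1 1 / phi_s w.1))
      + A ^ 2 * (psi_s w.1 ^ 2 / phi_s w.1 + phi w.1 * psi_s w.1 * w.2 1 1 1 / phi_s w.1 ^ 2
        - phi w.1 * psi_s w.1 ^ 2 * w.2 0 1 1 / phi_s w.1 ^ 3)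
      + A ^ 2 * (chi_s w.1 * w.2 2 1 1 / (phi w.1 * phi_s w.1 ^ 2)
        - chi_s w.1 ^ 2 / (phi w.1 ^ 2 * phi_s w.1)
        - chi_s w.1 ^ 2 * w.2 0 1 1 / (phi w.1 * phi_s w.1 ^ 3)),
    fun w => phi w.1 * w.2 1 0 0 + 2 * phi_t w.1 * psi_t w.1
      - A ^ 2 * (psi_s w.1 / phi w.1 + w.2 1 1 1 / phi_s w.1
        - psi_s w.1 * w.2 0 1 1 / phi_s w.1 ^ 2),
    fun w => w.2 2 0 0 - A ^ 2 * (w.2 2 1 1 / (phi w.1 * phi_s w.1)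
        - chi_s w.1 / phi w.1 ^ 2 - chi_s w.1 * w.2 0 1 1 / (phi w.1 * phi_s w.1 ^ 2))]

theorem Regular.rpow_pos (h : Regular S z) (γ : ℝ) : 0 < phi z ^ γ := Real.rpow_pos_of_pos h.phi_pos γ
theorem Regular.rpow_pos' (h : Regular S z) (γ : ℝ) : 0 < phi_s z ^ γ :=
  Real.rpow_pos_of_pos h.phi_s_pos γ

theorem system_eq_explicit (h : Regular S w.1) (k : Fin 3) :
    system A γ S k w = explicitSystem A γ S k w := by
  have h1 := h.phi_pos.ne'
  have h2 := h.phi_s_pos.ne'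
  have h3 := (h.rpow_pos γ).ne'
  have h4 := (h.rpow_pos' γ).ne'
  fin_cases k
  · have e1 := (((hasDir_ss w.1 (dir1 1 w)).comp h.hasDerivAt).div
      (((hasDir_phi w.1 (dir1 1 w)).rpow h.phi_pos γ).mul
        ((hasDir_phi_s w.1 (dir1 1 w)).rpow h.phi_s_pos γ)) (mul_ne_zero h3 h4)).D1_eq
    have e2 := (((hasDir_phi w.1 (dir1 1 w)).sq.mul (hasDir_psi_s w.1 (dir1 1 w)).sq).div
      (hasDir_phi_s w.1 (dir1 1 w)).sq (pow_ne_zero 2 h2)).D1_eq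
    have e3 := ((hasDir_chi_s w.1 (dir1 1 w)).sq.div ((hasDir_phi w.1 (dir1 1 w)).sq.mul
      (hasDir_phi_s w.1 (dir1 1 w)).sq)
      (mul_ne_zero (pow_ne_zero 2 h1) (pow_ne_zero 2 h2))).D1_eq
    simp only [system, explicitSystem, Fin.zero_eta, Matrix.cons_val_zero]
    rw [e1, e2, e3]
    simp only [ss_dir1_one, phi_dir1, phi_s_dir1, psi_s_dir1, chi_s_dir1]
    field_simp
    ring
  · have e1 := ((hasDir_phi w.1 (dir1 0 w)).mul (hasDir_psi_t w.1 (dir1 0 w))).D1_eq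
    have e2 := (((hasDir_phi w.1 (dir1 1 w)).mul (hasDir_psi_s w.1 (dir1 1 w))).div
      (hasDir_phi_s w.1 (dir1 1 w)) h2).D1_eq
    simp only [system, explicitSystem, Fin.mk_one, Matrix.cons_val_one, Matrix.cons_val_zero]
    rw [e1, e2]
    simp only [phi_dir1, phi_s_dir1, psi_t_dir1, psi_s_dir1, chi_s_dir1]
    field_simp
    ring
  · have e1 := ((hasDir_chi_s w.1 (dir1 1 w)).div ((hasDir_phi w.1 (dir1 1 w)).mul
      (hasDir_phi_s w.1 (dir1 1 w))) (mul_ne_zero h1 h2)).D1_eq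
    simp only [system, explicitSystem, Fin.reduceFinMk, Matrix.cons_val]
    rw [e1]
    simp only [phi_dir1, phi_s_dir1, psi_t_dir1, psi_s_dir1, chi_s_dir1]
    field_simp
    ring

end CylMHD

end

noncomputable section

namespace CylMHD

/-! ### Linearization of the system -/

variable {A γ : ℝ} {S : ℝ → ℝ} {w v : J2} {z : J1}

/-- The derivative of `explicitSystem` at `w` in the direction `v`. -/
def linearizedSystem (A γ : ℝ) (S : ℝ → ℝ) : Fin 3 → J2 → J2 → ℝ :=
  ![fun w v => v.2 0 0 0 - phi v.1 * psi_t w.1 ^ 2 - 2 * phi w.1 * psi_t w.1 * psi_t v.1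
      + (phi w.1 / (phi w.1 ^ γ * phi_s w.1 ^ γ)
        * (phi v.1 / phi w.1 - γ * (phi v.1 / phi w.1 + phi_s v.1 / phi_s w.1))
        * (deriv S (ss w.1)
          - γ * S (ss w.1) * (phi_s w.1 / phi w.1 + w.2 0 1 1 / phi_s w.1))
      + phi w.1 / (phi w.1 ^ γ * phi_s w.1 ^ γ)
        * (deriv (deriv S) (ss w.1) * ss v.1
          - γ * (deriv S (ss w.1) * ss v.1) * (phi_s w.1 / phi w.1 + w.2 0 1 1 / phi_s w.1)
          - γ * S (ss w.1) * (phi_s v.1 / phi w.1 - phi_s w.1 * phi v.1 / phi w.1 ^ 2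
            + v.2 0 1 1 / phi_s w.1 - w.2 0 1 1 * phi_s v.1 / phi_s w.1 ^ 2)))
      + A ^ 2 * (2 * psi_s w.1 * psi_s v.1 / phi_s w.1
        - psi_s w.1 ^ 2 * phi_s v.1 / phi_s w.1 ^ 2
        + (phi v.1 * psi_s w.1 * w.2 1 1 1 + phi w.1 * psi_s v.1 * w.2 1 1 1
          + phi w.1 * psi_s w.1 * v.2 1 1 1) / phi_s w.1 ^ 2
        - 2 * phi w.1 * psi_s w.1 * w.2 1 1 1 * phi_s v.1 / phi_s w.1 ^ 3
        - (phi v.1 * psi_s w.1 ^ 2 * w.2 0 1 1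
          + 2 * phi w.1 * psi_s w.1 * psi_s v.1 * w.2 0 1 1
          + phi w.1 * psi_s w.1 ^ 2 * v.2 0 1 1) / phi_s w.1 ^ 3
        + 3 * phi w.1 * psi_s w.1 ^ 2 * w.2 0 1 1 * phi_s v.1 / phi_s w.1 ^ 4)
      + A ^ 2 * ((chi_s v.1 * w.2 2 1 1 + chi_s w.1 * v.2 2 1 1) / (phi w.1 * phi_s w.1 ^ 2)
        - chi_s w.1 * w.2 2 1 1 * (phi v.1 / phi w.1 + 2 * phi_s v.1 / phi_s w.1)
          / (phi w.1 * phi_s w.1 ^ 2)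
        - 2 * chi_s w.1 * chi_s v.1 / (phi w.1 ^ 2 * phi_s w.1)
        + chi_s w.1 ^ 2 * (2 * phi v.1 / phi w.1 + phi_s v.1 / phi_s w.1)
          / (phi w.1 ^ 2 * phi_s w.1)
        - (2 * chi_s w.1 * chi_s v.1 * w.2 0 1 1 + chi_s w.1 ^ 2 * v.2 0 1 1)
          / (phi w.1 * phi_s w.1 ^ 3)
        + chi_s w.1 ^ 2 * w.2 0 1 1 * (phi v.1 / phi w.1 + 3 * phi_s v.1 / phi_s w.1)
          / (phi w.1 * phi_s w.1 ^ 3)),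
    fun w v => phi v.1 * w.2 1 0 0 + phi w.1 * v.2 1 0 0
      + 2 * (phi_t v.1 * psi_t w.1 + phi_t w.1 * psi_t v.1)
      - A ^ 2 * (psi_s v.1 / phi w.1 - psi_s w.1 * phi v.1 / phi w.1 ^ 2
        + v.2 1 1 1 / phi_s w.1 - w.2 1 1 1 * phi_s v.1 / phi_s w.1 ^ 2
        - (psi_s v.1 * w.2 0 1 1 + psi_s w.1 * v.2 0 1 1) / phi_s w.1 ^ 2
        + 2 * psi_s w.1 * w.2 0 1 1 * phi_s v.1 / phi_s w.1 ^ 3),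
    fun w v => v.2 2 0 0
      - A ^ 2 * (v.2 2 1 1 / (phi w.1 * phi_s w.1)
        - w.2 2 1 1 * (phi v.1 / phi w.1 + phi_s v.1 / phi_s w.1) / (phi w.1 * phi_s w.1)
        - chi_s v.1 / phi w.1 ^ 2 + 2 * chi_s w.1 * phi v.1 / phi w.1 ^ 3
        - (chi_s v.1 * w.2 0 1 1 + chi_s w.1 * v.2 0 1 1) / (phi w.1 * phi_s w.1 ^ 2)
        + chi_s w.1 * w.2 0 1 1 * (phi v.1 / phi w.1 + 2 * phi_s v.1 / phi_s w.1)
          / (phi w.1 * phi_s w.1 ^ 2))]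

theorem hasDir_explicitSystem (h : Regular S w.1) (k : Fin 3) :
    HasDir (explicitSystem A γ S k) w v (linearizedSystem A γ S k w v) := by
  have h1 := h.phi_pos.ne'
  have h2 := h.phi_s_pos.ne'
  have h3 := (h.rpow_pos γ).ne'
  have h4 := (h.rpow_pos' γ).ne'
  have c2 := HasDir.const (2 : ℝ) w v
  have cA := HasDir.const (A ^ 2) w v
  have dφ := (hasDir_phi w.1 v.1).lift
  have dp := (hasDir_phi_s w.1 v.1).lift
  have dα := (hasDir_psi_s w.1 v.1).lift
  have dβ := (hasDir_chi_s w.1 v.1).lift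
  have dψt := (hasDir_psi_t w.1 v.1).lift
  have qφ := hasDir_q 0 1 1 w v
  have qψ := hasDir_q 1 1 1 w v
  have qχ := hasDir_q 2 1 1 w v
  fin_cases k
  · have dS := ((hasDir_ss w.1 v.1).comp h.hasDerivAt).lift
    have dS' := ((hasDir_ss w.1 v.1).comp h.hasDerivAt_deriv).lift
    have e1 := (hasDir_q 0 0 0 w v).sub (dφ.mul dψt.sq)
    have e2 := (dφ.div ((dφ.rpow h.phi_pos γ).mul (dp.rpow h.phi_s_pos γ))
      (mul_ne_zero h3 h4)).mul (dS'.sub (((HasDir.const γ w v).mul dS).mul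
        ((dp.div dφ h1).add (qφ.div dp h2))))
    have e3 := cA.mul (((dα.sq.div dp h2).add (((dφ.mul dα).mul qψ).div dp.sq
      (pow_ne_zero 2 h2))).sub (((dφ.mul dα.sq).mul qφ).div (dp.pow 3) (pow_ne_zero 3 h2)))
    have e4 := cA.mul ((((dβ.mul qχ).div (dφ.mul dp.sq)
      (mul_ne_zero h1 (pow_ne_zero 2 h2))).sub (dβ.sq.div (dφ.sq.mul dp)
        (mul_ne_zero (pow_ne_zero 2 h1) h2))).sub ((dβ.sq.mul qφ).div (dφ.mul (dp.pow 3))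
          (mul_ne_zero h1 (pow_ne_zero 3 h2))))
    refine (((e1.add e2).add e3).add e4).congr_val ?_
    simp only [linearizedSystem, Fin.zero_eta, Matrix.cons_val_zero]
    congr 1
    congr 1
    congr 1
    · ring
    · field_simp
      ring
    · field_simp
      push_cast
      ring
    · field_simp
      push_cast
      ring
  · refine (((dφ.mul (hasDir_q 1 0 0 w v)).add ((c2.mul (hasDir_phi_t w.1 v.1).lift).mul
      dψt)).sub (cA.mul (((dα.div dφ h1).add (qψ.div dp h2)).sub
        ((dα.mul qφ).div dp.sq (pow_ne_zero 2 h2))))).congr_val ?_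
    simp only [linearizedSystem, Fin.mk_one, Matrix.cons_val_one, Matrix.cons_val_zero]
    field_simp
    ring
  · refine ((hasDir_q 2 0 0 w v).sub (cA.mul (((qχ.div (dφ.mul dp) (mul_ne_zero h1 h2)).sub
      (dβ.div dφ.sq (pow_ne_zero 2 h1))).sub ((dβ.mul qφ).div (dφ.mul dp.sq)
        (mul_ne_zero h1 (pow_ne_zero 2 h2)))))).congr_val ?_
    simp only [linearizedSystem, Fin.reduceFinMk, Matrix.cons_val]
    field_simp
    ring

theorem hasDir_system (h : Regular S w.1) (k : Fin 3) :
    HasDir (system A γ S k) w v (linearizedSystem A γ S k w v) :=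
  (hasDir_explicitSystem h k).congr_fun
    (h.eventually_jet.mono fun _ hy => system_eq_explicit hy k)

/-! ### The Lagrangian and its Euler-Lagrange equations -/

/-- The derivative of `lagrangian` at `z` in the direction `v`. -/
theorem hasDir_lagrangian (hγ : γ ≠ 1) (h : Regular S z) (v : J1) :
    HasDir (lagrangian A γ S) z v
      (phi_t z * phi_t v + phi z * psi_t z ^ 2 * phi v + phi z ^ 2 * psi_t z * psi_t v
        + chi_t z * chi_t v
        - phi z * phi_s z / (phi z ^ γ * phi_s z ^ γ)
          * (deriv S (ss z) * ss v / (γ - 1) - S (ss z) * (phi v / phi z + phi_s v / phi_s z))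
        - A ^ 2 / 2 * (phi v * psi_s z ^ 2 / phi_s z + 2 * phi z * psi_s z * psi_s v / phi_s z
          - phi z * psi_s z ^ 2 * phi_s v / phi_s z ^ 2
          + 2 * chi_s z * chi_s v / (phi z * phi_s z)
          - chi_s z ^ 2 / (phi z * phi_s z) * (phi v / phi z + phi_s v / phi_s z))) := by
  have h1 := h.phi_pos.ne'
  have h2 := h.phi_s_pos.ne'
  have h3 := (h.rpow_pos γ).ne'
  have h4 := (h.rpow_pos' γ).ne'
  have h5 : γ - 1 ≠ 0 := sub_ne_zero.2 hγ
  have dφ := hasDir_phi z v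
  have dp := hasDir_phi_s z v
  have dα := hasDir_psi_s z v
  have dβ := hasDir_chi_s z v
  have dS := (hasDir_ss z v).comp h.hasDerivAt
  have e1 := (HasDir.const (1 / 2 : ℝ) z v).mul (((hasDir_phi_t z v).sq.add
    (dφ.sq.mul (hasDir_psi_t z v).sq)).add (hasDir_chi_t z v).sq)
  have e2 := ((dS.div (HasDir.const (γ - 1) z v) h5).mul (dφ.rpow h.phi_pos (1 - γ))).mul
    (dp.rpow h.phi_s_pos (1 - γ))
  have e3 := (HasDir.const (A ^ 2 / 2) z v).mul (((dφ.mul dα.sq).div dp h2).add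
    (dβ.sq.div (dφ.mul dp) (mul_ne_zero h1 h2)))
  refine ((e1.sub e2).sub e3).congr_val ?_
  rw [Real.rpow_sub h.phi_pos, Real.rpow_sub h.phi_s_pos, Real.rpow_one, Real.rpow_one]
  congr 1
  congr 1
  · ring
  · field_simp
    ring
  · field_simp
    ring

theorem dU_lagrangian (hγ : γ ≠ 1) (h : Regular S z) (k : Fin 3) :
    dU (lagrangian A γ S) k z =
      (![phi z * psi_t z ^ 2 + phi_s z * S (ss z) / (phi z ^ γ * phi_s z ^ γ)
        - A ^ 2 / 2 * (psi_s z ^ 2 / phi_s z - chi_s z ^ 2 / (phi z ^ 2 * phi_s z)), 0, 0] :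
        Fin 3 → ℝ) k := by
  have h1 := h.phi_pos.ne'
  have h2 := h.phi_s_pos.ne'
  have h3 := (h.rpow_pos γ).ne'
  have h4 := (h.rpow_pos' γ).ne'
  refine (hasDir_lagrangian hγ h _).fderiv_eq.trans ?_
  fin_cases k <;> simp [phi_t, phi, psi_t, chi_t, ss, phi_s, psi_s, chi_s]
  have h1 : z.1.2 0 ≠ 0 := h1
  have h2 : z.2 0 1 ≠ 0 := h2
  have h3 : z.1.2 0 ^ γ ≠ 0 := h3
  have h4 : z.2 0 1 ^ γ ≠ 0 := h4
  field_simp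

theorem dP_lagrangian (hγ : γ ≠ 1) (h : Regular S z) (k : Fin 3) (i : Fin 2) :
    dP (lagrangian A γ S) k i z =
      (![![phi_t z, phi z * S (ss z) / (phi z ^ γ * phi_s z ^ γ)
          + A ^ 2 / 2 * (phi z * psi_s z ^ 2 / phi_s z ^ 2 + chi_s z ^ 2 / (phi z * phi_s z ^ 2))],
        ![phi z ^ 2 * psi_t z, - A ^ 2 * (phi z * psi_s z / phi_s z)],
        ![chi_t z, - A ^ 2 * (chi_s z / (phi z * phi_s z))]] : Fin 3 → Fin 2 → ℝ) k i := by
  have h1 : z.1.2 0 ≠ 0 := h.phi_pos.ne'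
  have h2 : z.2 0 1 ≠ 0 := h.phi_s_pos.ne'
  have h3 : z.1.2 0 ^ γ ≠ 0 := (h.rpow_pos γ).ne'
  have h4 : z.2 0 1 ^ γ ≠ 0 := (h.rpow_pos' γ).ne'
  refine (hasDir_lagrangian hγ h _).fderiv_eq.trans ?_
  fin_cases k <;> fin_cases i <;> simp [phi_t, phi, psi_t, chi_t, ss, phi_s, psi_s, chi_s] <;>
    field_simp
  ring

/-- The Euler-Lagrange equations are the equations of the system up to nonzero factors. -/
theorem eulerLagrange_lagrangian (hγ : γ ≠ 1) (h : Regular S w.1)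
    (k : Fin 3) :
    eulerLagrange (lagrangian A γ S) k w =
      - (![1, phi w.1, 1] : Fin 3 → ℝ) k * system A γ S k w := by
  have h1 := h.phi_pos.ne'
  have h2 := h.phi_s_pos.ne'
  have h3 := (h.rpow_pos γ).ne'
  have h4 := (h.rpow_pos' γ).ne'
  -- The closed form of the momentum is known at regular jets only; these form a neighbourhood,
  -- which is enough for its total derivative.
  have key : ∀ i k (f : J1 → ℝ) d, (∀ y, Regular S y → dP (lagrangian A γ S) k i y = f y) →
      HasDir f w.1 (dir1 i w) d → D1 i (dP (lagrangian A γ S) k i) w = d := by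
    intro i k f d hf hd
    exact (hd.congr_fun (h.eventually.mono hf)).D1_eq
  rw [eulerLagrange, Fin.sum_univ_two, dU_lagrangian hγ h, system_eq_explicit h]
  have dφ := fun i => hasDir_phi w.1 (dir1 i w)
  have dp := fun i => hasDir_phi_s w.1 (dir1 i w)
  have dα := fun i => hasDir_psi_s w.1 (dir1 i w)
  have dβ := fun i => hasDir_chi_s w.1 (dir1 i w)
  have dS := fun i => (hasDir_ss w.1 (dir1 i w)).comp h.hasDerivAt
  fin_cases k <;> simp only [Fin.zero_eta, Fin.mk_one, Fin.reduceFinMk]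
  · rw [key 0 _ _ _ (fun y hy => dP_lagrangian hγ hy 0 0) (hasDir_phi_t w.1 (dir1 0 w)),
      key 1 _ _ _ (fun y hy => dP_lagrangian hγ hy 0 1)
        ((((dφ 1).mul (dS 1)).div (((dφ 1).rpow h.phi_pos γ).mul ((dp 1).rpow h.phi_s_pos γ))
          (mul_ne_zero h3 h4)).add ((HasDir.const (A ^ 2 / 2) w.1 _).mul
          ((((dφ 1).mul (dα 1).sq).div (dp 1).sq (pow_ne_zero 2 h2)).add
            ((dβ 1).sq.div ((dφ 1).mul (dp 1).sq) (mul_ne_zero h1 (pow_ne_zero 2 h2))))))]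
    simp only [explicitSystem, Matrix.cons_val_zero]
    simp only [ss_dir1_one, phi_dir1, phi_t_dir1, phi_s_dir1, psi_s_dir1, chi_s_dir1]
    field_simp
    ring
  · rw [key 0 _ _ _ (fun y hy => dP_lagrangian hγ hy 1 0)
        ((dφ 0).sq.mul (hasDir_psi_t w.1 (dir1 0 w))),
      key 1 _ _ _ (fun y hy => dP_lagrangian hγ hy 1 1)
        ((HasDir.const (- A ^ 2) w.1 _).mul
          (((dφ 1).mul (dα 1)).div (dp 1) h2))]
    simp only [explicitSystem, Matrix.cons_val_one, Matrix.cons_val_zero]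
    simp only [phi_dir1, phi_s_dir1, psi_s_dir1, psi_t_dir1]
    field_simp
    ring
  · rw [key 0 _ _ _ (fun y hy => dP_lagrangian hγ hy 2 0) (hasDir_chi_t w.1 (dir1 0 w)),
      key 1 _ _ _ (fun y hy => dP_lagrangian hγ hy 2 1)
        ((HasDir.const (- A ^ 2) w.1 _).mul ((dβ 1).div ((dφ 1).mul (dp 1)) (mul_ne_zero h1 h2)))]
    simp only [explicitSystem, Matrix.cons_val]
    simp only [phi_dir1, phi_s_dir1, chi_t_dir1, chi_s_dir1]
    field_simp
    ring

end CylMHD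

end

noncomputable section

namespace CylMHD

variable {A γ : ℝ} {S : ℝ → ℝ} {w v : J2} {z : J1} {y : J0} {X : VF} {f g : J0 → ℝ} {Ω : Set J0}

/-! ### First and second derivatives of functions on `J0` -/

theorem two_le_infty : (2 : WithTop ℕ∞) ≤ ∞ :=
  show ((2 : ℕ∞) : WithTop ℕ∞) ≤ _ from WithTop.coe_le_coe.2 le_top

/-- The coordinate direction of the `i`-th independent variable. -/
def ex (i : Fin 2) : J0 := (Pi.single i 1, 0)

/-- The coordinate direction of the `k`-th dependent variable. -/
def eu (k : Fin 3) : J0 := (0, Pi.single k 1)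

theorem clm_apply_eq (L : J0 →L[ℝ] ℝ) (v : J0) :
    L v = v.1 0 * L (ex 0) + v.1 1 * L (ex 1)
      + (v.2 0 * L (eu 0) + v.2 1 * L (eu 1) + v.2 2 * L (eu 2)) := by
  have h : v = v.1 0 • ex 0 + v.1 1 • ex 1 + (v.2 0 • eu 0 + v.2 1 • eu 1 + v.2 2 • eu 2) := by
    ext i <;> fin_cases i <;> simp [ex, eu]
  conv_lhs => rw [h]
  simp only [map_add, map_smul, smul_eq_mul]

theorem clm_dir0 (L : J0 →L[ℝ] ℝ) (i : Fin 2) (z : J1) :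
    L (dir0 i z) = L (ex i) + z.2 0 i * L (eu 0) + z.2 1 i * L (eu 1) + z.2 2 i * L (eu 2) := by
  rw [clm_apply_eq]
  fin_cases i <;> simp [dir0] <;> ring

theorem clm_eq_zero {L : J0 →L[ℝ] ℝ} (h : ∀ i, L (ex i) = 0) (h' : ∀ k, L (eu k) = 0) : L = 0 := by
  refine ContinuousLinearMap.ext fun v => ?_
  rw [clm_apply_eq]
  simp [h, h']

theorem D0_eq (i : Fin 2) (f : J0 → ℝ) (z : J1) : D0 i f z = fderiv ℝ f z.1 (dir0 i z) := rfl

/-- The second derivative of `f`, first in the direction `u` and then in the direction `v`. -/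
def hess (f : J0 → ℝ) (y u v : J0) : ℝ := fderiv ℝ (fderiv ℝ f) y v u

theorem hess_dir0 (f : J0 → ℝ) (y : J0) (i : Fin 2) (z : J1) (v : J0) :
    hess f y (dir0 i z) v = hess f y (ex i) v + z.2 0 i * hess f y (eu 0) v
      + z.2 1 i * hess f y (eu 1) v + z.2 2 i * hess f y (eu 2) v :=
  clm_dir0 (fderiv ℝ (fderiv ℝ f) y v) i z

theorem hasDir_fderiv (hf : ContDiffAt ℝ ∞ f y) (u v : J0) :
    HasDir (fun y => fderiv ℝ f y u) y v (hess f y u v) := by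
  have h1 : DifferentiableAt ℝ (fderiv ℝ f) y :=
    (hf.fderiv_right (m := 1) (by simpa [one_add_one_eq_two] using two_le_infty)).differentiableAt (by norm_num)
  refine ⟨_, h1.hasFDerivAt.clm_apply (hasFDerivAt_const u y), ?_⟩
  simp [hess]

theorem hess_comm (hf : ContDiffAt ℝ ∞ f y) (u v : J0) : hess f y u v = hess f y v u :=
  (hf.isSymmSndFDerivAt (by simpa using two_le_infty)) v u

/-- If the derivative of `f` in the direction `u` is known on an open set, so is its derivative. -/
theorem hess_eq_of_hasDir (hΩ : IsOpen Ω) (hf : ContDiffOn ℝ ∞ f Ω) (hy : y ∈ Ω) {u v : J0} {d : ℝ}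
    (h : ∀ x ∈ Ω, fderiv ℝ f x u = g x) (hg : HasDir g y v d) : hess f y u v = d := by
  have h1 := hasDir_fderiv (hf.contDiffAt (hΩ.mem_nhds hy)) u v
  exact h1.fderiv_eq.symm.trans (hg.congr_fun
    (Filter.eventually_of_mem (hΩ.mem_nhds hy) h)).fderiv_eq

theorem hess_eq_zero (hΩ : IsOpen Ω) (hf : ContDiffOn ℝ ∞ f Ω) (hy : y ∈ Ω) {u : J0} {c : ℝ}
    (h : ∀ x ∈ Ω, fderiv ℝ f x u = c) (v : J0) : hess f y u v = 0 :=
  hess_eq_of_hasDir hΩ hf hy h (HasDir.const c y v)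

/-! ### Prolongation formulas -/

theorem contDiffOn_xi (hX : ContDiffOn ℝ ∞ X Ω) (i : Fin 2) : ContDiffOn ℝ ∞ (VF.xi X i) Ω :=
  contDiffOn_pi.1 hX.fst i

theorem contDiffOn_eta (hX : ContDiffOn ℝ ∞ X Ω) (k : Fin 3) : ContDiffOn ℝ ∞ (VF.eta X k) Ω :=
  contDiffOn_pi.1 hX.snd k

/-- `D_i f` is affine in the first derivatives with coefficients on `J0`. The product rule gives one
term from moving the base point and one from varying the direction `dir0 i z`. -/
theorem hasDir_D0 (hf : ContDiffAt ℝ ∞ f z.1) (i : Fin 2) (v : J1) :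
    HasDir (fun z => D0 i f z) z v
      (hess f z.1 (dir0 i z) v.1 + ∑ k, v.2 k i * fderiv ℝ f z.1 (eu k)) := by
  have h1 : ∀ u, HasDir (fun z : J1 => fderiv ℝ f z.1 u) z v (hess f z.1 u v.1) :=
    fun u => (hasDir_fderiv hf u v.1).lift0
  have e : (fun z : J1 => D0 i f z) = fun z => fderiv ℝ f z.1 (ex i)
      + z.2 0 i * fderiv ℝ f z.1 (eu 0) + z.2 1 i * fderiv ℝ f z.1 (eu 1)
      + z.2 2 i * fderiv ℝ f z.1 (eu 2) := funext fun z => clm_dir0 _ i z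
  rw [e, hess_dir0 _ _ i]
  refine ((((h1 (ex i)).add ((hasDir_p 0 i z v).mul (h1 (eu 0)))).add
    ((hasDir_p 1 i z v).mul (h1 (eu 1)))).add ((hasDir_p 2 i z v).mul (h1 (eu 2)))).congr_val ?_
  rw [Fin.sum_univ_three]
  ring

theorem zeta2_eq (hX : ContDiffAt ℝ ∞ X w.1.1) (k : Fin 3) (i j : Fin 2) :
    zeta2 X k i j w = hess (VF.eta X k) w.1.1 (dir0 i w.1) (dir0 j w.1)
      + ∑ m, w.2 m i j * fderiv ℝ (VF.eta X k) w.1.1 (eu m)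
      - ∑ l, (w.2 k l j * fderiv ℝ (VF.xi X l) w.1.1 (dir0 i w.1)
        + w.1.2 k l * (hess (VF.xi X l) w.1.1 (dir0 i w.1) (dir0 j w.1)
          + ∑ m, w.2 m i j * fderiv ℝ (VF.xi X l) w.1.1 (eu m)))
      - ∑ l, w.2 k i l * fderiv ℝ (VF.xi X l) w.1.1 (dir0 j w.1) := by
  have hxi : ∀ l, ContDiffAt ℝ ∞ (VF.xi X l) w.1.1 := contDiffAt_pi.1 hX.fst
  have heta : ContDiffAt ℝ ∞ (VF.eta X k) w.1.1 := contDiffAt_pi.1 hX.snd k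
  have h := ((hasDir_D0 heta i (dir1 j w)).sub (HasDir.sum Finset.univ fun l _ =>
    (hasDir_p k l w.1 (dir1 j w)).mul (hasDir_D0 (hxi l) i (dir1 j w)))).D1_eq
  rw [zeta2, show zeta1 X k i = fun z => D0 i (VF.eta X k) z - ∑ l, z.2 k l * D0 i (VF.xi X l) z
    from rfl, h]
  rfl

/-- The equations contain no mixed second derivatives, so only the diagonal coefficients `ζ^k_{ii}`
ever enter the criterion. -/
theorem zeta2_diag (hX : ContDiffAt ℝ ∞ X w.1.1) (k : Fin 3) (i : Fin 2) :
    zeta2 X k i i w = hess (VF.eta X k) w.1.1 (dir0 i w.1) (dir0 i w.1)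
      + (w.2 0 i i * fderiv ℝ (VF.eta X k) w.1.1 (eu 0)
        + w.2 1 i i * fderiv ℝ (VF.eta X k) w.1.1 (eu 1)
        + w.2 2 i i * fderiv ℝ (VF.eta X k) w.1.1 (eu 2))
      - w.1.2 k 0 * (hess (VF.xi X 0) w.1.1 (dir0 i w.1) (dir0 i w.1)
        + (w.2 0 i i * fderiv ℝ (VF.xi X 0) w.1.1 (eu 0)
          + w.2 1 i i * fderiv ℝ (VF.xi X 0) w.1.1 (eu 1)
          + w.2 2 i i * fderiv ℝ (VF.xi X 0) w.1.1 (eu 2)))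
      - w.1.2 k 1 * (hess (VF.xi X 1) w.1.1 (dir0 i w.1) (dir0 i w.1)
        + (w.2 0 i i * fderiv ℝ (VF.xi X 1) w.1.1 (eu 0)
          + w.2 1 i i * fderiv ℝ (VF.xi X 1) w.1.1 (eu 1)
          + w.2 2 i i * fderiv ℝ (VF.xi X 1) w.1.1 (eu 2)))
      - (w.2 k 0 i + w.2 k i 0) * fderiv ℝ (VF.xi X 0) w.1.1 (dir0 i w.1)
      - (w.2 k 1 i + w.2 k i 1) * fderiv ℝ (VF.xi X 1) w.1.1 (dir0 i w.1) := by
  rw [zeta2_eq hX]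
  simp only [Fin.sum_univ_two, Fin.sum_univ_three]
  ring

/-! ### Regions -/

theorem IsRegion.isOpen_sRange (h : IsRegion Ω) : IsOpen (sRange Ω) :=
  (((isOpenMap_eval (1 : Fin 2)).comp isOpenMap_fst) :
    IsOpenMap fun y : J0 => y.1 1) Ω h.isOpen

theorem IsRegion.isPreconnected_sRange (h : IsRegion Ω) : IsPreconnected (sRange Ω) :=
  h.isConnected.isPreconnected.image _ (by fun_prop)

theorem IsRegion.nonempty_sRange (h : IsRegion Ω) : (sRange Ω).Nonempty :=
  h.isConnected.nonempty.image _

theorem IsEntropy.contDiffAt (h : IsRegion Ω) (hS : IsEntropy Ω S) {s : ℝ} (hs : s ∈ sRange Ω) :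
    ContDiffAt ℝ ∞ S s := hS.1.contDiffAt (h.isOpen_sRange.mem_nhds hs)

theorem IsEntropy.regular (h : IsRegion Ω) (hS : IsEntropy Ω S) (hz : z ∈ adm1 Ω) : Regular S z where
  phi_pos := h.pos _ hz.1
  phi_s_pos := hz.2
  contDiffAt := (hS.contDiffAt h ⟨_, hz.1, rfl⟩).of_le two_le_infty

/-- The symmetry criterion with explicit derivatives. -/
theorem isSymmetry_iff (h : IsRegion Ω) (hS : IsEntropy Ω S) :
    IsSymmetry Ω (system A γ S) X ↔ ContDiffOn ℝ ∞ X Ω ∧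
      ∀ w ∈ adm2 Ω, (∀ k, explicitSystem A γ S k w = 0) →
        ∀ k, linearizedSystem A γ S k w (pr2 X w) = 0 := by
  refine and_congr_right fun _ => forall₂_congr fun w hw => ?_
  have hr := hS.regular h hw.1
  simp only [system_eq_explicit hr, (hasDir_system hr _).fderiv_eq]

/-- Connectedness of the region is what makes the parameters of a symmetry global constants. -/
theorem eq_const_of_fderiv_eq_zero (h : IsRegion Ω) (hf : ContDiffOn ℝ ∞ f Ω)
    (h1 : ∀ y ∈ Ω, ∀ i, fderiv ℝ f y (ex i) = 0) (h2 : ∀ y ∈ Ω, ∀ k, fderiv ℝ f y (eu k) = 0) :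
    ∃ c, ∀ y ∈ Ω, f y = c :=
  h.isOpen.exists_is_const_of_fderiv_eq_zero h.isConnected.isPreconnected
    (hf.differentiableOn (by simp)) fun y hy => clm_eq_zero (h1 y hy) (h2 y hy)

end CylMHD

end

noncomputable section

namespace CylMHD

variable {A γ : ℝ} {S : ℝ → ℝ} {w v : J2} {z : J1} {y : J0} {X : VF} {f g : J0 → ℝ} {Ω : Set J0}

/-! ### Jets on the solution manifold -/

/-- The first-order jet with given derivatives in `t` and in `s`. -/
def jet1 (y : J0) (a b c p α β : ℝ) : J1 := (y, ![![a, p], ![b, α], ![c, β]])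

/-- The symmetric second-order jet over `z` with pure `t`, mixed and pure `s` derivatives
`T`, `m`, `n`. -/
def jet2 (z : J1) (T m n : Fin 3 → ℝ) : J2 := (z, fun k => ![![T k, m k], ![m k, n k]])

/-- The second `t`-derivatives on the solution manifold. -/
def accel (A γ : ℝ) (S : ℝ → ℝ) (z : J1) (n : Fin 3 → ℝ) : Fin 3 → ℝ :=
  ![phi z * psi_t z ^ 2
      - (phi z / (phi z ^ γ * phi_s z ^ γ) * (deriv S (ss z)
        - γ * S (ss z) * (phi_s z / phi z + n 0 / phi_s z))
      + A ^ 2 * (psi_s z ^ 2 / phi_s z + phi z * psi_s z * n 1 / phi_s z ^ 2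
        - phi z * psi_s z ^ 2 * n 0 / phi_s z ^ 3)
      + A ^ 2 * (chi_s z * n 2 / (phi z * phi_s z ^ 2)
        - chi_s z ^ 2 / (phi z ^ 2 * phi_s z)
        - chi_s z ^ 2 * n 0 / (phi z * phi_s z ^ 3))),
    (A ^ 2 * (psi_s z / phi z + n 1 / phi_s z - psi_s z * n 0 / phi_s z ^ 2)
      - 2 * phi_t z * psi_t z) / phi z,
    A ^ 2 * (n 2 / (phi z * phi_s z) - chi_s z / phi z ^ 2
      - chi_s z * n 0 / (phi z * phi_s z ^ 2))]

/-- Each equation is linear in its own second `t`-derivative, with coefficient `1`, `φ` or `1`. The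
solution manifold is therefore a graph over the remaining jet coordinates. -/
theorem explicitSystem_accel (hz : phi z ≠ 0) (m n : Fin 3 → ℝ) (k : Fin 3) :
    explicitSystem A γ S k (jet2 z (accel A γ S z n) m n) = 0 := by
  fin_cases k
  · simp [explicitSystem, jet2, accel]
    ring
  · have hz : z.1.2 0 ≠ 0 := hz
    simp [explicitSystem, jet2, accel, phi]
    field_simp
    ring
  · simp [explicitSystem, jet2, accel]

theorem jet2_mem (hz : z ∈ adm1 Ω) (T m n : Fin 3 → ℝ) : jet2 z T m n ∈ adm2 Ω := by
  refine ⟨hz, fun k i j => ?_⟩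
  fin_cases i <;> fin_cases j <;> simp [jet2]

theorem jet1_mem (hy : y ∈ Ω) (a b c : ℝ) {p : ℝ} (hp : 0 < p) (α β : ℝ) :
    jet1 y a b c p α β ∈ adm1 Ω := ⟨hy, hp⟩

/-- Mixed derivatives enter `ζ^k_{tt}` only through `-2 u^k_{ts} D_t ξ^s`, and `ζ^k_{ss}` only
through `-2 u^k_{ts} D_s ξ^t`. -/
theorem zeta2_jet2 (hX : ContDiffAt ℝ ∞ X z.1) (T m n : Fin 3 → ℝ) (k : Fin 3) (i : Fin 2) :
    zeta2 X k i i (jet2 z T m n) = zeta2 X k i i (jet2 z T 0 n)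
      - 2 * m k * (![D0 0 (VF.xi X 1) z, D0 1 (VF.xi X 0) z] : Fin 2 → ℝ) i := by
  rw [zeta2_diag (w := jet2 z T m n) hX, zeta2_diag (w := jet2 z T 0 n) hX]
  simp only [D0_eq]
  fin_cases i
  · simp only [jet2, Fin.zero_eta, Matrix.cons_val_zero, Matrix.cons_val_one, Pi.zero_apply]
    ring
  · simp only [jet2, Fin.mk_one, Matrix.cons_val_zero, Matrix.cons_val_one, Pi.zero_apply]
    ring

/-- The determining equations of a symmetry. -/
def Determining (A γ : ℝ) (S : ℝ → ℝ) (X : VF) (z : J1) : Prop :=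
  ∀ (m n : Fin 3 → ℝ) (k : Fin 3), linearizedSystem A γ S k (jet2 z (accel A γ S z n) m n)
    (pr2 X (jet2 z (accel A γ S z n) m n)) = 0

theorem IsSymmetry.determining (h : IsRegion Ω) (hS : IsEntropy Ω S)
    (hX : IsSymmetry Ω (system A γ S) X) (hz : z ∈ adm1 Ω) : Determining A γ S X z :=
  fun m n k => ((isSymmetry_iff h hS).1 hX).2 _ (jet2_mem hz _ m n)
    (explicitSystem_accel (h.pos _ hz.1).ne' m n) k

theorem pr2_snd (X : VF) (w : J2) (k : Fin 3) (i j : Fin 2) :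
    (pr2 X w).2 k i j = zeta2 X k i j w := rfl
theorem ss_pr2 (X : VF) (w : J2) : ss (pr2 X w).1 = VF.xi X 1 w.1.1 := rfl
theorem phi_pr2 (X : VF) (w : J2) : phi (pr2 X w).1 = VF.eta X 0 w.1.1 := rfl
theorem phi_t_pr2 (X : VF) (w : J2) : phi_t (pr2 X w).1 = zeta1 X 0 0 w.1 := rfl
theorem phi_s_pr2 (X : VF) (w : J2) : phi_s (pr2 X w).1 = zeta1 X 0 1 w.1 := rfl
theorem psi_t_pr2 (X : VF) (w : J2) : psi_t (pr2 X w).1 = zeta1 X 1 0 w.1 := rfl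
theorem psi_s_pr2 (X : VF) (w : J2) : psi_s (pr2 X w).1 = zeta1 X 1 1 w.1 := rfl
theorem chi_s_pr2 (X : VF) (w : J2) : chi_s (pr2 X w).1 = zeta1 X 2 1 w.1 := rfl

/-! ### The independent variables are transformed among themselves -/

/-- Subtracting the `χ`-equation at `m = 0` from the one at a general `m` leaves the part linear in
the mixed derivatives. Its `φ_{ts}` coefficient gives the first relation, its `χ_{ts}` coefficient
the second. -/
theorem Determining.mixed (hA : A ≠ 0) (hX : ContDiffAt ℝ ∞ X z.1) (h1 : 0 < phi z)
    (h2 : 0 < phi_s z) (h : Determining A γ S X z) :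
    chi_s z * D0 1 (VF.xi X 0) z = 0 ∧
      D0 0 (VF.xi X 1) z * (phi z * phi_s z) = A ^ 2 * D0 1 (VF.xi X 0) z := by
  have key : ∀ m : Fin 3 → ℝ, m 2 * D0 0 (VF.xi X 1) z * (phi z * phi_s z ^ 2) =
      A ^ 2 * D0 1 (VF.xi X 0) z * (m 2 * phi_s z - chi_s z * m 0) := by
    intro m
    have e1 := h m 0 2
    have e2 := h 0 0 2
    simp only [linearizedSystem, Matrix.cons_val, pr2_snd, phi_pr2, phi_s_pr2, chi_s_pr2] at e1 e2
    rw [zeta2_jet2 hX _ m, zeta2_jet2 hX _ m, zeta2_jet2 hX _ m] at e1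
    simp only [jet2, Pi.zero_apply, Matrix.cons_val_zero,
      Matrix.cons_val_one] at e1 e2
    have h1 := h1.ne'
    have h2 := h2.ne'
    linear_combination (norm := skip) (-(phi z * phi_s z ^ 2) / 2) * e1 +
      (phi z * phi_s z ^ 2) / 2 * e2
    field_simp
    ring
  have k0 := key ![1, 0, 0]
  have k2 := key ![0, 0, 1]
  simp [hA] at k0 k2
  refine ⟨by rcases k0 with k0 | k0 <;> simp [k0], mul_right_cancel₀ h2.ne' ?_⟩
  linear_combination k2

/-- The independent variables are transformed by themselves: `ξ^t` depends on `t` only and `ξ^s`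
on `s` only. -/
structure Separated (Ω : Set J0) (X : VF) : Prop where
  xi_t_s : ∀ y ∈ Ω, fderiv ℝ (VF.xi X 0) y (ex 1) = 0
  xi_t_u : ∀ y ∈ Ω, ∀ k, fderiv ℝ (VF.xi X 0) y (eu k) = 0
  xi_s_t : ∀ y ∈ Ω, fderiv ℝ (VF.xi X 1) y (ex 0) = 0
  xi_s_u : ∀ y ∈ Ω, ∀ k, fderiv ℝ (VF.xi X 1) y (eu k) = 0

theorem D0_jet1_zero (f : J0 → ℝ) (y : J0) (a b c p α β : ℝ) :
    D0 0 f (jet1 y a b c p α β) = fderiv ℝ f y (ex 0) + a * fderiv ℝ f y (eu 0)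
      + b * fderiv ℝ f y (eu 1) + c * fderiv ℝ f y (eu 2) := by
  rw [D0_eq, clm_dir0]; rfl

theorem D0_jet1_one (f : J0 → ℝ) (y : J0) (a b c p α β : ℝ) :
    D0 1 f (jet1 y a b c p α β) = fderiv ℝ f y (ex 1) + p * fderiv ℝ f y (eu 0)
      + α * fderiv ℝ f y (eu 1) + β * fderiv ℝ f y (eu 2) := by
  rw [D0_eq, clm_dir0]; rfl

/-- Where `χ_s ≠ 0`, `Determining.mixed` makes both `D_s ξ^t` and `D_t ξ^s` vanish. They are affine
in the first derivatives, so finitely many jets recover the partial derivatives of `ξ^t` and `ξ^s`.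
-/
theorem IsSymmetry.separated (hA : A ≠ 0) (h : IsRegion Ω) (hS : IsEntropy Ω S)
    (hX : IsSymmetry Ω (system A γ S) X) : Separated Ω X := by
  have key : ∀ y ∈ Ω, ∀ a b c p α β : ℝ, 0 < p → β ≠ 0 →
      D0 1 (VF.xi X 0) (jet1 y a b c p α β) = 0 ∧
        D0 0 (VF.xi X 1) (jet1 y a b c p α β) = 0 := by
    intro y hy a b c p α β hp hβ
    obtain ⟨e1, e2⟩ := (hX.determining h hS (jet1_mem hy a b c hp α β)).mixed hA
      (hX.1.contDiffAt (h.isOpen.mem_nhds hy)) (h.pos y hy) hp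
    have e3 := (mul_eq_zero.1 e1).resolve_left hβ
    rw [e3, mul_zero] at e2
    exact ⟨e3, (mul_eq_zero.1 e2).resolve_right (mul_pos (h.pos y hy) hp).ne'⟩
  -- Four affinely independent choices both of `(a, b, c)` and of `(p, α, β)`, within `p > 0` and `β
  -- ≠ 0`.
  have k0 : ∀ y ∈ Ω, _ := fun y hy => (key y hy 0 0 0 1 0 1 one_pos one_ne_zero)
  have k1 : ∀ y ∈ Ω, _ := fun y hy => (key y hy 1 0 0 2 0 1 two_pos one_ne_zero)
  have k2 : ∀ y ∈ Ω, _ := fun y hy => (key y hy 0 1 0 1 1 1 one_pos one_ne_zero)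
  have k3 : ∀ y ∈ Ω, _ := fun y hy => (key y hy 0 0 1 1 0 2 one_pos two_ne_zero)
  simp only [D0_jet1_zero, D0_jet1_one] at k0 k1 k2 k3
  refine ⟨fun y hy => ?_, fun y hy k => ?_, fun y hy => ?_, fun y hy k => ?_⟩
  · linear_combination 3 * (k0 y hy).1 - (k1 y hy).1 - (k3 y hy).1
  · fin_cases k <;> simp only [Fin.zero_eta, Fin.mk_one, Fin.reduceFinMk]
    · linear_combination (k1 y hy).1 - (k0 y hy).1
    · linear_combination (k2 y hy).1 - (k0 y hy).1
    · linear_combination (k3 y hy).1 - (k0 y hy).1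
  · linear_combination (k0 y hy).2
  · fin_cases k <;> simp only [Fin.zero_eta, Fin.mk_one, Fin.reduceFinMk]
    · linear_combination (k1 y hy).2 - (k0 y hy).2
    · linear_combination (k2 y hy).2 - (k0 y hy).2
    · linear_combination (k3 y hy).2 - (k0 y hy).2

theorem Separated.D0_xi (hs : Separated Ω X) (hz : z.1 ∈ Ω) : D0 0 (VF.xi X 0) z = fderiv ℝ (VF.xi X 0) z.1 (ex 0) ∧
    D0 1 (VF.xi X 0) z = 0 ∧ D0 0 (VF.xi X 1) z = 0 ∧
    D0 1 (VF.xi X 1) z = fderiv ℝ (VF.xi X 1) z.1 (ex 1) := by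
  simp only [D0_eq, clm_dir0, hs.xi_t_s _ hz, hs.xi_t_u _ hz, hs.xi_s_t _ hz, hs.xi_s_u _ hz]
  simp

theorem Separated.zeta1_t (hs : Separated Ω X) (hz : z.1 ∈ Ω) (k : Fin 3) : zeta1 X k 0 z =
    D0 0 (VF.eta X k) z - z.2 k 0 * fderiv ℝ (VF.xi X 0) z.1 (ex 0) := by
  obtain ⟨e1, -, e3, -⟩ := hs.D0_xi hz
  rw [zeta1, Fin.sum_univ_two, e1, e3]
  ring

theorem Separated.zeta1_s (hs : Separated Ω X) (hz : z.1 ∈ Ω) (k : Fin 3) : zeta1 X k 1 z =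
    D0 1 (VF.eta X k) z - z.2 k 1 * fderiv ℝ (VF.xi X 1) z.1 (ex 1) := by
  obtain ⟨-, e2, -, e4⟩ := hs.D0_xi hz
  rw [zeta1, Fin.sum_univ_two, e2, e4]
  ring

/-- Four of the five first derivatives vanish on an open set, so by symmetry the Hessian has a
single entry. -/
theorem Separated.hess_xi_t (h : IsRegion Ω) (hX : ContDiffOn ℝ ∞ X Ω) (hs : Separated Ω X)
    (hy : y ∈ Ω) (u v : J0) : hess (VF.xi X 0) y u v =
      u.1 0 * v.1 0 * hess (VF.xi X 0) y (ex 0) (ex 0) := by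
  have h1 := contDiffOn_xi hX 0
  have h2 : ∀ v, hess (VF.xi X 0) y (ex 1) v = 0 := hess_eq_zero h.isOpen h1 hy hs.xi_t_s
  have h3 : ∀ k v, hess (VF.xi X 0) y (eu k) v = 0 :=
    fun k => hess_eq_zero h.isOpen h1 hy fun x hx => hs.xi_t_u x hx k
  have h4 : ∀ u v, hess (VF.xi X 0) y u v = u.1 0 * hess (VF.xi X 0) y (ex 0) v := fun u v => by
    have := clm_apply_eq (fderiv ℝ (fderiv ℝ (VF.xi X 0)) y v) u
    simp only [hess] at h2 h3 ⊢
    rw [this, h2, h3, h3, h3]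
    ring
  have hc := hess_comm (h1.contDiffAt (h.isOpen.mem_nhds hy))
  rw [h4, hc, h4]
  ring

theorem Separated.hess_xi_s (h : IsRegion Ω) (hX : ContDiffOn ℝ ∞ X Ω) (hs : Separated Ω X)
    (hy : y ∈ Ω) (u v : J0) : hess (VF.xi X 1) y u v =
      u.1 1 * v.1 1 * hess (VF.xi X 1) y (ex 1) (ex 1) := by
  have h1 := contDiffOn_xi hX 1
  have h2 : ∀ v, hess (VF.xi X 1) y (ex 0) v = 0 := hess_eq_zero h.isOpen h1 hy hs.xi_s_t
  have h3 : ∀ k v, hess (VF.xi X 1) y (eu k) v = 0 :=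
    fun k => hess_eq_zero h.isOpen h1 hy fun x hx => hs.xi_s_u x hx k
  have h4 : ∀ u v, hess (VF.xi X 1) y u v = u.1 1 * hess (VF.xi X 1) y (ex 1) v := fun u v => by
    have := clm_apply_eq (fderiv ℝ (fderiv ℝ (VF.xi X 1)) y v) u
    simp only [hess] at h2 h3 ⊢
    rw [this, h2, h3, h3, h3]
    ring
  have hc := hess_comm (h1.contDiffAt (h.isOpen.mem_nhds hy))
  rw [h4, hc, h4]
  ring

theorem Separated.zeta2_tt (h : IsRegion Ω) (hX : ContDiffOn ℝ ∞ X Ω) (hs : Separated Ω X)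
    (hz : z.1 ∈ Ω) (T n : Fin 3 → ℝ) (k : Fin 3) : zeta2 X k 0 0 (jet2 z T 0 n) =
      hess (VF.eta X k) z.1 (dir0 0 z) (dir0 0 z) + (T 0 * fderiv ℝ (VF.eta X k) z.1 (eu 0)
        + T 1 * fderiv ℝ (VF.eta X k) z.1 (eu 1) + T 2 * fderiv ℝ (VF.eta X k) z.1 (eu 2))
      - z.2 k 0 * hess (VF.xi X 0) z.1 (ex 0) (ex 0)
      - 2 * T k * fderiv ℝ (VF.xi X 0) z.1 (ex 0) := by
  obtain ⟨e1, -, e3, -⟩ := hs.D0_xi hz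
  rw [D0_eq] at e1 e3
  rw [zeta2_diag (w := jet2 z T 0 n) (hX.contDiffAt (h.isOpen.mem_nhds hz))]
  simp only [jet2, hs.xi_t_u _ hz, hs.xi_s_u _ hz, hs.hess_xi_t h hX hz (dir0 0 z),
    hs.hess_xi_s h hX hz (dir0 0 z), e1, e3,
    show (dir0 0 z).1 = Pi.single 0 1 from rfl,
    show (Pi.single 0 1 : Fin 2 → ℝ) 0 = 1 by simp,
    show (Pi.single 0 1 : Fin 2 → ℝ) 1 = 0 by simp,
    Matrix.cons_val_zero, Matrix.cons_val_one, Pi.zero_apply]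
  ring

theorem Separated.zeta2_ss (h : IsRegion Ω) (hX : ContDiffOn ℝ ∞ X Ω) (hs : Separated Ω X)
    (hz : z.1 ∈ Ω) (T n : Fin 3 → ℝ) (k : Fin 3) : zeta2 X k 1 1 (jet2 z T 0 n) =
      hess (VF.eta X k) z.1 (dir0 1 z) (dir0 1 z) + (n 0 * fderiv ℝ (VF.eta X k) z.1 (eu 0)
        + n 1 * fderiv ℝ (VF.eta X k) z.1 (eu 1) + n 2 * fderiv ℝ (VF.eta X k) z.1 (eu 2))
      - z.2 k 1 * hess (VF.xi X 1) z.1 (ex 1) (ex 1)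
      - 2 * n k * fderiv ℝ (VF.xi X 1) z.1 (ex 1) := by
  obtain ⟨-, e2, -, e4⟩ := hs.D0_xi hz
  rw [D0_eq] at e2 e4
  rw [zeta2_diag (w := jet2 z T 0 n) (hX.contDiffAt (h.isOpen.mem_nhds hz))]
  simp only [jet2, hs.xi_t_u _ hz, hs.xi_s_u _ hz, hs.hess_xi_t h hX hz (dir0 1 z),
    hs.hess_xi_s h hX hz (dir0 1 z), e2, e4,
    show (dir0 1 z).1 = Pi.single 1 1 from rfl,
    show (Pi.single 1 1 : Fin 2 → ℝ) 1 = 1 by simp,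
    show (Pi.single 1 1 : Fin 2 → ℝ) 0 = 0 by simp,
    Matrix.cons_val_zero, Matrix.cons_val_one, Pi.zero_apply]
  ring

end CylMHD

end

noncomputable section

namespace CylMHD

variable {A γ : ℝ} {S : ℝ → ℝ} {w v : J2} {z : J1} {y : J0} {X : VF} {f g : J0 → ℝ} {Ω : Set J0}

/-! ### Determining equations from the coefficients of the second derivatives in `s` -/

/-- The `coeff_` lemmas share one method: subtract a determining equation at `n = 0` from the same
equation at a unit vector `n`. This isolates the coefficient of one second `s`-derivative; the name
gives the equation first, then the variable differentiated twice. Here `α` and `β` are free, so the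
identity decouples `η^χ` from `φ` and `η^φ` from `ψ`. -/
theorem IsSymmetry.coeff_chi_psi (hA : A ≠ 0) (h : IsRegion Ω) (hS : IsEntropy Ω S)
    (hX : IsSymmetry Ω (system A γ S) X) (hs : Separated Ω X) (hy : y ∈ Ω) (α β : ℝ) :
    y.2 0 ^ 2 * α * fderiv ℝ (VF.eta X 2) y (eu 0) = β * fderiv ℝ (VF.eta X 0) y (eu 1) := by
  have hφ := (h.pos y hy).ne'
  have hz : jet1 y 0 0 0 1 α β ∈ adm1 Ω := jet1_mem hy 0 0 0 one_pos α β
  have e1 := hX.determining h hS hz 0 ![0, 1, 0] 2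
  have e0 := hX.determining h hS hz 0 0 2
  simp only [linearizedSystem, Matrix.cons_val, Matrix.cons_val_zero, Matrix.cons_val_one, pr2_snd,
    ss_pr2, phi_pr2, phi_t_pr2, phi_s_pr2, psi_t_pr2, psi_s_pr2, chi_s_pr2,
    hs.zeta2_tt h hX.1 hz.1, hs.zeta2_ss h hX.1 hz.1] at e1 e0
  simp only [jet2, hs.zeta1_t hz.1, hs.zeta1_s hz.1, D0_jet1_one, D0_jet1_zero] at e1 e0
  simp [accel, jet1, phi, phi_s, phi_t, psi_t, psi_s, chi_s, ss] at e1 e0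
  refine mul_left_cancel₀ (pow_ne_zero 2 hA) ?_
  linear_combination (norm := skip) (-y.2 0) * e1 - (-y.2 0) * e0
  field_simp
  ring


theorem IsSymmetry.coeff_psi_chi (hA : A ≠ 0) (h : IsRegion Ω) (hS : IsEntropy Ω S)
    (hX : IsSymmetry Ω (system A γ S) X) (hs : Separated Ω X) (hy : y ∈ Ω) (α β : ℝ) :
    α * fderiv ℝ (VF.eta X 0) y (eu 2) = β * fderiv ℝ (VF.eta X 1) y (eu 0) := by
  have hφ := (h.pos y hy).ne'
  have hz : jet1 y 0 0 0 1 α β ∈ adm1 Ω := jet1_mem hy 0 0 0 one_pos α β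
  have e1 := hX.determining h hS hz 0 ![0, 0, 1] 1
  have e0 := hX.determining h hS hz 0 0 1
  simp only [linearizedSystem, Matrix.cons_val, Matrix.cons_val_zero, Matrix.cons_val_one, pr2_snd,
    ss_pr2, phi_pr2, phi_t_pr2, phi_s_pr2, psi_t_pr2, psi_s_pr2, chi_s_pr2,
    hs.zeta2_tt h hX.1 hz.1, hs.zeta2_ss h hX.1 hz.1] at e1 e0
  simp only [jet2, hs.zeta1_t hz.1, hs.zeta1_s hz.1, D0_jet1_one, D0_jet1_zero] at e1 e0
  simp [accel, jet1, phi, phi_s, phi_t, psi_t, psi_s, chi_s, ss] at e1 e0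
  refine mul_left_cancel₀ (pow_ne_zero 2 hA) ?_
  linear_combination (norm := skip) (1) * e1 - (1) * e0
  field_simp
  ring


/-- The slope `φ_s = p` is kept free, so that the parts of degree `0` and `1` in `p` can be
separated. -/
theorem IsSymmetry.coeff_psi_psi (hA : A ≠ 0) (h : IsRegion Ω) (hS : IsEntropy Ω S)
    (hX : IsSymmetry Ω (system A γ S) X) (hs : Separated Ω X) (hy : y ∈ Ω) {p : ℝ} (hp : 0 < p) :
    p * (VF.eta X 0 y + y.2 0 * fderiv ℝ (VF.eta X 0) y (eu 0)
      - (2 * fderiv ℝ (VF.xi X 0) y (ex 0) - fderiv ℝ (VF.xi X 1) y (ex 1)) * y.2 0)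
      + y.2 0 * fderiv ℝ (VF.eta X 0) y (ex 1) = 0 := by
  have hφ := (h.pos y hy).ne'
  have hp' := hp.ne'
  have hz : jet1 y 0 0 0 p 0 0 ∈ adm1 Ω := jet1_mem hy 0 0 0 hp 0 0
  have e1 := hX.determining h hS hz 0 ![0, 1, 0] 1
  have e0 := hX.determining h hS hz 0 0 1
  simp only [linearizedSystem, Matrix.cons_val, Matrix.cons_val_zero, Matrix.cons_val_one, pr2_snd,
    ss_pr2, phi_pr2, phi_t_pr2, phi_s_pr2, psi_t_pr2, psi_s_pr2, chi_s_pr2,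
    hs.zeta2_tt h hX.1 hz.1, hs.zeta2_ss h hX.1 hz.1] at e1 e0
  simp only [jet2, hs.zeta1_t hz.1, hs.zeta1_s hz.1, D0_jet1_one, D0_jet1_zero] at e1 e0
  simp [accel, jet1, phi, phi_s, phi_t, psi_t, psi_s, chi_s, ss] at e1 e0
  refine mul_left_cancel₀ (pow_ne_zero 2 hA) ?_
  linear_combination (norm := skip) (p^2*y.2 0) * e1 - (p^2*y.2 0) * e0
  field_simp
  ring


theorem IsSymmetry.coeff_psi_phi (hA : A ≠ 0) (h : IsRegion Ω) (hS : IsEntropy Ω S)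
    (hX : IsSymmetry Ω (system A γ S) X) (hs : Separated Ω X) (hy : y ∈ Ω)
    (h10 : fderiv ℝ (VF.eta X 1) y (eu 0) = 0) :
    fderiv ℝ (VF.eta X 1) y (ex 1) = 0 := by
  have hφ := (h.pos y hy).ne'
  have hz : jet1 y 0 0 0 1 0 0 ∈ adm1 Ω := jet1_mem hy 0 0 0 one_pos 0 0
  have e1 := hX.determining h hS hz 0 ![1, 0, 0] 1
  have e0 := hX.determining h hS hz 0 0 1
  simp only [linearizedSystem, Matrix.cons_val, Matrix.cons_val_zero, Matrix.cons_val_one, pr2_snd,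
    ss_pr2, phi_pr2, phi_t_pr2, phi_s_pr2, psi_t_pr2, psi_s_pr2, chi_s_pr2,
    hs.zeta2_tt h hX.1 hz.1, hs.zeta2_ss h hX.1 hz.1] at e1 e0
  simp only [jet2, hs.zeta1_t hz.1, hs.zeta1_s hz.1, D0_jet1_one, D0_jet1_zero] at e1 e0
  simp [accel, jet1, phi, phi_s, phi_t, psi_t, psi_s, chi_s, ss, h10] at e1 e0
  refine mul_left_cancel₀ (pow_ne_zero 2 hA) ?_
  linear_combination (norm := skip) (1) * e1 - (1) * e0
  field_simp
  ring


theorem IsSymmetry.coeff_chi_phi (hA : A ≠ 0) (h : IsRegion Ω) (hS : IsEntropy Ω S)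
    (hX : IsSymmetry Ω (system A γ S) X) (hs : Separated Ω X) (hy : y ∈ Ω)
    (h20 : fderiv ℝ (VF.eta X 2) y (eu 0) = 0) :
    fderiv ℝ (VF.eta X 2) y (ex 1) = 0 := by
  have hφ := (h.pos y hy).ne'
  have hz : jet1 y 0 0 0 1 0 0 ∈ adm1 Ω := jet1_mem hy 0 0 0 one_pos 0 0
  have e1 := hX.determining h hS hz 0 ![1, 0, 0] 2
  have e0 := hX.determining h hS hz 0 0 2
  simp only [linearizedSystem, Matrix.cons_val, Matrix.cons_val_zero, Matrix.cons_val_one, pr2_snd,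
    ss_pr2, phi_pr2, phi_t_pr2, phi_s_pr2, psi_t_pr2, psi_s_pr2, chi_s_pr2,
    hs.zeta2_tt h hX.1 hz.1, hs.zeta2_ss h hX.1 hz.1] at e1 e0
  simp only [jet2, hs.zeta1_t hz.1, hs.zeta1_s hz.1, D0_jet1_one, D0_jet1_zero] at e1 e0
  simp [accel, jet1, phi, phi_s, phi_t, psi_t, psi_s, chi_s, ss, h20] at e1 e0
  refine mul_left_cancel₀ (pow_ne_zero 2 hA) ?_
  linear_combination (norm := skip) (y.2 0) * e1 - (y.2 0) * e0
  field_simp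
  ring


/-- With the couplings already excluded, the `α`-part fixes the weight of `ψ` relative to that of
`φ`. The `β`-part ties `∂_ψ η^χ` to `∂_χ η^ψ`. -/
theorem IsSymmetry.coeff_phi_psi (hA : A ≠ 0) (h : IsRegion Ω) (hS : IsEntropy Ω S)
    (hX : IsSymmetry Ω (system A γ S) X) (hs : Separated Ω X) (hy : y ∈ Ω)
    (h01 : fderiv ℝ (VF.eta X 0) y (eu 1) = 0) (h02 : fderiv ℝ (VF.eta X 0) y (eu 2) = 0)
    (h10 : fderiv ℝ (VF.eta X 1) y (eu 0) = 0) (h20 : fderiv ℝ (VF.eta X 2) y (eu 0) = 0)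
    (h0 : fderiv ℝ (VF.eta X 0) y (ex 1) = 0) (h1 : fderiv ℝ (VF.eta X 1) y (ex 1) = 0)
    (h2 : fderiv ℝ (VF.eta X 2) y (ex 1) = 0) (α β : ℝ) :
    α * (y.2 0 * (3 * fderiv ℝ (VF.eta X 0) y (eu 0) - 2 * fderiv ℝ (VF.eta X 1) y (eu 1)
      - 2 * fderiv ℝ (VF.xi X 0) y (ex 0) + fderiv ℝ (VF.xi X 1) y (ex 1)) - VF.eta X 0 y) * y.2 0
      = β * (fderiv ℝ (VF.eta X 2) y (eu 1) + y.2 0 ^ 2 * fderiv ℝ (VF.eta X 1) y (eu 2)) := by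
  have hφ := (h.pos y hy).ne'
  have hz : jet1 y 0 0 0 1 α β ∈ adm1 Ω := jet1_mem hy 0 0 0 one_pos α β
  have e1 := hX.determining h hS hz 0 ![0, 1, 0] 0
  have e0 := hX.determining h hS hz 0 0 0
  simp only [linearizedSystem, Matrix.cons_val, Matrix.cons_val_zero, Matrix.cons_val_one, pr2_snd,
    ss_pr2, phi_pr2, phi_t_pr2, phi_s_pr2, psi_t_pr2, psi_s_pr2, chi_s_pr2,
    hs.zeta2_tt h hX.1 hz.1, hs.zeta2_ss h hX.1 hz.1] at e1 e0
  simp only [jet2, hs.zeta1_t hz.1, hs.zeta1_s hz.1, D0_jet1_one, D0_jet1_zero] at e1 e0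
  simp [accel, jet1, phi, phi_s, phi_t, psi_t, psi_s, chi_s, ss, h01, h02, h10, h20, h0, h1, h2] at e1 e0
  refine mul_left_cancel₀ (pow_ne_zero 2 hA) ?_
  linear_combination (norm := skip) (-y.2 0) * e1 - (-y.2 0) * e0
  field_simp
  ring


theorem IsSymmetry.coeff_phi_chi (hA : A ≠ 0) (h : IsRegion Ω) (hS : IsEntropy Ω S)
    (hX : IsSymmetry Ω (system A γ S) X) (hs : Separated Ω X) (hy : y ∈ Ω)
    (h01 : fderiv ℝ (VF.eta X 0) y (eu 1) = 0) (h02 : fderiv ℝ (VF.eta X 0) y (eu 2) = 0)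
    (h10 : fderiv ℝ (VF.eta X 1) y (eu 0) = 0) (h20 : fderiv ℝ (VF.eta X 2) y (eu 0) = 0)
    (h0 : fderiv ℝ (VF.eta X 0) y (ex 1) = 0) (h1 : fderiv ℝ (VF.eta X 1) y (ex 1) = 0)
    (h2 : fderiv ℝ (VF.eta X 2) y (ex 1) = 0) :
    y.2 0 * (3 * fderiv ℝ (VF.eta X 0) y (eu 0) - 2 * fderiv ℝ (VF.eta X 2) y (eu 2)
      - 2 * fderiv ℝ (VF.xi X 0) y (ex 0) + fderiv ℝ (VF.xi X 1) y (ex 1)) + VF.eta X 0 y = 0 := by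
  have hφ := (h.pos y hy).ne'
  have hz : jet1 y 0 0 0 1 0 1 ∈ adm1 Ω := jet1_mem hy 0 0 0 one_pos 0 1
  have e1 := hX.determining h hS hz 0 ![0, 0, 1] 0
  have e0 := hX.determining h hS hz 0 0 0
  simp only [linearizedSystem, Matrix.cons_val, Matrix.cons_val_zero, Matrix.cons_val_one, pr2_snd,
    ss_pr2, phi_pr2, phi_t_pr2, phi_s_pr2, psi_t_pr2, psi_s_pr2, chi_s_pr2,
    hs.zeta2_tt h hX.1 hz.1, hs.zeta2_ss h hX.1 hz.1] at e1 e0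
  simp only [jet2, hs.zeta1_t hz.1, hs.zeta1_s hz.1, D0_jet1_one, D0_jet1_zero] at e1 e0
  simp [accel, jet1, phi, phi_s, phi_t, psi_t, psi_s, chi_s, ss, h01, h02, h10, h20, h0, h1, h2] at e1 e0
  refine mul_left_cancel₀ (pow_ne_zero 2 hA) ?_
  linear_combination (norm := skip) (-y.2 0^2) * e1 - (-y.2 0^2) * e0
  field_simp
  ring


/-- At `ψ_s = χ_s = 0` the magnetic terms contribute nothing to the coefficient of `φ_{ss}`, so it
sees the pressure alone. It turns into the entropy condition once the field is known to be affine.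
-/
theorem IsSymmetry.coeff_phi_phi (h : IsRegion Ω) (hS : IsEntropy Ω S)
    (hX : IsSymmetry Ω (system A γ S) X) (hs : Separated Ω X) (hy : y ∈ Ω)
    (h01 : fderiv ℝ (VF.eta X 0) y (eu 1) = 0) (h02 : fderiv ℝ (VF.eta X 0) y (eu 2) = 0)
    (h10 : fderiv ℝ (VF.eta X 1) y (eu 0) = 0) (h20 : fderiv ℝ (VF.eta X 2) y (eu 0) = 0)
    (h0 : fderiv ℝ (VF.eta X 0) y (ex 1) = 0) (h1 : fderiv ℝ (VF.eta X 1) y (ex 1) = 0)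
    (h2 : fderiv ℝ (VF.eta X 2) y (ex 1) = 0) :
    γ * (deriv S (y.1 1) * VF.xi X 1 y * y.2 0 + S (y.1 1) * ((1 - γ) * VF.eta X 0 y
      - (γ + 1) * (fderiv ℝ (VF.eta X 0) y (eu 0) - fderiv ℝ (VF.xi X 1) y (ex 1)) * y.2 0
      + 2 * (fderiv ℝ (VF.xi X 0) y (ex 0) - fderiv ℝ (VF.xi X 1) y (ex 1)) * y.2 0)) = 0 := by
  have hφ := (h.pos y hy).ne'
  have hz : jet1 y 0 0 0 1 0 0 ∈ adm1 Ω := jet1_mem hy 0 0 0 one_pos 0 0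
  have e1 := hX.determining h hS hz 0 ![1, 0, 0] 0
  have e0 := hX.determining h hS hz 0 0 0
  simp only [linearizedSystem, Matrix.cons_val, Matrix.cons_val_zero, Matrix.cons_val_one, pr2_snd,
    ss_pr2, phi_pr2, phi_t_pr2, phi_s_pr2, psi_t_pr2, psi_s_pr2, chi_s_pr2,
    hs.zeta2_tt h hX.1 hz.1, hs.zeta2_ss h hX.1 hz.1] at e1 e0
  simp only [jet2, hs.zeta1_t hz.1, hs.zeta1_s hz.1, D0_jet1_one, D0_jet1_zero] at e1 e0
  simp [accel, jet1, phi, phi_s, phi_t, psi_t, psi_s, chi_s, ss, h01, h02, h10, h20, h0, h1, h2] at e1 e0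
  have hg := (Real.rpow_pos_of_pos (h.pos y hy) γ).ne'
  linear_combination (norm := skip) (-y.2 0 ^ γ) * e1 + (y.2 0 ^ γ) * e0
  field_simp
  ring


end CylMHD

end

noncomputable section

namespace CylMHD

variable {A γ : ℝ} {S : ℝ → ℝ} {w v : J2} {z : J1} {y : J0} {X : VF} {f g : J0 → ℝ} {Ω : Set J0}

/-! ### Affine vector fields -/

/-- The fields among which all symmetries are found. -/
def affineField (a b c d e c₁ c₂ : ℝ) : VF := fun y =>
  (![a * y.1 0 + c, b * y.1 1 + d],
    ![(a - b / 2) * y.2 0, e, (a - b / 2) * y.2 2 + c₁ * y.1 0 + c₂])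

/-- The entropy function admits the scaling `b`, `a` and the shift `d`. -/
def EntropyCondition (I : Set ℝ) (γ : ℝ) (S : ℝ → ℝ) (a b d : ℝ) : Prop :=
  ∀ s ∈ I, deriv S s * (b * s + d) = ((2 * γ - 2) * (a - b / 2) - γ * b) * S s

theorem hasDir_xc (i : Fin 2) (y v : J0) : HasDir (fun y : J0 => y.1 i) y v (v.1 i) :=
  HasDir.clm ((ContinuousLinearMap.proj i).comp (ContinuousLinearMap.fst ℝ (Fin 2 → ℝ) _)) y v

theorem hasDir_uc (k : Fin 3) (y v : J0) : HasDir (fun y : J0 => y.2 k) y v (v.2 k) :=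
  HasDir.clm ((ContinuousLinearMap.proj k).comp (ContinuousLinearMap.snd ℝ _ (Fin 3 → ℝ))) y v

theorem contDiffOn_fderiv_apply (hΩ : IsOpen Ω) (hf : ContDiffOn ℝ ∞ f Ω) (u : J0) :
    ContDiffOn ℝ ∞ (fun y => fderiv ℝ f y u) Ω :=
  (hf.fderiv_of_isOpen hΩ (by simp)).clm_apply contDiffOn_const

theorem exists_affine (h : IsRegion Ω) (hf : ContDiffOn ℝ ∞ f Ω) (p : Fin 2 → ℝ) (q : Fin 3 → ℝ)
    (h1 : ∀ y ∈ Ω, ∀ i, fderiv ℝ f y (ex i) = p i) (h2 : ∀ y ∈ Ω, ∀ k, fderiv ℝ f y (eu k) = q k) :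
    ∃ c, ∀ y ∈ Ω, f y = p 0 * y.1 0 + p 1 * y.1 1 + q 0 * y.2 0 + q 1 * y.2 1 + q 2 * y.2 2 + c := by
  have hd : ∀ y ∈ Ω, ∀ v, HasDir (fun y => f y - (p 0 * y.1 0 + p 1 * y.1 1 + q 0 * y.2 0
      + q 1 * y.2 1 + q 2 * y.2 2)) y v (fderiv ℝ f y v
        - (p 0 * v.1 0 + p 1 * v.1 1 + q 0 * v.2 0 + q 1 * v.2 1 + q 2 * v.2 2)) := by
    intro y hy v
    have hc := fun r : ℝ => HasDir.const r y v
    refine ((HasDir.of_differentiableAt ((hf.contDiffAt (h.isOpen.mem_nhds hy)).differentiableAt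
      (by simp)) v).sub (((((hc _).mul (hasDir_xc 0 y v)).add ((hc _).mul (hasDir_xc 1 y v))).add
        ((hc _).mul (hasDir_uc 0 y v))).add ((hc _).mul (hasDir_uc 1 y v)) |>.add
          ((hc _).mul (hasDir_uc 2 y v)))).congr_val ?_
    ring
  obtain ⟨c, hc⟩ := eq_const_of_fderiv_eq_zero h (f := fun y => f y - (p 0 * y.1 0 + p 1 * y.1 1
      + q 0 * y.2 0 + q 1 * y.2 1 + q 2 * y.2 2)) (hf.sub (by fun_prop)) (fun y hy i => by
        rw [(hd y hy _).fderiv_eq, h1 y hy]; fin_cases i <;> simp [ex]) (fun y hy k => by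
        rw [(hd y hy _).fderiv_eq, h2 y hy]; fin_cases k <;> simp [eu])
  exact ⟨c, fun y hy => by rw [← hc y hy]; ring⟩

/-- The integration step common to the symmetries of the system and of the Lagrangian. The
derivatives of `ξ^t`, `ξ^s`, and `η^χ` in `t`, `s`, and `t`, respectively, have zero differential
and hence are constants; functions with constant partial derivatives on a connected region are
affine. -/
theorem Separated.exists_affineField (h : IsRegion Ω) (hX : ContDiffOn ℝ ∞ X Ω)
    (hs : Separated Ω X) (ha : ∀ y ∈ Ω, hess (VF.xi X 0) y (ex 0) (ex 0) = 0)
    (hb : ∀ y ∈ Ω, hess (VF.xi X 1) y (ex 1) (ex 1) = 0)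
    (h0 : ∀ y ∈ Ω, VF.eta X 0 y =
      (fderiv ℝ (VF.xi X 0) y (ex 0) - fderiv ℝ (VF.xi X 1) y (ex 1) / 2) * y.2 0)
    (h1 : ∀ y ∈ Ω, ∀ i, fderiv ℝ (VF.eta X 1) y (ex i) = 0)
    (h1' : ∀ y ∈ Ω, ∀ k, fderiv ℝ (VF.eta X 1) y (eu k) = 0)
    (h2s : ∀ y ∈ Ω, fderiv ℝ (VF.eta X 2) y (ex 1) = 0)
    (h2φ : ∀ y ∈ Ω, fderiv ℝ (VF.eta X 2) y (eu 0) = 0)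
    (h2ψ : ∀ y ∈ Ω, fderiv ℝ (VF.eta X 2) y (eu 1) = 0)
    (h2χ : ∀ y ∈ Ω, fderiv ℝ (VF.eta X 2) y (eu 2) =
      fderiv ℝ (VF.xi X 0) y (ex 0) - fderiv ℝ (VF.xi X 1) y (ex 1) / 2)
    (h2t : ∀ y ∈ Ω, hess (VF.eta X 2) y (ex 0) (ex 0) = 0) :
    ∃ a b c d e c₁ c₂, (∀ y ∈ Ω, X y = affineField a b c d e c₁ c₂ y) ∧
      (∀ y ∈ Ω, fderiv ℝ (VF.xi X 0) y (ex 0) = a) ∧ (∀ y ∈ Ω, fderiv ℝ (VF.xi X 1) y (ex 1) = b) ∧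
      ∀ y ∈ Ω, fderiv ℝ (VF.eta X 2) y (ex 0) = c₁ := by
  have hes : ∀ {f u}, ContDiffOn ℝ ∞ f Ω → (∀ y ∈ Ω, ∀ v, hess f y u v = 0) →
      ∃ c, ∀ y ∈ Ω, fderiv ℝ f y u = c := by
    intro f u hf hu
    refine eq_const_of_fderiv_eq_zero h (contDiffOn_fderiv_apply h.isOpen hf u) ?_ ?_ <;>
    · intro y hy i
      rw [(hasDir_fderiv (hf.contDiffAt (h.isOpen.mem_nhds hy)) u _).fderiv_eq, hu y hy]
  obtain ⟨a, ha'⟩ := hes (contDiffOn_xi hX 0) (u := ex 0) fun y hy v => by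
    rw [hs.hess_xi_t h hX hy, ha y hy, mul_zero]
  obtain ⟨b, hb'⟩ := hes (contDiffOn_xi hX 1) (u := ex 1) fun y hy v => by
    rw [hs.hess_xi_s h hX hy, hb y hy, mul_zero]
  have h2χ' : ∀ y ∈ Ω, fderiv ℝ (VF.eta X 2) y (eu 2) = a - b / 2 := fun y hy => by
    rw [h2χ y hy, ha' y hy, hb' y hy]
  have c2 := contDiffOn_eta hX 2
  obtain ⟨c₁, hc₁⟩ := hes c2 (u := ex 0) fun y hy v => by
    rw [hess_comm (c2.contDiffAt (h.isOpen.mem_nhds hy)), hess,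
      clm_apply_eq]
    have e0 := h2t y hy
    have e1 := hess_eq_zero h.isOpen c2 hy h2s (ex 0)
    have e2 := hess_eq_zero h.isOpen c2 hy h2φ (ex 0)
    have e3 := hess_eq_zero h.isOpen c2 hy h2ψ (ex 0)
    have e4 := hess_eq_zero h.isOpen c2 hy h2χ' (ex 0)
    rw [hess] at e0 e1 e2 e3 e4
    rw [e0, e1, e2, e3, e4]
    ring
  obtain ⟨c, hc⟩ := exists_affine h (contDiffOn_xi hX 0) ![a, 0] 0
    (fun y hy i => by fin_cases i <;> simp [ha' y hy, hs.xi_t_s y hy])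
    fun y hy k => by simp [hs.xi_t_u y hy]
  obtain ⟨d, hd⟩ := exists_affine h (contDiffOn_xi hX 1) ![0, b] 0
    (fun y hy i => by fin_cases i <;> simp [hb' y hy, hs.xi_s_t y hy])
    fun y hy k => by simp [hs.xi_s_u y hy]
  obtain ⟨e, he⟩ := exists_affine h (contDiffOn_eta hX 1) 0 0
    (fun y hy i => by simp [h1 y hy]) fun y hy k => by simp [h1' y hy]
  obtain ⟨c₂, hc₂⟩ := exists_affine h c2 ![c₁, 0] ![0, 0, a - b / 2]
    (fun y hy i => by fin_cases i <;> simp [hc₁ y hy, h2s y hy])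
    fun y hy k => by fin_cases k <;> simp [h2φ y hy, h2ψ y hy, h2χ' y hy]
  refine ⟨a, b, c, d, e, c₁, c₂, fun y hy => ?_, ha', hb', hc₁⟩
  have e0 := h0 y hy
  rw [ha' y hy, hb' y hy] at e0
  have hc := hc y hy
  have hd := hd y hy
  have he := he y hy
  have hc₂ := hc₂ y hy
  simp at hc hd he hc₂
  ext i
  · fin_cases i
    · simpa [affineField] using hc
    · simpa [affineField] using hd
  · fin_cases i
    · simpa [affineField] using e0
    · simpa [affineField] using he
    · simp [affineField]
      linear_combination hc₂

end CylMHD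

end

noncomputable section

namespace CylMHD

variable {A γ : ℝ} {S : ℝ → ℝ} {w v : J2} {z : J1} {y : J0} {X : VF} {f g : J0 → ℝ} {Ω : Set J0}

/-! ### Solution of the determining equations of a symmetry -/

theorem hess_dir0_dir0 (hf : ContDiffAt ℝ ∞ f z.1) (i : Fin 2) :
    hess f z.1 (dir0 i z) (dir0 i z) = hess f z.1 (ex i) (ex i)
      + 2 * (z.2 0 i * hess f z.1 (eu 0) (ex i) + z.2 1 i * hess f z.1 (eu 1) (ex i)
        + z.2 2 i * hess f z.1 (eu 2) (ex i))
      + (z.2 0 i ^ 2 * hess f z.1 (eu 0) (eu 0) + z.2 1 i ^ 2 * hess f z.1 (eu 1) (eu 1)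
        + z.2 2 i ^ 2 * hess f z.1 (eu 2) (eu 2))
      + 2 * (z.2 0 i * z.2 1 i * hess f z.1 (eu 0) (eu 1)
        + z.2 0 i * z.2 2 i * hess f z.1 (eu 0) (eu 2)
        + z.2 1 i * z.2 2 i * hess f z.1 (eu 1) (eu 2)) := by
  have hc := hess_comm hf
  rw [hess_dir0, hc (ex i) (dir0 i z), hc (eu 0) (dir0 i z), hc (eu 1) (dir0 i z),
    hc (eu 2) (dir0 i z)]
  simp only [hess_dir0]
  rw [hc (eu 1) (eu 0), hc (eu 2) (eu 0), hc (eu 2) (eu 1)]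
  rw [hc (ex i) (eu 0), hc (ex i) (eu 1), hc (ex i) (eu 2)]
  ring

/-- The coefficient identities form an overdetermined linear system. Differentiating them in `φ` and
`s` and using symmetry of second derivatives determines the field up to constants; terms without
second `s`-derivatives are needed only for the dependence on `t`. -/
theorem IsSymmetry.exists_affineField (hA : A ≠ 0) (hγ : 1 < γ) (h : IsRegion Ω)
    (hS : IsEntropy Ω S) (hX : IsSymmetry Ω (system A γ S) X) :
    ∃ a b c d e c₁ c₂, (∀ y ∈ Ω, X y = affineField a b c d e c₁ c₂ y) ∧
      EntropyCondition (sRange Ω) γ S a b d := by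
  have hs := hX.separated hA h hS
  have hφ := h.pos
  have c0 := contDiffOn_eta hX.1 0
  have c1 := contDiffOn_eta hX.1 1
  have c2 := contDiffOn_eta hX.1 2
  have comm : ∀ {f : J0 → ℝ}, ContDiffOn ℝ ∞ f Ω → ∀ y ∈ Ω, ∀ u v, hess f y u v = hess f y v u :=
    fun hf y hy => hess_comm (hf.contDiffAt (h.isOpen.mem_nhds hy))
  have h20 : ∀ y ∈ Ω, fderiv ℝ (VF.eta X 2) y (eu 0) = 0 := fun y hy => by
    have := hX.coeff_chi_psi hA h hS hs hy 1 0
    simpa [(hφ y hy).ne'] using this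
  have h01 : ∀ y ∈ Ω, fderiv ℝ (VF.eta X 0) y (eu 1) = 0 := fun y hy => by
    have := hX.coeff_chi_psi hA h hS hs hy 0 1
    simpa using this.symm
  have h02 : ∀ y ∈ Ω, fderiv ℝ (VF.eta X 0) y (eu 2) = 0 := fun y hy => by
    simpa using hX.coeff_psi_chi hA h hS hs hy 1 0
  have h10 : ∀ y ∈ Ω, fderiv ℝ (VF.eta X 1) y (eu 0) = 0 := fun y hy => by
    simpa using (hX.coeff_psi_chi hA h hS hs hy 0 1).symm
  have h0s : ∀ y ∈ Ω, fderiv ℝ (VF.eta X 0) y (ex 1) = 0 := fun y hy => by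
    have e1 := hX.coeff_psi_psi hA h hS hs hy one_pos
    have e2 := hX.coeff_psi_psi hA h hS hs hy two_pos
    refine (mul_eq_zero.1 ?_).resolve_left (hφ y hy).ne'
    linear_combination 2 * e1 - e2
  have hE : ∀ y ∈ Ω, VF.eta X 0 y + y.2 0 * fderiv ℝ (VF.eta X 0) y (eu 0)
      - (2 * fderiv ℝ (VF.xi X 0) y (ex 0) - fderiv ℝ (VF.xi X 1) y (ex 1)) * y.2 0 = 0 :=
    fun y hy => by
      have e1 := hX.coeff_psi_psi hA h hS hs hy one_pos
      rw [h0s y hy] at e1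
      linear_combination e1
  have h1s : ∀ y ∈ Ω, fderiv ℝ (VF.eta X 1) y (ex 1) = 0 := fun y hy =>
    hX.coeff_psi_phi hA h hS hs hy (h10 y hy)
  have h2s : ∀ y ∈ Ω, fderiv ℝ (VF.eta X 2) y (ex 1) = 0 := fun y hy =>
    hX.coeff_chi_phi hA h hS hs hy (h20 y hy)
  have h11 : ∀ y ∈ Ω, fderiv ℝ (VF.eta X 1) y (eu 1) = 2 * fderiv ℝ (VF.eta X 0) y (eu 0)
      - 2 * fderiv ℝ (VF.xi X 0) y (ex 0) + fderiv ℝ (VF.xi X 1) y (ex 1) := fun y hy => by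
    have e1 := hX.coeff_phi_psi hA h hS hs hy (h01 y hy) (h02 y hy) (h10 y hy) (h20 y hy)
      (h0s y hy) (h1s y hy) (h2s y hy) 1 0
    have e2 := hE y hy
    refine mul_left_cancel₀ (pow_ne_zero 2 (hφ y hy).ne') ?_
    linear_combination (-1 / 2) * e1 - y.2 0 / 2 * e2
  have hM : ∀ y ∈ Ω, fderiv ℝ (VF.eta X 2) y (eu 1)
      = - (y.2 0 ^ 2 * fderiv ℝ (VF.eta X 1) y (eu 2)) := fun y hy => by
    have e1 := hX.coeff_phi_psi hA h hS hs hy (h01 y hy) (h02 y hy) (h10 y hy) (h20 y hy)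
      (h0s y hy) (h1s y hy) (h2s y hy) 0 1
    linear_combination -e1
  have hd : ∀ {f : J0 → ℝ}, ContDiffOn ℝ ∞ f Ω → ∀ y ∈ Ω, ∀ u v,
      HasDir (fun y => fderiv ℝ f y u) y v (hess f y u v) :=
    fun hf y hy => hasDir_fderiv (hf.contDiffAt (h.isOpen.mem_nhds hy))
  have hφd : ∀ y ∈ Ω, HasDir (fun y : J0 => y.2 0) y (eu 0) 1 := fun y hy =>
    (hasDir_uc 0 y (eu 0)).congr_val (by simp [eu])
  have ca := fun y hy v => hd (contDiffOn_xi hX.1 0) y hy (ex 0) v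
  have cb := fun y hy v => hd (contDiffOn_xi hX.1 1) y hy (ex 1) v
  have ca0 : ∀ y ∈ Ω, hess (VF.xi X 0) y (ex 0) (eu 0) = 0 := fun y hy => by
    rw [hs.hess_xi_t h hX.1 hy]; simp [eu]
  have cb0 : ∀ y ∈ Ω, hess (VF.xi X 1) y (ex 1) (eu 0) = 0 := fun y hy => by
    rw [hs.hess_xi_s h hX.1 hy]; simp [eu]
  -- Since `∂_φ η^ψ = 0`, the `φ`-derivative of `h11` has left side zero and leaves only `∂_φ² η^φ`.
  have h000 : ∀ y ∈ Ω, hess (VF.eta X 0) y (eu 0) (eu 0) = 0 := fun y hy => by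
    have e1 := hess_eq_of_hasDir h.isOpen c1 hy h11
      (((((HasDir.const 2 y (eu 0)).mul (hd c0 y hy (eu 0) (eu 0))).sub
        ((HasDir.const 2 y (eu 0)).mul (ca y hy (eu 0)))).add (cb y hy (eu 0))))
    rw [comm c1 y hy, hess_eq_zero h.isOpen c1 hy h10, ca0 y hy, cb0 y hy] at e1
    linear_combination (-1 / 2) * e1
  -- The `φ`-derivative of `hE` contains `∂_φ η^φ` twice, and `h000` removes the second-order term.
  have h00 : ∀ y ∈ Ω, fderiv ℝ (VF.eta X 0) y (eu 0) =
      fderiv ℝ (VF.xi X 0) y (ex 0) - fderiv ℝ (VF.xi X 1) y (ex 1) / 2 := fun y hy => by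
    have e1 := (((HasDir.of_differentiableAt ((c0.contDiffAt
      (h.isOpen.mem_nhds hy)).differentiableAt (by simp)) (eu 0)).add ((hφd y hy).mul
        (hd c0 y hy (eu 0) (eu 0)))).sub ((((HasDir.const 2 y (eu 0)).mul (ca y hy (eu 0))).sub
          (cb y hy (eu 0))).mul (hφd y hy))).fderiv_eq
    rw [((HasDir.const 0 y (eu 0)).congr_fun (Filter.eventually_of_mem (h.isOpen.mem_nhds hy)
      hE)).fderiv_eq, h000 y hy, ca0 y hy, cb0 y hy] at e1
    linear_combination (-1 / 2) * e1
  -- In `hM` neither `∂_ψ η^χ` nor `∂_χ η^ψ` depends on `φ`, so the explicit factor `φ ^ 2` forces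
  -- both to vanish.
  have h12 : ∀ y ∈ Ω, fderiv ℝ (VF.eta X 1) y (eu 2) = 0 := fun y hy => by
    have e1 := hess_eq_of_hasDir h.isOpen c2 hy hM
      (((hφd y hy).sq.mul (hd c1 y hy (eu 2) (eu 0))).neg)
    rw [comm c2 y hy, hess_eq_zero h.isOpen c2 hy h20, comm c1 y hy,
      hess_eq_zero h.isOpen c1 hy h10] at e1
    refine (mul_eq_zero.1 ?_).resolve_left (hφ y hy).ne'
    linear_combination (1 / 2) * e1
  have h21 : ∀ y ∈ Ω, fderiv ℝ (VF.eta X 2) y (eu 1) = 0 := fun y hy => by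
    rw [hM y hy, h12 y hy]; ring
  have h11' : ∀ y ∈ Ω, fderiv ℝ (VF.eta X 1) y (eu 1) = 0 := fun y hy => by
    rw [h11 y hy, h00 y hy]; ring
  have h0 : ∀ y ∈ Ω, VF.eta X 0 y =
      (fderiv ℝ (VF.xi X 0) y (ex 0) - fderiv ℝ (VF.xi X 1) y (ex 1) / 2) * y.2 0 := fun y hy => by
    have e1 := hE y hy
    rw [h00 y hy] at e1
    linear_combination e1
  have h22 : ∀ y ∈ Ω, fderiv ℝ (VF.eta X 2) y (eu 2) =
      fderiv ℝ (VF.xi X 0) y (ex 0) - fderiv ℝ (VF.xi X 1) y (ex 1) / 2 := fun y hy => by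
    have e1 := hX.coeff_phi_chi hA h hS hs hy (h01 y hy) (h02 y hy) (h10 y hy) (h20 y hy)
      (h0s y hy) (h1s y hy) (h2s y hy)
    rw [h00 y hy, h0 y hy] at e1
    refine mul_left_cancel₀ (hφ y hy).ne' ?_
    linear_combination (-1 / 2) * e1
  -- `η^φ` does not depend on `s`, so the `s`-derivative of `h00` is a statement about `ξ^s` alone.
  have hb : ∀ y ∈ Ω, hess (VF.xi X 1) y (ex 1) (ex 1) = 0 := fun y hy => by
    have e1 := hess_eq_of_hasDir h.isOpen c0 hy h00 ((ca y hy (ex 1)).sub ((cb y hy (ex 1)).div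
      (HasDir.const 2 y (ex 1)) two_ne_zero))
    rw [comm c0 y hy, hess_eq_zero h.isOpen c0 hy h0s, hs.hess_xi_t h hX.1 hy] at e1
    simp [ex] at e1
    simpa [ex] using e1
  have h00t : ∀ y ∈ Ω, hess (VF.eta X 0) y (eu 0) (ex 0) = hess (VF.xi X 0) y (ex 0) (ex 0) :=
    fun y hy => by
      rw [hess_eq_of_hasDir h.isOpen c0 hy h00 ((ca y hy (ex 0)).sub ((cb y hy (ex 0)).div
        (HasDir.const 2 y (ex 0)) two_ne_zero)), hs.hess_xi_s h hX.1 hy]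
      simp [ex]
  have z01 : ∀ y ∈ Ω, ∀ v, hess (VF.eta X 0) y (eu 1) v = 0 := fun y hy =>
    hess_eq_zero h.isOpen c0 hy h01
  have quad0 : ∀ y ∈ Ω, ∀ a b p α β, hess (VF.eta X 0) y (dir0 0 (jet1 y a b 0 p α β))
      (dir0 0 (jet1 y a b 0 p α β)) = hess (VF.eta X 0) y (ex 0) (ex 0)
        + 2 * a * hess (VF.xi X 0) y (ex 0) (ex 0) := fun y hy a b p α β => by
    have e := hess_dir0_dir0 (z := jet1 y a b 0 p α β) (c0.contDiffAt (h.isOpen.mem_nhds hy)) 0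
    rw [show (jet1 y a b 0 p α β).1 = y from rfl, h00t y hy, z01 y hy, z01 y hy, h000 y hy,
      comm c0 y hy (eu 0) (eu 1), z01 y hy] at e
    rw [e]
    simp [jet1]
    ring
  have dir : ∀ y : J0, ∀ a b : ℝ, dir0 1 (jet1 y a b 0 1 0 0) = dir0 1 (jet1 y 0 0 0 1 0 0) :=
    fun y a b => by ext i <;> fin_cases i <;> rfl
  -- The `φ`-equation at velocities `φ_t = a`, `ψ_t = b`, minus the same equation at rest. Terms
  -- without velocities drop out and the quadratic ones cancel by the weights already found.
  have low : ∀ y ∈ Ω, ∀ a b : ℝ, a * hess (VF.xi X 0) y (ex 0) (ex 0)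
      - 2 * y.2 0 * b * fderiv ℝ (VF.eta X 1) y (ex 0) = 0 := by
    intro y hy a b
    have e1 : ∀ a b : ℝ, _ := fun a b => hX.determining h hS
      (jet1_mem hy a b 0 one_pos 0 0) 0 0 0
    have hz : ∀ a b : ℝ, _ := fun a b => (jet1_mem hy a b 0 one_pos 0 0).1
    simp only [linearizedSystem, Matrix.cons_val, Matrix.cons_val_zero, Matrix.cons_val_one,
      pr2_snd, ss_pr2, phi_pr2, phi_t_pr2, phi_s_pr2, psi_t_pr2, psi_s_pr2, chi_s_pr2,
      hs.zeta2_tt h hX.1 (hz _ _), hs.zeta2_ss h hX.1 (hz _ _)] at e1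
    simp only [jet2, hs.zeta1_t (hz _ _), hs.zeta1_s (hz _ _), D0_jet1_one, D0_jet1_zero] at e1
    simp only [show ∀ a b, (jet1 y a b 0 1 0 0).1 = y from fun _ _ => rfl, quad0 y hy,
      dir y] at e1
    simp [accel, jet1, phi, phi_s, phi_t, psi_t, psi_s, chi_s, ss, h01 y hy, h02 y hy, h00 y hy,
      h0 y hy, hb y hy, h11' y hy, h10 y hy, h12 y hy] at e1
    linear_combination e1 a b - e1 0 0
  have ha : ∀ y ∈ Ω, hess (VF.xi X 0) y (ex 0) (ex 0) = 0 := fun y hy => by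
    linear_combination low y hy 1 0
  have h1t : ∀ y ∈ Ω, fderiv ℝ (VF.eta X 1) y (ex 0) = 0 := fun y hy => by
    refine (mul_eq_zero.1 ?_).resolve_left (hφ y hy).ne'
    linear_combination (-1 / 2) * low y hy 0 1
  -- At a jet at rest with `ψ_s = χ_s = 0`, `φ_s = 1` and `n = 0`, the `χ`-equation reduces to `∂_t²
  -- η^χ = 0`.
  have h2t : ∀ y ∈ Ω, hess (VF.eta X 2) y (ex 0) (ex 0) = 0 := fun y hy => by
    have hz := jet1_mem hy 0 0 0 one_pos 0 0
    have c2' := c2.contDiffAt (h.isOpen.mem_nhds hy)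
    have e1 := hX.determining h hS hz 0 0 2
    have e2 := hess_dir0_dir0 (z := jet1 y 0 0 0 1 0 0) c2' 0
    have e3 := hess_dir0 (VF.eta X 2) y 1 (jet1 y 0 0 0 1 0 0) (dir0 1 (jet1 y 0 0 0 1 0 0))
    rw [hess_eq_zero h.isOpen c2 hy h2s, hess_eq_zero h.isOpen c2 hy h20] at e3
    simp only [linearizedSystem, Matrix.cons_val, Matrix.cons_val_zero, Matrix.cons_val_one,
      pr2_snd, ss_pr2, phi_pr2, phi_t_pr2, phi_s_pr2, psi_t_pr2, psi_s_pr2, chi_s_pr2,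
      hs.zeta2_tt h hX.1 hz.1, hs.zeta2_ss h hX.1 hz.1] at e1
    simp only [jet2, hs.zeta1_t hz.1, hs.zeta1_s hz.1, D0_jet1_one, D0_jet1_zero] at e1
    simp [accel, jet1, phi, phi_s, phi_t, psi_t, psi_s, chi_s, h20 y hy, h2s y hy, h21 y hy,
      hb y hy] at e1 e2 e3
    rwa [e3, e2, zero_div, mul_zero, sub_zero] at e1
  obtain ⟨a, b, c, d, e, c₁, c₂, hf, ha', hb', -⟩ := hs.exists_affineField h hX.1 ha hb h0
    (fun y hy i => by fin_cases i; exacts [h1t y hy, h1s y hy])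
    (fun y hy k => by fin_cases k; exacts [h10 y hy, h11' y hy, h12 y hy]) h2s h20 h21 h22 h2t
  refine ⟨a, b, c, d, e, c₁, c₂, hf, ?_⟩
  rintro s ⟨y, hy, rfl⟩
  have e1 := hX.coeff_phi_phi h hS hs hy (h01 y hy) (h02 y hy) (h10 y hy) (h20 y hy)
    (h0s y hy) (h1s y hy) (h2s y hy)
  have e2 : VF.xi X 1 y = b * y.1 1 + d := by rw [VF.xi, hf y hy]; simp [affineField]
  rw [e2, h0 y hy, h00 y hy, ha' y hy, hb' y hy] at e1
  refine mul_left_cancel₀ (mul_ne_zero (hφ y hy).ne' (by linarith : γ ≠ 0)) ?_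
  linear_combination e1

end CylMHD

end

noncomputable section

namespace CylMHD

variable {A γ : ℝ} {S : ℝ → ℝ} {w v : J2} {z : J1} {y : J0} {X Y : VF} {f g : J0 → ℝ} {Ω : Set J0}

/-! ### Prolongations of affine fields -/

/-- A symmetry is identified with an affine field on `Ω` only. Prolongations involve derivatives of
the field, so openness of `Ω` is needed to transfer the formulas. -/
theorem zeta1_congr (hΩ : IsOpen Ω) (hXY : Set.EqOn X Y Ω) (hz : z.1 ∈ Ω) (k : Fin 3) (i : Fin 2) :
    zeta1 X k i z = zeta1 Y k i z := by
  have h1 : X =ᶠ[nhds z.1] Y := hXY.eventuallyEq_of_mem (hΩ.mem_nhds hz)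
  have h2 : VF.eta X k =ᶠ[nhds z.1] VF.eta Y k := h1.mono fun y hy => by rw [VF.eta, VF.eta, hy]
  have h3 : ∀ j, VF.xi X j =ᶠ[nhds z.1] VF.xi Y j :=
    fun j => h1.mono fun y hy => by rw [VF.xi, VF.xi, hy]
  simp only [zeta1, D0, h2.fderiv_eq, (h3 _).fderiv_eq]

theorem pr1_congr (hΩ : IsOpen Ω) (hXY : Set.EqOn X Y Ω) (hz : z.1 ∈ Ω) : pr1 X z = pr1 Y z := by
  simp only [pr1, zeta1_congr hΩ hXY hz, hXY hz]

theorem D0_xi_congr (hΩ : IsOpen Ω) (hXY : Set.EqOn X Y Ω) (hz : z.1 ∈ Ω) (i j : Fin 2) :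
    D0 i (VF.xi X j) z = D0 i (VF.xi Y j) z := by
  have h1 : X =ᶠ[nhds z.1] Y := hXY.eventuallyEq_of_mem (hΩ.mem_nhds hz)
  have h3 : VF.xi X j =ᶠ[nhds z.1] VF.xi Y j := h1.mono fun y hy => by rw [VF.xi, VF.xi, hy]
  rw [D0, D0, h3.fderiv_eq]

theorem pr2_congr (hΩ : IsOpen Ω) (hXY : Set.EqOn X Y Ω) (hw : w.1.1 ∈ Ω) :
    pr2 X w = pr2 Y w := by
  have h1 : ∀ k i, zeta1 X k i =ᶠ[nhds w.1] zeta1 Y k i := fun k i =>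
    Filter.eventually_of_mem ((hΩ.preimage continuous_fst).mem_nhds hw)
      fun z hz => zeta1_congr hΩ hXY hz k i
  have h2 : ∀ k i j, zeta2 X k i j w = zeta2 Y k i j w := fun k i j => by
    simp only [zeta2, D1, (h1 k i).fderiv_eq, D0_xi_congr hΩ hXY hw]
  simp only [pr2, pr1_congr hΩ hXY hw, h2]

section Affine

variable (a b c d e c₁ c₂ : ℝ)

theorem contDiff_affineField : ContDiff ℝ ∞ (affineField a b c d e c₁ c₂) := by
  refine ContDiff.prodMk (contDiff_pi.2 fun i => ?_) (contDiff_pi.2 fun i => ?_) <;>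
    fin_cases i <;> simp <;> fun_prop

theorem D0_xi_affineField (i : Fin 2) (z : J1) :
    D0 i (VF.xi (affineField a b c d e c₁ c₂) 0) z = a * (Pi.single i 1 : Fin 2 → ℝ) 0 ∧
    D0 i (VF.xi (affineField a b c d e c₁ c₂) 1) z = b * (Pi.single i 1 : Fin 2 → ℝ) 1 := by
  constructor
  · exact ((((HasDir.const a z.1 _).mul (hasDir_xc 0 z.1 (dir0 i z))).add
      (HasDir.const c z.1 _)).congr_val (by simp [dir0])).fderiv_eq
  · exact ((((HasDir.const b z.1 _).mul (hasDir_xc 1 z.1 (dir0 i z))).add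
      (HasDir.const d z.1 _)).congr_val (by simp [dir0])).fderiv_eq

theorem D0_eta_affineField (i : Fin 2) (z : J1) :
    D0 i (VF.eta (affineField a b c d e c₁ c₂) 0) z = (a - b / 2) * z.2 0 i ∧
    D0 i (VF.eta (affineField a b c d e c₁ c₂) 1) z = 0 ∧
    D0 i (VF.eta (affineField a b c d e c₁ c₂) 2) z =
      (a - b / 2) * z.2 2 i + c₁ * (Pi.single i 1 : Fin 2 → ℝ) 0 := by
  refine ⟨?_, (HasDir.const e z.1 (dir0 i z)).fderiv_eq, ?_⟩
  · exact (((HasDir.const (a - b / 2) z.1 _).mul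
      (hasDir_uc 0 z.1 (dir0 i z))).congr_val (by simp [dir0])).fderiv_eq
  · exact (((((HasDir.const (a - b / 2) z.1 _).mul (hasDir_uc 2 z.1 (dir0 i z))).add
      ((HasDir.const c₁ z.1 _).mul (hasDir_xc 0 z.1 (dir0 i z)))).add
        (HasDir.const c₂ z.1 _)).congr_val (by simp [dir0])).fderiv_eq

theorem zeta1_affineField (k : Fin 3) (i : Fin 2) (z : J1) :
    zeta1 (affineField a b c d e c₁ c₂) k i z =
      (![![a - b / 2 - a, a - b / 2 - b], ![-a, -b], ![a - b / 2 - a, a - b / 2 - b]] :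
        Fin 3 → Fin 2 → ℝ) k i * z.2 k i
      + (![![0, 0], ![0, 0], ![c₁, 0]] : Fin 3 → Fin 2 → ℝ) k i := by
  obtain ⟨e1, e2⟩ := D0_xi_affineField a b c d e c₁ c₂ i z
  obtain ⟨e3, e4, e5⟩ := D0_eta_affineField a b c d e c₁ c₂ i z
  rw [zeta1, Fin.sum_univ_two, e1, e2]
  fin_cases k <;> simp only [Fin.zero_eta, Fin.mk_one, Fin.reduceFinMk, e3, e4, e5] <;>
    fin_cases i <;> simp <;> ring

theorem zeta2_affineField (k : Fin 3) (i : Fin 2) (w : J2) :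
    zeta2 (affineField a b c d e c₁ c₂) k i i w =
      (![![a - b / 2 - 2 * a, a - b / 2 - 2 * b], ![-(2 * a), -(2 * b)],
        ![a - b / 2 - 2 * a, a - b / 2 - 2 * b]] : Fin 3 → Fin 2 → ℝ) k i * w.2 k i i := by
  obtain ⟨e1, e2⟩ := D0_xi_affineField a b c d e c₁ c₂ i w.1
  rw [zeta2, Fin.sum_univ_two, e1, e2, funext (zeta1_affineField a b c d e c₁ c₂ k i),
    (((HasDir.const _ w.1 _).mul (hasDir_p k i w.1 (dir1 i w))).add
      (HasDir.const _ w.1 _)).D1_eq]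
  fin_cases k <;> fin_cases i <;> simp [dir1] <;> ring

end Affine

/-! ### Affine fields that are symmetries -/

/-- The linearized `φ`-equation contains `S''`, which is eliminated by differentiating the condition
in `s`. -/
theorem EntropyCondition.deriv_deriv {a b d : ℝ} (h : IsRegion Ω) (hS : IsEntropy Ω S)
    (hE : EntropyCondition (sRange Ω) γ S a b d) {s : ℝ} (hs : s ∈ sRange Ω) :
    deriv (deriv S) s * (b * s + d) + deriv S s * b =
      ((2 * γ - 2) * (a - b / 2) - γ * b) * deriv S s := by
  have h1 : HasDerivAt S (deriv S s) s :=
    ((hS.contDiffAt h hs).differentiableAt (by simp)).hasDerivAt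
  have h2 : HasDerivAt (deriv S) (deriv (deriv S) s) s := by
    have := (hS.1.deriv_of_isOpen h.isOpen_sRange (m := ∞) (by simp)).contDiffAt
      (h.isOpen_sRange.mem_nhds hs)
    exact (this.differentiableAt (by simp)).hasDerivAt
  have h3 := h2.mul (((hasDerivAt_id s).const_mul b).add_const d)
  have h4 := h1.const_mul ((2 * γ - 2) * (a - b / 2) - γ * b)
  have h5 := h4.congr_of_eventuallyEq (Filter.eventually_of_mem (h.isOpen_sRange.mem_nhds hs) hE)
  simpa using h3.unique h5

/-- The flow of an affine field combines a scaling with translations and a shift of `χ` linear in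
`t`. Every equation is homogeneous under it, so its linearization is a multiple of the equation
itself; only the pressure term needs the entropy condition. -/
theorem isSymmetry_affineField {a b c d e c₁ c₂ : ℝ} (h : IsRegion Ω) (hS : IsEntropy Ω S)
    (hE : EntropyCondition (sRange Ω) γ S a b d)
    (hX : ∀ y ∈ Ω, X y = affineField a b c d e c₁ c₂ y) :
    IsSymmetry Ω (system A γ S) X := by
  refine (isSymmetry_iff h hS).2 ⟨(contDiff_affineField a b c d e c₁ c₂).contDiffOn.congr hX,
    fun w hw h0 k => ?_⟩
  rw [pr2_congr h.isOpen hX hw.1.1]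
  have hr := hS.regular h hw.1
  have h1 : w.1.1.2 0 ≠ 0 := hr.phi_pos.ne'
  have h2 : w.1.2 0 1 ≠ 0 := hr.phi_s_pos.ne'
  have h3 : w.1.1.2 0 ^ γ ≠ 0 := (hr.rpow_pos γ).ne'
  have h4 : w.1.2 0 1 ^ γ ≠ 0 := (hr.rpow_pos' γ).ne'
  have hk := h0 k
  have hs : w.1.1.1 1 ∈ sRange Ω := ⟨_, hw.1.1, rfl⟩
  have o1 := hE _ hs
  have o2 := hE.deriv_deriv h hS hs
  fin_cases k
  · simp only [linearizedSystem, explicitSystem, Fin.zero_eta, Matrix.cons_val,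
      Matrix.cons_val_zero, Matrix.cons_val_one, pr2_snd, ss_pr2, phi_pr2, phi_t_pr2, phi_s_pr2,
      psi_t_pr2, psi_s_pr2, chi_s_pr2, zeta1_affineField, zeta2_affineField] at hk ⊢
    simp only [affineField, phi, phi_s, phi_t, psi_t, psi_s, chi_s, ss, VF.xi, VF.eta,
      Matrix.cons_val, Matrix.cons_val_zero, Matrix.cons_val_one, add_zero] at hk ⊢
    -- The factor is the common weight of `φ_{tt}`, `φ ψ_{tt}` and `χ_{tt}`. The remaining terms are
    -- the expanded `s`-derivative of `S / (φ φ_s) ^ γ`, handled by the entropy condition and its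
    -- derivative.
    linear_combination (norm := skip) (a - b / 2 - 2 * a) * hk
      + w.1.1.2 0 / (w.1.1.2 0 ^ γ * w.1.2 0 1 ^ γ) * o2
      - w.1.1.2 0 / (w.1.1.2 0 ^ γ * w.1.2 0 1 ^ γ) * γ
        * (w.1.2 0 1 / w.1.1.2 0 + w.2 0 1 1 / w.1.2 0 1) * o1
    field_simp
    ring
  · simp only [linearizedSystem, explicitSystem, Fin.mk_one, Matrix.cons_val,
      Matrix.cons_val_zero, Matrix.cons_val_one, pr2_snd, ss_pr2, phi_pr2, phi_t_pr2, phi_s_pr2,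
      psi_t_pr2, psi_s_pr2, chi_s_pr2, zeta1_affineField, zeta2_affineField] at hk ⊢
    simp only [affineField, phi, phi_s, phi_t, psi_t, psi_s, chi_s, ss, VF.xi, VF.eta,
      Matrix.cons_val, Matrix.cons_val_zero, Matrix.cons_val_one, add_zero] at hk ⊢
    linear_combination (norm := skip) (a - b / 2 - 2 * a) * hk
    field_simp
    ring
  · simp only [linearizedSystem, explicitSystem, Fin.reduceFinMk, Matrix.cons_val,
      Matrix.cons_val_zero, Matrix.cons_val_one, pr2_snd, ss_pr2, phi_pr2, phi_t_pr2, phi_s_pr2,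
      psi_t_pr2, psi_s_pr2, chi_s_pr2, zeta1_affineField, zeta2_affineField] at hk ⊢
    simp only [affineField, phi, phi_s, phi_t, psi_t, psi_s, chi_s, ss, VF.xi, VF.eta,
      Matrix.cons_val, Matrix.cons_val_zero, Matrix.cons_val_one, add_zero] at hk ⊢
    linear_combination (norm := skip) (a - b / 2 - 2 * a) * hk
    field_simp
    ring

/-- The symmetries of the system. -/
theorem isSymmetry_system_iff (hA : A ≠ 0) (hγ : 1 < γ) (h : IsRegion Ω) (hS : IsEntropy Ω S) :
    IsSymmetry Ω (system A γ S) X ↔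
      ∃ a b c d e c₁ c₂, (∀ y ∈ Ω, X y = affineField a b c d e c₁ c₂ y) ∧
        EntropyCondition (sRange Ω) γ S a b d :=
  ⟨fun hX => hX.exists_affineField hA hγ h hS, fun ⟨_, _, _, _, _, _, _, hX, hE⟩ =>
    isSymmetry_affineField h hS hE hX⟩

/-! ### Variations of the action -/

/-- `X L + L (D_t ξ^t + D_s ξ^s)` for the Lagrangian of the system. -/
theorem actionVariation_lagrangian (hγ : γ ≠ 1) (h : Regular S z) (X : VF) :
    actionVariation (lagrangian A γ S) X z =
      (phi_t z * zeta1 X 0 0 z + phi z * psi_t z ^ 2 * VF.eta X 0 z.1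
        + phi z ^ 2 * psi_t z * zeta1 X 1 0 z + chi_t z * zeta1 X 2 0 z
        - phi z * phi_s z / (phi z ^ γ * phi_s z ^ γ)
          * (deriv S (ss z) * VF.xi X 1 z.1 / (γ - 1)
            - S (ss z) * (VF.eta X 0 z.1 / phi z + zeta1 X 0 1 z / phi_s z))
        - A ^ 2 / 2 * (VF.eta X 0 z.1 * psi_s z ^ 2 / phi_s z
          + 2 * phi z * psi_s z * zeta1 X 1 1 z / phi_s z
          - phi z * psi_s z ^ 2 * zeta1 X 0 1 z / phi_s z ^ 2
          + 2 * chi_s z * zeta1 X 2 1 z / (phi z * phi_s z)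
          - chi_s z ^ 2 / (phi z * phi_s z)
            * (VF.eta X 0 z.1 / phi z + zeta1 X 0 1 z / phi_s z)))
      + (1 / 2 * (phi_t z ^ 2 + phi z ^ 2 * psi_t z ^ 2 + chi_t z ^ 2)
        - S (ss z) / (γ - 1) * (phi z * phi_s z / (phi z ^ γ * phi_s z ^ γ))
        - A ^ 2 / 2 * (phi z * psi_s z ^ 2 / phi_s z + chi_s z ^ 2 / (phi z * phi_s z)))
        * (D0 0 (VF.xi X 0) z + D0 1 (VF.xi X 1) z) := by
  have h1 := h.phi_pos.ne'
  have h2 := h.phi_s_pos.ne'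
  rw [actionVariation, (hasDir_lagrangian hγ h (pr1 X z)).fderiv_eq, Fin.sum_univ_two, lagrangian,
    Real.rpow_sub h.phi_pos, Real.rpow_sub h.phi_s_pos, Real.rpow_one, Real.rpow_one]
  congr 1
  congr 1
  congr 1
  congr 1
  rw [mul_assoc, div_mul_div_comm]

/-- All parts of `L` have weight `-b`, which cancels `D_s ξ^s = b`; for weight `a` in `t` the action
would be multiplied by `a`. The shift `c₁ t` of `χ` changes the kinetic energy by `c₁ χ_t`. -/
theorem actionVariation_affineField {b c d e c₁ c₂ : ℝ} (hγ : 1 < γ) (h : IsRegion Ω)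
    (hS : IsEntropy Ω S) (hE : EntropyCondition (sRange Ω) γ S 0 b d)
    (hX : ∀ y ∈ Ω, X y = affineField 0 b c d e c₁ c₂ y) (hz : z ∈ adm1 Ω) :
    actionVariation (lagrangian A γ S) X z = c₁ * chi_t z := by
  have hr := hS.regular h hz
  have h1 : z.1.2 0 ≠ 0 := hr.phi_pos.ne'
  have h2 : z.2 0 1 ≠ 0 := hr.phi_s_pos.ne'
  have h3 : z.1.2 0 ^ γ ≠ 0 := (hr.rpow_pos γ).ne'
  have h4 : z.2 0 1 ^ γ ≠ 0 := (hr.rpow_pos' γ).ne'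
  have h5 : γ - 1 ≠ 0 := by linarith
  have o1 := hE (z.1.1 1) ⟨_, hz.1, rfl⟩
  rw [actionVariation_lagrangian hγ.ne' hr]
  simp only [zeta1_congr h.isOpen hX hz.1, D0_xi_congr h.isOpen hX hz.1, zeta1_affineField,
    (D0_xi_affineField _ _ _ _ _ _ _ _ _).1, (D0_xi_affineField _ _ _ _ _ _ _ _ _).2,
    VF.xi, VF.eta, hX _ hz.1]
  simp only [affineField, phi, phi_s, phi_t, psi_t, psi_s, chi_s, chi_t, ss, VF.xi, VF.eta,
      Matrix.cons_val, Matrix.cons_val_zero, Matrix.cons_val_one, add_zero, Pi.single_eq_same]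
  linear_combination (norm := skip)
    (-(z.1.2 0 * z.2 0 1 / (z.1.2 0 ^ γ * z.2 0 1 ^ γ) / (γ - 1))) * o1
  field_simp
  ring

end CylMHD

end

noncomputable section

namespace CylMHD

variable {A γ : ℝ} {S : ℝ → ℝ} {w v : J2} {z : J1} {y : J0} {X Y : VF} {f g : J0 → ℝ} {Ω : Set J0}
  {B : Fin 2 → J0 → ℝ}

/-! ### Solution of the determining equations of a divergence symmetry -/

set_option maxHeartbeats 1000000 in
-- For fixed slopes in `s` the action variation is a polynomial in the velocities, and finite
-- differences extract its coefficients. The functions `B` depend on no derivatives, so their total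
-- derivatives have degree at most one and do not affect the coefficients used here.
theorem IsDivergenceWith.separated (hA : A ≠ 0) (hγ : γ ≠ 1) (h : IsRegion Ω)
    (hS : IsEntropy Ω S) (hX : IsDivergenceWith Ω (lagrangian A γ S) X B) : Separated Ω X := by
  have key : ∀ y ∈ Ω, ∀ a b c p α β : ℝ, 0 < p → _ := fun y hy a b c p α β hp =>
    hX.2.2 _ (jet1_mem hy a b c hp α β)
  have key' : ∀ y ∈ Ω, ∀ a b c p α β : ℝ, 0 < p → _ := fun y hy a b c p α β hp =>
    (actionVariation_lagrangian hγ (hS.regular h (jet1_mem hy a b c hp α β)) X).symm.trans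
      (key y hy a b c p α β hp)
  simp only [Fin.sum_univ_two, zeta1, D0_jet1_zero, D0_jet1_one] at key'
  simp only [jet1, phi, phi_s, phi_t, psi_t, psi_s, chi_s, chi_t, ss, Matrix.cons_val_zero,
    Matrix.cons_val_one, Matrix.cons_val] at key'
  -- This combination of values at `±1`, `±2` kills even powers and the linear term, leaving twelve
  -- times the cubic coefficient, which is `-∂_φ ξ^t / 2`.
  have t0 : ∀ y ∈ Ω, fderiv ℝ (VF.xi X 0) y (eu 0) = 0 := fun y hy => by
    have e := fun a : ℝ => key' y hy a 0 0 1 0 0 one_pos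
    linear_combination (-1 / 6) * (e 2 - e (-2) - 2 * (e 1 - e (-1)))
  have t1 : ∀ y ∈ Ω, fderiv ℝ (VF.xi X 0) y (eu 1) = 0 := fun y hy => by
    have e := fun b : ℝ => key' y hy 0 b 0 1 0 0 one_pos
    refine mul_left_cancel₀ (pow_ne_zero 2 (h.pos y hy).ne') ?_
    linear_combination (-1 / 6) * (e 2 - e (-2) - 2 * (e 1 - e (-1)))
  have t2 : ∀ y ∈ Ω, fderiv ℝ (VF.xi X 0) y (eu 2) = 0 := fun y hy => by
    have e := fun c : ℝ => key' y hy 0 0 c 1 0 0 one_pos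
    linear_combination (-1 / 6) * (e 2 - e (-2) - 2 * (e 1 - e (-1)))
  have quad : ∀ y ∈ Ω, ∀ p α β : ℝ, 0 < p → 2 * fderiv ℝ (VF.eta X 0) y (eu 0)
      - fderiv ℝ (VF.xi X 0) y (ex 0) + fderiv ℝ (VF.xi X 1) y (ex 1)
      - p * fderiv ℝ (VF.xi X 1) y (eu 0) + α * fderiv ℝ (VF.xi X 1) y (eu 1)
      + β * fderiv ℝ (VF.xi X 1) y (eu 2) = 0 := by
    intro y hy p α β hp
    have e := fun a : ℝ => key' y hy a 0 0 p α β hp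
    simp only [t0 y hy, t1 y hy, t2 y hy] at e
    linear_combination e 1 + e (-1) - 2 * e 0
  -- The mixed difference isolates `χ_t χ_s`, to which kinetic and magnetic energy contribute with
  -- different powers of `φ_s`. Two values of `p` then separate `∂_s ξ^t` from `∂_t ξ^s`.
  have lin : ∀ y ∈ Ω, ∀ p : ℝ, 0 < p → A ^ 2 * fderiv ℝ (VF.xi X 0) y (ex 1) =
      y.2 0 * p * fderiv ℝ (VF.xi X 1) y (ex 0) := by
    intro y hy p hp
    have e := fun c β : ℝ => key' y hy 0 0 c p 0 β hp
    simp only [t0 y hy, t1 y hy, t2 y hy] at e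
    have hφ := (h.pos y hy).ne'
    have hp' := hp.ne'
    have e' : A ^ 2 * fderiv ℝ (VF.xi X 0) y (ex 1) / (y.2 0 * p)
        - fderiv ℝ (VF.xi X 1) y (ex 0) = 0 := by
      linear_combination (1 / 2) * (e 1 1 - e (-1) 1 - e 1 0 + e (-1) 0)
    field_simp at e'
    linear_combination e'
  have s0 : ∀ y ∈ Ω, fderiv ℝ (VF.xi X 1) y (ex 0) = 0 := fun y hy => by
    refine (mul_eq_zero.1 ?_).resolve_left (h.pos y hy).ne'
    linear_combination lin y hy 1 one_pos - lin y hy 2 two_pos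
  refine ⟨fun y hy => ?_, fun y hy k => ?_, s0, fun y hy k => ?_⟩
  · have e := lin y hy 1 one_pos
    rw [s0 y hy, mul_zero] at e
    exact (mul_eq_zero.1 e).resolve_left (pow_ne_zero 2 hA)
  · fin_cases k
    exacts [t0 y hy, t1 y hy, t2 y hy]
  · fin_cases k <;> simp only [Fin.zero_eta, Fin.mk_one, Fin.reduceFinMk]
    · linear_combination quad y hy 1 0 0 one_pos - quad y hy 2 0 0 two_pos
    · linear_combination quad y hy 1 1 0 one_pos - quad y hy 1 0 0 one_pos
    · linear_combination quad y hy 1 0 1 one_pos - quad y hy 1 0 0 one_pos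

/-- At `p = 1, 2, 4`, with `x = 2 ^ r`, eliminating `u` and `v` gives `c (x - 1) (x - 2) = 0`, and
`x < 1`. For `r = 1 - γ` this separates the internal energy from `D_s B^s` as functions of `φ_s`. -/
theorem eq_zero_of_mul_rpow_eq_affine {r c u v : ℝ} (hr : r < 0)
    (h : ∀ p : ℝ, 0 < p → c * p ^ r = u + v * p) : c = 0 ∧ u = 0 ∧ v = 0 := by
  have h1 := h 1 one_pos
  have h2 := h 2 two_pos
  have h4 := h (2 * 2) (by norm_num)
  have hx : (2 : ℝ) ^ r < 1 := Real.rpow_lt_one_of_one_lt_of_neg one_lt_two hr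
  rw [Real.mul_rpow two_pos.le two_pos.le] at h4
  rw [Real.one_rpow] at h1
  have hc : c * (((2 : ℝ) ^ r - 1) * ((2 : ℝ) ^ r - 2)) = 0 := by
    linear_combination h4 - 3 * h2 + 2 * h1
  have hc' : c = 0 := (mul_eq_zero.1 hc).resolve_right
    (mul_ne_zero (by linarith) (by linarith))
  rw [hc'] at h1 h2
  exact ⟨hc', by linarith, by linarith⟩

set_option maxHeartbeats 1000000 in
-- Quadratic terms in the velocities and in `ψ_s`, `χ_s` fix the weights, linear terms relate `B` to
-- the field, and the rest yields the entropy condition. The value of `∂_χ B^t` is recorded because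
-- it vanishes for a variational symmetry and then excludes `t ∂_χ`.
theorem IsDivergenceWith.exists_affineField (hA : A ≠ 0) (hγ : 1 < γ) (h : IsRegion Ω)
    (hS : IsEntropy Ω S) (hX : IsDivergenceWith Ω (lagrangian A γ S) X B) :
    ∃ b c d e c₁ c₂, (∀ y ∈ Ω, X y = affineField 0 b c d e c₁ c₂ y) ∧
      EntropyCondition (sRange Ω) γ S 0 b d ∧ ∀ y ∈ Ω, fderiv ℝ (B 0) y (eu 2) = c₁ := by
  have hs := hX.separated hA hγ.ne' h hS
  have hφ := h.pos
  have c0 := contDiffOn_eta hX.1 0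
  have c1 := contDiffOn_eta hX.1 1
  have c2 := contDiffOn_eta hX.1 2
  have cB := hX.2.1
  have comm : ∀ {f : J0 → ℝ}, ContDiffOn ℝ ∞ f Ω → ∀ y ∈ Ω, ∀ u v, hess f y u v = hess f y v u :=
    fun hf y hy => hess_comm (hf.contDiffAt (h.isOpen.mem_nhds hy))
  have hd : ∀ {f : J0 → ℝ}, ContDiffOn ℝ ∞ f Ω → ∀ y ∈ Ω, ∀ u v,
      HasDir (fun y => fderiv ℝ f y u) y v (hess f y u v) :=
    fun hf y hy => hasDir_fderiv (hf.contDiffAt (h.isOpen.mem_nhds hy))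
  have hφd : ∀ y ∈ Ω, HasDir (fun y : J0 => y.2 0) y (eu 0) 1 := fun y hy =>
    (hasDir_uc 0 y (eu 0)).congr_val (by simp [eu])
  have ca := fun y hy v => hd (contDiffOn_xi hX.1 0) y hy (ex 0) v
  have cb := fun y hy v => hd (contDiffOn_xi hX.1 1) y hy (ex 1) v
  have hz : ∀ y ∈ Ω, ∀ a b c p α β : ℝ, (jet1 y a b c p α β).1 ∈ Ω := fun y hy _ _ _ _ _ _ => hy
  have key' : ∀ y ∈ Ω, ∀ a b c p α β : ℝ, 0 < p → _ := fun y hy a b c p α β hp =>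
    (actionVariation_lagrangian hγ.ne' (hS.regular h (jet1_mem hy a b c hp α β)) X).symm.trans
      (hX.2.2 _ (jet1_mem hy a b c hp α β))
  simp only [Fin.sum_univ_two, D0_jet1_zero, D0_jet1_one] at key'
  have key : ∀ y ∈ Ω, ∀ a b c p α β : ℝ, 0 < p → _ := fun y hy a b c p α β hp => by
    have e := key' y hy a b c p α β hp
    simp only [hs.zeta1_t (hz y hy _ _ _ _ _ _), hs.zeta1_s (hz y hy _ _ _ _ _ _), D0_jet1_zero,
      D0_jet1_one, hs.xi_t_u y hy, hs.xi_s_u y hy] at e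
    simp only [jet1, phi, phi_s, phi_t, psi_t, psi_s, chi_s, chi_t, ss, Matrix.cons_val_zero,
      Matrix.cons_val_one, Matrix.cons_val] at e
    exact e
  have h00 : ∀ y ∈ Ω, fderiv ℝ (VF.eta X 0) y (eu 0) =
      (fderiv ℝ (VF.xi X 0) y (ex 0) - fderiv ℝ (VF.xi X 1) y (ex 1)) / 2 := fun y hy => by
    have e := fun a : ℝ => key y hy a 0 0 1 0 0 one_pos
    linear_combination (1 / 2) * (e 1 + e (-1) - 2 * e 0)
  have h11 : ∀ y ∈ Ω, y.2 0 * fderiv ℝ (VF.eta X 1) y (eu 1) = y.2 0 *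
      (fderiv ℝ (VF.xi X 0) y (ex 0) - fderiv ℝ (VF.xi X 1) y (ex 1)) / 2 - VF.eta X 0 y :=
    fun y hy => by
      have e := fun b : ℝ => key y hy 0 b 0 1 0 0 one_pos
      refine mul_left_cancel₀ (hφ y hy).ne' ?_
      linear_combination (1 / 2) * (e 1 + e (-1) - 2 * e 0)
  have h22 : ∀ y ∈ Ω, fderiv ℝ (VF.eta X 2) y (eu 2) =
      (fderiv ℝ (VF.xi X 0) y (ex 0) - fderiv ℝ (VF.xi X 1) y (ex 1)) / 2 := fun y hy => by
    have e := fun c : ℝ => key y hy 0 0 c 1 0 0 one_pos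
    linear_combination (1 / 2) * (e 1 + e (-1) - 2 * e 0)
  -- The cubic coefficient in `ψ_s`: it comes from `ζ^φ_s` multiplying `φ ψ_s ^ 2 / φ_s ^ 2`.
  have h01 : ∀ y ∈ Ω, fderiv ℝ (VF.eta X 0) y (eu 1) = 0 := fun y hy => by
    have e := fun α : ℝ => key y hy 0 0 0 1 α 0 one_pos
    refine mul_left_cancel₀ (mul_ne_zero (pow_ne_zero 2 hA) (hφ y hy).ne') ?_
    linear_combination (1 / 6) * (e 2 - e (-2) - 2 * (e 1 - e (-1)))
  have h02 : ∀ y ∈ Ω, fderiv ℝ (VF.eta X 0) y (eu 2) = 0 := fun y hy => by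
    have e := fun β : ℝ => key y hy 0 0 0 1 0 β one_pos
    have hφ' := (hφ y hy).ne'
    refine mul_left_cancel₀ (pow_ne_zero 2 hA) ?_
    have e' : A ^ 2 * fderiv ℝ (VF.eta X 0) y (eu 2) / y.2 0 = 0 := by
      linear_combination (1 / 6) * (e 2 - e (-2) - 2 * (e 1 - e (-1)))
    field_simp at e'
    linear_combination e'
  have h10 : ∀ y ∈ Ω, fderiv ℝ (VF.eta X 1) y (eu 0) = 0 := fun y hy => by
    have e := fun a b : ℝ => key y hy a b 0 1 0 0 one_pos
    refine mul_left_cancel₀ (pow_ne_zero 2 (hφ y hy).ne') ?_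
    linear_combination e 1 1 - e 1 0 - e 0 1 + e 0 0 - h01 y hy
  have h20 : ∀ y ∈ Ω, fderiv ℝ (VF.eta X 2) y (eu 0) = 0 := fun y hy => by
    have e := fun a b : ℝ => key y hy a 0 b 1 0 0 one_pos
    linear_combination e 1 1 - e 1 0 - e 0 1 + e 0 0 - h02 y hy
  have hM : ∀ y ∈ Ω, fderiv ℝ (VF.eta X 2) y (eu 1)
      = - (y.2 0 ^ 2 * fderiv ℝ (VF.eta X 1) y (eu 2)) := fun y hy => by
    have e := fun a b : ℝ => key y hy 0 a b 1 0 0 one_pos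
    linear_combination e 1 1 - e 1 0 - e 0 1 + e 0 0
  have hB0 : ∀ y ∈ Ω, fderiv ℝ (B 0) y (eu 0) = fderiv ℝ (VF.eta X 0) y (ex 0) := fun y hy => by
    have e := fun a : ℝ => key y hy a 0 0 1 0 0 one_pos
    linear_combination (-1 / 2) * (e 1 - e (-1))
  have hB1 : ∀ y ∈ Ω, fderiv ℝ (B 0) y (eu 1) = y.2 0 ^ 2 * fderiv ℝ (VF.eta X 1) y (ex 0) :=
    fun y hy => by
      have e := fun a : ℝ => key y hy 0 a 0 1 0 0 one_pos
      linear_combination (-1 / 2) * (e 1 - e (-1))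
  have hB2 : ∀ y ∈ Ω, fderiv ℝ (B 0) y (eu 2) = fderiv ℝ (VF.eta X 2) y (ex 0) := fun y hy => by
    have e := fun a : ℝ => key y hy 0 0 a 1 0 0 one_pos
    linear_combination (-1 / 2) * (e 1 - e (-1))
  have qα : ∀ y ∈ Ω, ∀ p : ℝ, 0 < p → p * (VF.eta X 0 y
      + 2 * (y.2 0 * fderiv ℝ (VF.eta X 1) y (eu 1)) + y.2 0 * fderiv ℝ (VF.xi X 0) y (ex 0)
      - y.2 0 * fderiv ℝ (VF.eta X 0) y (eu 0)) = y.2 0 * fderiv ℝ (VF.eta X 0) y (ex 1) := by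
    intro y hy p hp
    have e := fun α : ℝ => key y hy 0 0 0 p α 0 hp
    have hp' := hp.ne'
    refine mul_left_cancel₀ (pow_ne_zero 2 hA) ?_
    have e' : A ^ 2 * (VF.eta X 0 y / p
        + 2 * y.2 0 * (fderiv ℝ (VF.eta X 1) y (eu 1) - fderiv ℝ (VF.xi X 1) y (ex 1)) / p
        - y.2 0 * (fderiv ℝ (VF.eta X 0) y (ex 1) + p * fderiv ℝ (VF.eta X 0) y (eu 0)
          - p * fderiv ℝ (VF.xi X 1) y (ex 1)) / p ^ 2
        + y.2 0 / p * (fderiv ℝ (VF.xi X 0) y (ex 0) + fderiv ℝ (VF.xi X 1) y (ex 1))) = 0 := by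
      linear_combination -(e 1 + e (-1) - 2 * e 0)
    field_simp at e'
    linear_combination e'
  have h0s : ∀ y ∈ Ω, fderiv ℝ (VF.eta X 0) y (ex 1) = 0 := fun y hy => by
    refine (mul_eq_zero.1 ?_).resolve_left (hφ y hy).ne'
    linear_combination qα y hy 2 two_pos - 2 * qα y hy 1 one_pos
  have h0' : ∀ y ∈ Ω, VF.eta X 0 y = (fderiv ℝ (VF.xi X 0) y (ex 0)
      + (fderiv ℝ (VF.xi X 0) y (ex 0) - fderiv ℝ (VF.xi X 1) y (ex 1)) / 2) * y.2 0 := by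
    intro y hy
    have e := fun β : ℝ => key y hy 0 0 0 1 0 β one_pos
    have hφ' := (hφ y hy).ne'
    simp only [h0s y hy, h00 y hy, h22 y hy] at e
    have e' : A ^ 2 * (1 / y.2 0 * ((fderiv ℝ (VF.xi X 0) y (ex 0)
        - fderiv ℝ (VF.xi X 1) y (ex 1)) - 2 * fderiv ℝ (VF.xi X 1) y (ex 1)
        - (VF.eta X 0 y / y.2 0 + ((fderiv ℝ (VF.xi X 0) y (ex 0)
          - fderiv ℝ (VF.xi X 1) y (ex 1)) / 2 - fderiv ℝ (VF.xi X 1) y (ex 1)))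
        + (fderiv ℝ (VF.xi X 0) y (ex 0) + fderiv ℝ (VF.xi X 1) y (ex 1)))) = 0 := by
      linear_combination -(e 1 + e (-1) - 2 * e 0)
    have e2 := (mul_eq_zero.1 e').resolve_left (pow_ne_zero 2 hA)
    have e3 := (mul_eq_zero.1 e2).resolve_left (one_div_ne_zero hφ')
    field_simp at e3
    linear_combination (-1 / 2) * e3
  -- The kinetic energy (`h00`) and the `χ_s ^ 2` energy (`h0'`) give two values of `∂_φ η^φ` that
  -- differ by `∂_t ξ^t`. This excludes the scaling of `t` that the equations alone would allow.
  have a0 : ∀ y ∈ Ω, fderiv ℝ (VF.xi X 0) y (ex 0) = 0 := fun y hy => by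
    have e1 := (((((ca y hy (eu 0)).add (((ca y hy (eu 0)).sub (cb y hy (eu 0))).div
      (HasDir.const 2 y (eu 0)) two_ne_zero)).mul (hφd y hy))).congr_fun
        (Filter.eventually_of_mem (h.isOpen.mem_nhds hy) h0')).fderiv_eq
    rw [h00 y hy, hs.hess_xi_t h hX.1 hy, hs.hess_xi_s h hX.1 hy] at e1
    simp [eu] at e1
    linear_combination e1
  have h11' : ∀ y ∈ Ω, fderiv ℝ (VF.eta X 1) y (eu 1) = 0 := fun y hy => by
    refine (mul_eq_zero.1 ?_).resolve_left (hφ y hy).ne'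
    rw [h11 y hy, h0' y hy, a0 y hy]
    ring
  have h12 : ∀ y ∈ Ω, fderiv ℝ (VF.eta X 1) y (eu 2) = 0 := fun y hy => by
    have e1 := hess_eq_of_hasDir h.isOpen c2 hy hM
      (((hφd y hy).sq.mul (hd c1 y hy (eu 2) (eu 0))).neg)
    rw [comm c2 y hy, hess_eq_zero h.isOpen c2 hy h20, comm c1 y hy,
      hess_eq_zero h.isOpen c1 hy h10] at e1
    refine (mul_eq_zero.1 ?_).resolve_left (hφ y hy).ne'
    linear_combination (1 / 2) * e1
  have h21 : ∀ y ∈ Ω, fderiv ℝ (VF.eta X 2) y (eu 1) = 0 := fun y hy => by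
    rw [hM y hy, h12 y hy]; ring
  have lα : ∀ y ∈ Ω, ∀ p : ℝ, 0 < p → A ^ 2 * (y.2 0 * fderiv ℝ (VF.eta X 1) y (ex 1))
      + p * fderiv ℝ (B 1) y (eu 1) = 0 := by
    intro y hy p hp
    have e := fun α : ℝ => key y hy 0 0 0 p α 0 hp
    have hp' := hp.ne'
    simp only [h01 y hy, h10 y hy] at e
    have e' : A ^ 2 * (y.2 0 * fderiv ℝ (VF.eta X 1) y (ex 1)) / p
        + fderiv ℝ (B 1) y (eu 1) = 0 := by
      linear_combination (-1 / 2) * (e 1 - e (-1))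
    field_simp at e'
    linear_combination e'
  have h1s : ∀ y ∈ Ω, fderiv ℝ (VF.eta X 1) y (ex 1) = 0 := fun y hy => by
    refine mul_left_cancel₀ (mul_ne_zero (pow_ne_zero 2 hA) (hφ y hy).ne') ?_
    linear_combination 2 * lα y hy 1 one_pos - lα y hy 2 two_pos
  have lβ : ∀ y ∈ Ω, ∀ p : ℝ, 0 < p → A ^ 2 * fderiv ℝ (VF.eta X 2) y (ex 1)
      + p * (y.2 0 * fderiv ℝ (B 1) y (eu 2)) = 0 := by
    intro y hy p hp
    have e := fun β : ℝ => key y hy 0 0 0 p 0 β hp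
    have hp' := hp.ne'
    have hφ' := (hφ y hy).ne'
    simp only [h02 y hy, h20 y hy] at e
    have e' : A ^ 2 * fderiv ℝ (VF.eta X 2) y (ex 1) / (y.2 0 * p)
        + fderiv ℝ (B 1) y (eu 2) = 0 := by
      linear_combination (-1 / 2) * (e 1 - e (-1))
    field_simp at e'
    linear_combination e'
  have h2s : ∀ y ∈ Ω, fderiv ℝ (VF.eta X 2) y (ex 1) = 0 := fun y hy => by
    refine mul_left_cancel₀ (pow_ne_zero 2 hA) ?_
    linear_combination 2 * lβ y hy 1 one_pos - lβ y hy 2 two_pos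
  have hB12 : ∀ y ∈ Ω, fderiv ℝ (B 1) y (eu 2) = 0 := fun y hy => by
    refine mul_left_cancel₀ (hφ y hy).ne' ?_
    linear_combination lβ y hy 2 two_pos - lβ y hy 1 one_pos
  -- At rest and with `ψ_s = χ_s = 0`, only the internal energy and `D_t B^t + D_s B^s` remain, a
  -- relation in `φ_s = p` alone.
  have fin : ∀ y ∈ Ω, _ ∧ fderiv ℝ (B 0) y (ex 0) + fderiv ℝ (B 1) y (ex 1) = 0 ∧
      fderiv ℝ (B 1) y (eu 0) = 0 := fun y hy => by
    refine eq_zero_of_mul_rpow_eq_affine (r := 1 - γ)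
      (c := -(y.2 0 / y.2 0 ^ γ * (deriv S (y.1 1) * VF.xi X 1 y / (γ - 1)
        + (2 + 1 / (γ - 1)) * fderiv ℝ (VF.xi X 1) y (ex 1) * S (y.1 1)))) (by linarith) ?_
    intro p hp
    have e := key y hy 0 0 0 p 0 0 hp
    have hg := (Real.rpow_pos_of_pos (hφ y hy) γ).ne'
    have hg' := (Real.rpow_pos_of_pos hp γ).ne'
    have hγ' : γ - 1 ≠ 0 := by linarith
    have hp' := hp.ne'
    have hφ' := (hφ y hy).ne'
    simp only [h0s y hy, h00 y hy, h0' y hy, a0 y hy] at e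
    rw [Real.rpow_sub hp, Real.rpow_one]
    linear_combination (norm := skip) e
    field_simp
    ring
  have hb : ∀ y ∈ Ω, hess (VF.xi X 1) y (ex 1) (ex 1) = 0 := fun y hy => by
    have e1 := hess_eq_of_hasDir h.isOpen c0 hy h00 (((ca y hy (ex 1)).sub (cb y hy (ex 1))).div
      (HasDir.const 2 y (ex 1)) two_ne_zero)
    rw [comm c0 y hy, hess_eq_zero h.isOpen c0 hy h0s, hs.hess_xi_t h hX.1 hy] at e1
    simp [ex] at e1 ⊢
    linear_combination 2 * e1
  have h0 : ∀ y ∈ Ω, VF.eta X 0 y =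
      (fderiv ℝ (VF.xi X 0) y (ex 0) - fderiv ℝ (VF.xi X 1) y (ex 1) / 2) * y.2 0 := fun y hy => by
    rw [h0' y hy, a0 y hy]; ring
  have hB00 : ∀ y ∈ Ω, fderiv ℝ (B 0) y (eu 0) = 0 := fun y hy => by
    have e1 := ((((ca y hy (ex 0)).sub ((cb y hy (ex 0)).div (HasDir.const 2 y (ex 0))
      two_ne_zero)).mul (hasDir_uc 0 y (ex 0))).congr_fun
        (Filter.eventually_of_mem (h.isOpen.mem_nhds hy) h0)).fderiv_eq
    rw [hess_eq_zero h.isOpen (contDiffOn_xi hX.1 0) hy a0, hs.hess_xi_s h hX.1 hy] at e1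
    rw [hB0 y hy, e1]
    simp [ex]
  -- `B^t` and `η^ψ` do not depend on `φ`, whereas `hB1` carries the factor `φ ^ 2`.
  have h1t : ∀ y ∈ Ω, fderiv ℝ (VF.eta X 1) y (ex 0) = 0 := fun y hy => by
    have e1 := hess_eq_of_hasDir h.isOpen (cB 0) hy hB1
      ((hφd y hy).sq.mul (hd c1 y hy (ex 0) (eu 0)))
    rw [comm (cB 0) y hy, hess_eq_zero h.isOpen (cB 0) hy hB00, comm c1 y hy,
      hess_eq_zero h.isOpen c1 hy h10] at e1
    refine (mul_eq_zero.1 ?_).resolve_left (hφ y hy).ne'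
    linear_combination (-1 / 2) * e1
  -- `∂_t² η^χ = ∂_t ∂_χ B^t = ∂_χ ∂_t B^t = -∂_χ ∂_s B^s`, and `B^s` does not depend on `χ`.
  have h2t : ∀ y ∈ Ω, hess (VF.eta X 2) y (ex 0) (ex 0) = 0 := fun y hy => by
    have e1 := hess_eq_of_hasDir h.isOpen (cB 0) hy hB2 (hd c2 y hy (ex 0) (ex 0))
    have e2 := hess_eq_of_hasDir h.isOpen (cB 0) hy
      (fun y hy => eq_neg_of_add_eq_zero_left (fin y hy).2.1) (hd (cB 1) y hy (ex 1) (eu 2)).neg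
    rw [comm (cB 1) y hy, hess_eq_zero h.isOpen (cB 1) hy hB12, comm (cB 0) y hy] at e2
    rw [← e1, e2, neg_zero]
  obtain ⟨a, b, c, d, e, c₁, c₂, hf, ha', hb', hc⟩ := hs.exists_affineField h hX.1
    (fun y hy => hess_eq_zero h.isOpen (contDiffOn_xi hX.1 0) hy a0 _) hb h0
    (fun y hy i => by fin_cases i; exacts [h1t y hy, h1s y hy])
    (fun y hy k => by fin_cases k; exacts [h10 y hy, h11' y hy, h12 y hy]) h2s h20 h21
    (fun y hy => by rw [h22 y hy, a0 y hy]; ring) h2t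
  have ha : a = 0 := by
    obtain ⟨y, hy⟩ := h.isConnected.nonempty
    rw [← ha' y hy, a0 y hy]
  subst ha
  refine ⟨b, c, d, e, c₁, c₂, hf, ?_, fun y hy => by rw [hB2 y hy, hc y hy]⟩
  rintro s ⟨y, hy, rfl⟩
  have e1 := neg_eq_zero.1 (fin y hy).1
  have hg := (Real.rpow_pos_of_pos (hφ y hy) γ).ne'
  have hγ' : γ - 1 ≠ 0 := by linarith
  have e3 := (mul_eq_zero.1 e1).resolve_left (div_ne_zero (hφ y hy).ne' hg)
  have e2 : VF.xi X 1 y = b * y.1 1 + d := by rw [VF.xi, hf y hy]; simp [affineField]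
  rw [e2, hb' y hy] at e3
  linear_combination (norm := skip) (γ - 1) * e3
  field_simp
  ring

end CylMHD

end

noncomputable section

namespace CylMHD

variable {A γ : ℝ} {S : ℝ → ℝ} {X : VF} {Ω : Set J0} {B : Fin 2 → J0 → ℝ}

/-! ### The entropy functions with additional symmetries -/

section Entropy

variable {I : Set ℝ} {b d m S₀ s₀ q : ℝ}

/-- `Real.log` is even, so `exp (q log (s - s₀))` represents the function on both sides of `s₀` and
no case distinction is needed. -/
theorem hasDerivAt_abs_sub_rpow {s : ℝ} (hs : s ≠ s₀) (q : ℝ) :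
    HasDerivAt (fun s => |s - s₀| ^ q) (q * |s - s₀| ^ q / (s - s₀)) s := by
  have h0 : s - s₀ ≠ 0 := sub_ne_zero.2 hs
  have h1 : HasDerivAt (fun s => Real.exp (Real.log (s - s₀) * q))
      (Real.exp (Real.log (s - s₀) * q) * (1 / (s - s₀) * q)) s :=
    ((((hasDerivAt_id s).sub_const s₀).log h0).mul_const q).exp
  have h2 : ∀ t, t - s₀ ≠ 0 → |t - s₀| ^ q = Real.exp (Real.log (t - s₀) * q) := fun t ht => by
    rw [Real.rpow_def_of_pos (abs_pos.2 ht), Real.log_abs]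
  refine (h1.congr_of_eventuallyEq ?_).congr_deriv ?_
  · filter_upwards [isOpen_ne.mem_nhds hs] with t ht using h2 t (sub_ne_zero.2 ht)
  · rw [h2 s h0]
    ring

/-- A function that satisfies `S' = g S`, where `g` is the logarithmic derivative of `f`, is a
multiple of `f`. -/
theorem exists_eq_const_mul (hI : IsOpen I) (hI' : IsPreconnected I) (hS : DifferentiableOn ℝ S I)
    {f g : ℝ → ℝ} (hf : ∀ s ∈ I, HasDerivAt f (g s * f s) s) (hf0 : ∀ s ∈ I, f s ≠ 0)
    (h : ∀ s ∈ I, deriv S s = g s * S s) : ∃ S₀, ∀ s ∈ I, S s = S₀ * f s := by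
  have hd : ∀ s ∈ I, HasDerivAt (fun s => S s / f s) 0 s := fun s hs => by
    have h1 : HasDerivAt S (g s * S s) s :=
      h s hs ▸ ((hS s hs).differentiableAt (hI.mem_nhds hs)).hasDerivAt
    refine (h1.div (hf s hs) (hf0 s hs)).congr_deriv ?_
    field_simp [hf0 s hs]
    ring
  obtain ⟨S₀, h0⟩ := hI.exists_is_const_of_deriv_eq_zero hI'
    (fun s hs => (hd s hs).differentiableAt.differentiableWithinAt) fun s hs => (hd s hs).deriv
  exact ⟨S₀, fun s hs => (div_eq_iff (hf0 s hs)).1 (h0 s hs)⟩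

theorem exists_isPowOn (hI : IsOpen I) (hI' : IsPreconnected I) (hI'' : I.Nonempty)
    (hS : DifferentiableOn ℝ S I) (hS0 : ∀ s ∈ I, S s ≠ 0)
    (h : ∀ s ∈ I, deriv S s * (b * s + d) = m * S s) (hb : b ≠ 0) (hm : m ≠ 0) :
    ∃ S₀, IsPowOn I S S₀ (-d / b) (m / b) := by
  -- At a zero of `b s + d` the equation would give `m S = 0`, impossible for `m ≠ 0` and
  -- nonvanishing `S`.
  have hn : ∀ s ∈ I, s ≠ -d / b := by
    rintro s hs rfl
    have e := h _ hs
    rw [mul_div_cancel₀ _ hb, neg_add_cancel, mul_zero] at e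
    exact mul_ne_zero hm (hS0 _ hs) e.symm
  obtain ⟨S₀, h0⟩ := exists_eq_const_mul hI hI' hS
    (f := fun s => |s - -d / b| ^ (m / b)) (g := fun s => m / b / (s - -d / b))
    (fun s hs => (hasDerivAt_abs_sub_rpow (hn s hs) (m / b)).congr_deriv (by ring))
    (fun s hs => (Real.rpow_pos_of_pos (abs_pos.2 (sub_ne_zero.2 (hn s hs))) _).ne')
    (fun s hs => by
      have e1 := sub_ne_zero.2 (hn s hs)
      have e2 : b * s + d = b * (s - -d / b) := by field_simp; ring
      have e := h s hs
      rw [e2] at e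
      generalize s - -d / b = x at e e1
      field_simp
      linear_combination e)
  obtain ⟨s, hs⟩ := hI''
  refine ⟨S₀, ?_, fun h1 => hn _ h1 rfl, h0⟩
  rintro rfl
  exact hS0 s hs (by rw [h0 s hs, zero_mul])

theorem exists_isExpOn (hI : IsOpen I) (hI' : IsPreconnected I) (hI'' : I.Nonempty)
    (hS : DifferentiableOn ℝ S I) (hS0 : ∀ s ∈ I, S s ≠ 0)
    (h : ∀ s ∈ I, deriv S s * d = m * S s) (hd : d ≠ 0) :
    ∃ S₀, IsExpOn I S S₀ (m / d) := by
  obtain ⟨S₀, h0⟩ := exists_eq_const_mul hI hI' hS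
    (f := fun s => Real.exp (m / d * s)) (g := fun _ => m / d)
    (fun s hs => ((hasDerivAt_id s).const_mul (m / d)).exp.congr_deriv (by simp; ring))
    (fun s hs => (Real.exp_pos _).ne')
    (fun s hs => by
      have e := h s hs
      field_simp
      linear_combination e)
  obtain ⟨s, hs⟩ := hI''
  refine ⟨S₀, ?_, h0⟩
  rintro rfl
  exact hS0 s hs (by rw [h0 s hs, zero_mul])

/-- The point `-d / b` may lie in `I`. There `S' = 0` follows by differentiating the equation once,
since the only surviving term is `b S'`. -/
theorem exists_isConstOn (hI : IsOpen I) (hI' : IsPreconnected I) (hI'' : I.Nonempty)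
    (hS : DifferentiableOn ℝ S I) (hS' : DifferentiableOn ℝ (deriv S) I) (hS0 : ∀ s ∈ I, S s ≠ 0)
    (h : ∀ s ∈ I, deriv S s * (b * s + d) = 0) (hbd : ¬ (b = 0 ∧ d = 0)) :
    ∃ S₀, IsConstOn I S S₀ := by
  have h1 : ∀ s ∈ I, deriv S s = 0 := fun s hs => by
    by_cases hx : b * s + d = 0
    · have h2 := (((hS' s hs).differentiableAt (hI.mem_nhds hs)).hasDerivAt.mul
        (((hasDerivAt_id s).const_mul b).add_const d)).unique
          ((hasDerivAt_const s 0).congr_of_eventuallyEq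
            (Filter.eventually_of_mem (hI.mem_nhds hs) h))
      simp only [id, hx, mul_zero, zero_add, mul_one] at h2
      refine (mul_eq_zero.1 h2).resolve_right fun hb => hbd ⟨hb, ?_⟩
      rwa [hb, zero_mul, zero_add] at hx
    · exact (mul_eq_zero.1 (h s hs)).resolve_right hx
  obtain ⟨S₀, h0⟩ := hI.exists_is_const_of_deriv_eq_zero hI' hS h1
  obtain ⟨s, hs⟩ := hI''
  exact ⟨S₀, h0 s hs ▸ hS0 s hs, h0⟩

theorem eq_zero_of_affine_eq_zero (hI : IsOpen I) (hI'' : I.Nonempty)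
    (h : ∀ s ∈ I, b * s + d = 0) : b = 0 ∧ d = 0 := by
  obtain ⟨s, hs⟩ := hI''
  have h1 : HasDerivAt (fun s => b * s + d) b s := by
    simpa using ((hasDerivAt_id s).const_mul b).add_const d
  have hb : b = 0 := h1.unique ((hasDerivAt_const s 0).congr_of_eventuallyEq
    (Filter.eventually_of_mem (hI.mem_nhds hs) h))
  have := h s hs
  exact ⟨hb, by rwa [hb, zero_mul, zero_add] at this⟩

theorem IsConstOn.deriv_eq (hI : IsOpen I) (h : IsConstOn I S S₀) {s : ℝ} (hs : s ∈ I) :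
    deriv S s = 0 :=
  ((hasDerivAt_const s S₀).congr_of_eventuallyEq
    (Filter.eventually_of_mem (hI.mem_nhds hs) h.2)).deriv

theorem IsPowOn.deriv_eq (hI : IsOpen I) (h : IsPowOn I S S₀ s₀ q) {s : ℝ} (hs : s ∈ I) :
    deriv S s * (s - s₀) = q * S s := by
  have h0 : s ≠ s₀ := fun e => h.2.1 (e ▸ hs)
  have h1 := sub_ne_zero.2 h0
  rw [(((hasDerivAt_abs_sub_rpow h0 q).const_mul S₀).congr_of_eventuallyEq
    (Filter.eventually_of_mem (hI.mem_nhds hs) h.2.2)).deriv, h.2.2 s hs]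
  field_simp

theorem IsExpOn.deriv_eq (hI : IsOpen I) (h : IsExpOn I S S₀ q) {s : ℝ} (hs : s ∈ I) :
    deriv S s = q * S s := by
  rw [((((hasDerivAt_id s).const_mul q).exp.const_mul S₀).congr_of_eventuallyEq
    (Filter.eventually_of_mem (hI.mem_nhds hs) h.2)).deriv, h.2 s hs]
  simp
  ring

variable {a : ℝ}

theorem IsConstOn.entropyCondition_iff (hI : IsOpen I) (hI'' : I.Nonempty)
    (h : IsConstOn I S S₀) :
    EntropyCondition I γ S a b d ↔ (2 * γ - 2) * (a - b / 2) = γ * b := by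
  constructor
  · intro hE
    obtain ⟨s, hs⟩ := hI''
    have e := hE s hs
    rw [h.deriv_eq hI hs, h.2 s hs, zero_mul] at e
    exact sub_eq_zero.1 ((mul_eq_zero.1 e.symm).resolve_right h.1)
  · intro e s hs
    rw [h.deriv_eq hI hs, e]
    ring

/-- After multiplication by `s - s₀` the condition says that `S` times an affine function of `s`
vanishes; on a nonempty open set both coefficients must be zero. -/
theorem IsPowOn.entropyCondition_iff (hI : IsOpen I) (hI'' : I.Nonempty)
    (hS0 : ∀ s ∈ I, S s ≠ 0) (h : IsPowOn I S S₀ s₀ q) (hq : q ≠ 0) :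
    EntropyCondition I γ S a b d ↔
      (2 * γ - 2) * (a - b / 2) = (γ + q) * b ∧ d = -(b * s₀) := by
  have key : ∀ s ∈ I, (deriv S s * (b * s + d) = ((2 * γ - 2) * (a - b / 2) - γ * b) * S s ↔
      (q * b - ((2 * γ - 2) * (a - b / 2) - γ * b)) * s
        + (q * d + ((2 * γ - 2) * (a - b / 2) - γ * b) * s₀) = 0) := by
    intro s hs
    have h1 : s - s₀ ≠ 0 := sub_ne_zero.2 fun e => h.2.1 (e ▸ hs)
    have e := h.deriv_eq hI hs
    constructor
    · intro E
      refine (mul_eq_zero.1 ?_).resolve_right (hS0 s hs)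
      linear_combination (s - s₀) * E - (b * s + d) * e
    · intro E
      refine mul_right_cancel₀ h1 ?_
      linear_combination S s * E + (b * s + d) * e
  constructor
  · intro hE
    obtain ⟨e1, e2⟩ := eq_zero_of_affine_eq_zero hI hI'' fun s hs => (key s hs).1 (hE s hs)
    refine ⟨by linear_combination -e1, mul_left_cancel₀ hq ?_⟩
    linear_combination e2 + s₀ * e1
  · rintro ⟨e1, rfl⟩ s hs
    refine (key s hs).2 ?_
    linear_combination (s₀ - s) * e1

theorem IsExpOn.entropyCondition_iff (hI : IsOpen I) (hI'' : I.Nonempty)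
    (hS0 : ∀ s ∈ I, S s ≠ 0) (h : IsExpOn I S S₀ q) (hq : q ≠ 0) :
    EntropyCondition I γ S a b d ↔ b = 0 ∧ (2 * γ - 2) * a = q * d := by
  constructor
  · intro hE
    obtain ⟨e1, e2⟩ := eq_zero_of_affine_eq_zero (b := q * b)
      (d := q * d - ((2 * γ - 2) * (a - b / 2) - γ * b)) hI hI'' fun s hs => by
        have e := hE s hs
        rw [h.deriv_eq hI hs] at e
        refine (mul_eq_zero.1 ?_).resolve_right (hS0 s hs)
        linear_combination e
    have hb := (mul_eq_zero.1 e1).resolve_left hq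
    subst hb
    exact ⟨rfl, by linear_combination -e2⟩
  · rintro ⟨rfl, e⟩ s hs
    rw [h.deriv_eq hI hs]
    linear_combination -S s * e

end Entropy

theorem IsEntropy.differentiableOn (hS : IsEntropy Ω S) : DifferentiableOn ℝ S (sRange Ω) :=
  hS.1.differentiableOn (by simp)

theorem IsEntropy.differentiableOn_deriv (h : IsRegion Ω) (hS : IsEntropy Ω S) :
    DifferentiableOn ℝ (deriv S) (sRange Ω) :=
  (hS.1.deriv_of_isOpen h.isOpen_sRange (m := ∞) (by simp)).differentiableOn (by simp)

/-- For `S' (b s + d) = m S`: `m = 0` gives constants, `m ≠ 0 = b` exponentials of rate `m / d`, and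
`m ≠ 0 ≠ b` powers of exponent `m / b` centred at `-d / b`. -/
theorem entropy_cases (h : IsRegion Ω) (hS : IsEntropy Ω S) {a b d : ℝ}
    (hE : EntropyCondition (sRange Ω) γ S a b d) (hbd : ¬ (b = 0 ∧ d = 0)) :
    (∃ S₀, IsConstOn (sRange Ω) S S₀) ∨
      (∃ S₀ s₀ q, q ≠ 0 ∧ IsPowOn (sRange Ω) S S₀ s₀ q) ∨
      (∃ S₀ q, q ≠ 0 ∧ IsExpOn (sRange Ω) S S₀ q) := by
  have h1 := h.isOpen_sRange
  have h2 := h.isPreconnected_sRange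
  have h3 := h.nonempty_sRange
  by_cases hm : (2 * γ - 2) * (a - b / 2) - γ * b = 0
  · refine Or.inl (exists_isConstOn h1 h2 h3 hS.differentiableOn (hS.differentiableOn_deriv h) hS.2
      (fun s hs => ?_) hbd)
    rw [hE s hs, hm, zero_mul]
  · by_cases hb : b = 0
    · have hd : d ≠ 0 := fun hd => hbd ⟨hb, hd⟩
      obtain ⟨S₀, h0⟩ := exists_isExpOn h1 h2 h3 hS.differentiableOn hS.2
        (fun s hs => by have := hE s hs; rwa [hb, zero_mul, zero_add, ← hb] at this) hd
      exact Or.inr (Or.inr ⟨S₀, _, div_ne_zero hm hd, h0⟩)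
    · obtain ⟨S₀, h0⟩ := exists_isPowOn h1 h2 h3 hS.differentiableOn hS.2 hE hb hm
      exact Or.inr (Or.inl ⟨S₀, _, _, div_ne_zero hm hb, h0⟩)

theorem entropy_cases_variational (hγ : 1 < γ) (h : IsRegion Ω) (hS : IsEntropy Ω S) {b d : ℝ}
    (hE : EntropyCondition (sRange Ω) γ S 0 b d) (hbd : ¬ (b = 0 ∧ d = 0)) :
    (∃ S₀, IsConstOn (sRange Ω) S S₀) ∨
      (∃ S₀ s₀, IsPowOn (sRange Ω) S S₀ s₀ (1 - 2 * γ)) := by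
  have h1 := h.isOpen_sRange
  have h2 := h.isPreconnected_sRange
  have h3 := h.nonempty_sRange
  have em : (2 * γ - 2) * (0 - b / 2) - γ * b = (1 - 2 * γ) * b := by ring
  by_cases hb : b = 0
  · refine Or.inl (exists_isConstOn h1 h2 h3 hS.differentiableOn (hS.differentiableOn_deriv h) hS.2
      (fun s hs => ?_) hbd)
    rw [hE s hs, em, hb]
    ring
  · obtain ⟨S₀, h0⟩ := exists_isPowOn h1 h2 h3 hS.differentiableOn hS.2 hE hb
      (em ▸ mul_ne_zero (by linarith) hb)
    rw [em, mul_div_cancel_right₀ _ hb] at h0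
    exact Or.inr ⟨S₀, _, h0⟩

/-! ### Spans of the generators -/

/-- Translates spans into the parameters of `affineField`, so that each classification becomes
linear algebra on `a`, `b` and `d`. -/
theorem spannedOn_iff {n : ℕ} {G : Fin n → VF} {a b c d e c₁ c₂ : (Fin n → ℝ) → ℝ}
    (hG : ∀ r y, ∑ i, r i • G i y =
      affineField (a r) (b r) (c r) (d r) (e r) (c₁ r) (c₂ r) y) :
    SpannedOn Ω G X ↔ ∃ r, ∀ y ∈ Ω, X y =
      affineField (a r) (b r) (c r) (d r) (e r) (c₁ r) (c₂ r) y := by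
  simp only [SpannedOn, hG]

theorem spannedOn_kernel : SpannedOn Ω ![dt, dpsi, dchi, tdchi] X ↔
    ∃ r : Fin 4 → ℝ, ∀ y ∈ Ω, X y = affineField 0 0 (r 0) 0 (r 1) (r 3) (r 2) y :=
  spannedOn_iff fun r y => by
    ext i <;> fin_cases i <;>
      simp [Fin.sum_univ_succ, affineField, dt, dpsi, dchi, tdchi]
    ring

theorem spannedOn_three : SpannedOn Ω ![dt, dpsi, dchi] X ↔
    ∃ r : Fin 3 → ℝ, ∀ y ∈ Ω, X y = affineField 0 0 (r 0) 0 (r 1) 0 (r 2) y :=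
  spannedOn_iff fun r y => by
    ext i <;> fin_cases i <;> simp [Fin.sum_univ_succ, affineField, dt, dpsi, dchi]

theorem spannedOn_three_ds : SpannedOn Ω ![dt, dpsi, dchi, ds] X ↔
    ∃ r : Fin 4 → ℝ, ∀ y ∈ Ω, X y = affineField 0 0 (r 0) (r 3) (r 1) 0 (r 2) y :=
  spannedOn_iff fun r y => by
    ext i <;> fin_cases i <;> simp [Fin.sum_univ_succ, affineField, dt, dpsi, dchi, ds]

theorem spannedOn_kernel_ds : SpannedOn Ω ![dt, dpsi, dchi, tdchi, ds] X ↔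
    ∃ r : Fin 5 → ℝ, ∀ y ∈ Ω, X y = affineField 0 0 (r 0) (r 4) (r 1) (r 3) (r 2) y :=
  spannedOn_iff fun r y => by
    ext i <;> fin_cases i <;>
      simp [Fin.sum_univ_succ, affineField, dt, dpsi, dchi, tdchi, ds]
    ring

theorem spannedOn_const : SpannedOn Ω ![dt, dpsi, dchi, tdchi, ds, extConst γ] X ↔
    ∃ r : Fin 6 → ℝ, ∀ y ∈ Ω, X y = affineField ((2 * γ - 1) * r 5) (2 * (γ - 1) * r 5) (r 0) (r 4)
      (r 1) (r 3) (r 2) y :=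
  spannedOn_iff fun r y => by
    ext i <;> fin_cases i <;>
      simp [Fin.sum_univ_succ, affineField, dt, dpsi, dchi, tdchi, ds, extConst, tdt, sds, scl] <;>
      ring

theorem spannedOn_pow (q s₀ : ℝ) : SpannedOn Ω ![dt, dpsi, dchi, tdchi, extPow γ q s₀] X ↔
    ∃ r : Fin 5 → ℝ, ∀ y ∈ Ω, X y = affineField ((2 * γ + q - 1) * r 4) (2 * (γ - 1) * r 4) (r 0)
      (-(2 * (γ - 1) * r 4 * s₀)) (r 1) (r 3) (r 2) y :=
  spannedOn_iff fun r y => by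
    ext i <;> fin_cases i <;>
      simp [Fin.sum_univ_succ, affineField, dt, dpsi, dchi, tdchi, extPow, tdt, sds, scl] <;>
      ring

theorem spannedOn_exp (q : ℝ) : SpannedOn Ω ![dt, dpsi, dchi, tdchi, extExp γ q] X ↔
    ∃ r : Fin 5 → ℝ, ∀ y ∈ Ω, X y = affineField (q * r 4) 0 (r 0)
      (2 * (γ - 1) * r 4) (r 1) (r 3) (r 2) y :=
  spannedOn_iff fun r y => by
    ext i <;> fin_cases i <;>
      simp [Fin.sum_univ_succ, affineField, dt, dpsi, dchi, tdchi, ds, extExp, tdt, scl] <;>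
      ring

theorem spannedOn_three_extVar (s₀ : ℝ) : SpannedOn Ω ![dt, dpsi, dchi, extVar s₀] X ↔
    ∃ r : Fin 4 → ℝ, ∀ y ∈ Ω, X y = affineField 0 (2 * r 3) (r 0) (-(2 * r 3 * s₀)) (r 1)
      0 (r 2) y :=
  spannedOn_iff fun r y => by
    ext i <;> fin_cases i <;>
      simp [Fin.sum_univ_succ, affineField, dt, dpsi, dchi, extVar, sds, scl] <;> ring

theorem spannedOn_kernel_extVar (s₀ : ℝ) :
    SpannedOn Ω ![dt, dpsi, dchi, tdchi, extVar s₀] X ↔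
    ∃ r : Fin 5 → ℝ, ∀ y ∈ Ω, X y = affineField 0 (2 * r 4) (r 0) (-(2 * r 4 * s₀)) (r 1)
      (r 3) (r 2) y :=
  spannedOn_iff fun r y => by
    ext i <;> fin_cases i <;>
      simp [Fin.sum_univ_succ, affineField, dt, dpsi, dchi, tdchi, extVar, sds, scl] <;> ring

end CylMHD

end

noncomputable section

namespace CylMHD

variable {A γ : ℝ} {S : ℝ → ℝ} {X : VF} {Ω : Set J0} {B : Fin 2 → J0 → ℝ} {S₀ s₀ q : ℝ}

/-! ### Symmetries of the system -/

theorem IsRegion.sRange_eq_zero (h : IsRegion Ω) {b d : ℝ} (h0 : ∀ y ∈ Ω, b * y.1 1 + d = 0) :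
    b = 0 ∧ d = 0 :=
  eq_zero_of_affine_eq_zero h.isOpen_sRange h.nonempty_sRange
    (by rintro _ ⟨y, hy, rfl⟩; exact h0 y hy)

/-- Only the parameters entering the entropy condition are compared: `b` and `d` are seen on the
open range of `s`, and `a` because `φ > 0`. -/
theorem affineField_injOn (h : IsRegion Ω) {a b c d e c₁ c₂ a' b' c' d' e' c₁' c₂' : ℝ}
    (hX : ∀ y ∈ Ω, affineField a b c d e c₁ c₂ y = affineField a' b' c' d' e' c₁' c₂' y) :
    a = a' ∧ b = b' ∧ d = d' := by
  obtain ⟨hb, hd⟩ := h.sRange_eq_zero (b := b - b') (d := d - d') fun y hy => by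
    have e : b * y.1 1 + d = b' * y.1 1 + d' := congrArg (fun x : J0 => x.1 1) (hX y hy)
    linear_combination e
  obtain ⟨y, hy⟩ := h.isConnected.nonempty
  have e : (a - b / 2) * y.2 0 = (a' - b' / 2) * y.2 0 := congrArg (fun x : J0 => x.2 0) (hX y hy)
  have e := mul_right_cancel₀ (h.pos y hy).ne' e
  exact ⟨by linear_combination e + hb / 2, sub_eq_zero.1 hb, sub_eq_zero.1 hd⟩

theorem entropyCondition_zero (I : Set ℝ) (γ : ℝ) (S : ℝ → ℝ) : EntropyCondition I γ S 0 0 0 :=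
  fun _ _ => by ring

theorem IsEntropy.one (Ω : Set J0) : IsEntropy Ω fun _ => 1 :=
  ⟨contDiffOn_const, fun _ _ => one_ne_zero⟩

theorem IsEntropy.exp (Ω : Set J0) : IsEntropy Ω Real.exp :=
  ⟨Real.contDiff_exp.contDiffOn, fun s _ => Real.exp_ne_zero s⟩

/-- The kernel of the symmetry algebras. -/
theorem isSymmetry_forall_iff (hA : A ≠ 0) (hγ : 1 < γ) (h : IsRegion Ω) :
    (∀ S : ℝ → ℝ, IsEntropy Ω S → IsSymmetry Ω (system A γ S) X) ↔
      SpannedOn Ω ![dt, dpsi, dchi, tdchi] X := by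
  rw [spannedOn_kernel]
  constructor
  · intro hX
    -- Two entropies suffice: `S = exp` forces `b = 0` and `(2 γ - 2) a = d`, and `S = 1` then
    -- forces `a = 0`.
    obtain ⟨a, b, c, d, e, c₁, c₂, h1, hE1⟩ :=
      (isSymmetry_system_iff hA hγ h (IsEntropy.one Ω)).1 (hX _ (IsEntropy.one Ω))
    obtain ⟨a', b', c', d', e', c₁', c₂', h2, hE2⟩ :=
      (isSymmetry_system_iff hA hγ h (IsEntropy.exp Ω)).1 (hX _ (IsEntropy.exp Ω))
    obtain ⟨rfl, rfl, rfl⟩ := affineField_injOn h fun y hy => (h1 y hy).symm.trans (h2 y hy)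
    have hc : IsConstOn (sRange Ω) (fun _ => (1 : ℝ)) 1 := ⟨one_ne_zero, fun _ _ => rfl⟩
    have he : IsExpOn (sRange Ω) Real.exp 1 1 := ⟨one_ne_zero, fun _ _ => by simp⟩
    have e1 := (hc.entropyCondition_iff h.isOpen_sRange h.nonempty_sRange).1 hE1
    obtain ⟨rfl, e2⟩ := (he.entropyCondition_iff h.isOpen_sRange h.nonempty_sRange
      (fun s _ => Real.exp_ne_zero s) one_ne_zero).1 hE2
    have h3 : 2 * γ - 2 ≠ 0 := by linarith
    have ha : a = 0 := (mul_eq_zero.1 (by linear_combination e1)).resolve_left h3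
    subst ha
    have hd : d = 0 := by linear_combination -e2
    subst hd
    exact ⟨![c, e, c₂, c₁], h1⟩
  · rintro ⟨r, hr⟩ S hS
    exact (isSymmetry_system_iff hA hγ h hS).2
      ⟨_, _, _, _, _, _, _, hr, entropyCondition_zero _ _ _⟩

theorem system_iff_eulerLagrange (hγ : 1 < γ) (h : IsRegion Ω) (hS : IsEntropy Ω S) {w : J2}
    (hw : w ∈ adm2 Ω) :
    (∀ k, system A γ S k w = 0) ↔ ∀ k, eulerLagrange (lagrangian A γ S) k w = 0 := by
  have hr := hS.regular h hw.1
  refine forall_congr' fun k => ?_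
  rw [eulerLagrange_lagrangian hγ.ne' hr, neg_mul, neg_eq_zero, mul_eq_zero]
  have h1 := hr.phi_pos.ne'
  refine ⟨Or.inr, fun h => h.resolve_left ?_⟩
  fin_cases k <;> simp [h1]

theorem isSymmetry_iff_of_isConstOn (hA : A ≠ 0) (hγ : 1 < γ) (h : IsRegion Ω)
    (hS : IsEntropy Ω S) (hc : IsConstOn (sRange Ω) S S₀) :
    IsSymmetry Ω (system A γ S) X ↔
      SpannedOn Ω ![dt, dpsi, dchi, tdchi, ds, extConst γ] X := by
  have h3 : γ - 1 ≠ 0 := by linarith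
  simp only [isSymmetry_system_iff hA hγ h hS, spannedOn_const,
    hc.entropyCondition_iff h.isOpen_sRange h.nonempty_sRange]
  constructor
  · rintro ⟨a, b, c, d, e, c₁, c₂, hX, hE⟩
    -- The last coefficient is read off from the `s ∂_s` part of `extConst`; the condition then
    -- fixes `a`.
    refine ⟨![c, e, c₂, c₁, d, b / (2 * (γ - 1))], fun y hy => ?_⟩
    rw [hX y hy]
    have hb : b = 2 * (γ - 1) * (b / (2 * (γ - 1))) := by field_simp
    have ha : a = (2 * γ - 1) * (b / (2 * (γ - 1))) := by
      field_simp
      linear_combination hE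
    simp only [ha, ← hb]
    simp [← hb]
  · rintro ⟨r, hr⟩
    exact ⟨_, _, _, _, _, _, _, hr, by ring⟩

theorem isSymmetry_iff_of_isPowOn (hA : A ≠ 0) (hγ : 1 < γ) (h : IsRegion Ω)
    (hS : IsEntropy Ω S) (hq : q ≠ 0) (hc : IsPowOn (sRange Ω) S S₀ s₀ q) :
    IsSymmetry Ω (system A γ S) X ↔
      SpannedOn Ω ![dt, dpsi, dchi, tdchi, extPow γ q s₀] X := by
  have h3 : γ - 1 ≠ 0 := by linarith
  simp only [isSymmetry_system_iff hA hγ h hS, spannedOn_pow,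
    hc.entropyCondition_iff h.isOpen_sRange h.nonempty_sRange hS.2 hq]
  constructor
  · rintro ⟨a, b, c, d, e, c₁, c₂, hX, hE, rfl⟩
    refine ⟨![c, e, c₂, c₁, b / (2 * (γ - 1))], fun y hy => ?_⟩
    have hb : 2 * (γ - 1) * (b / (2 * (γ - 1))) = b := by field_simp
    have ha : (2 * γ + q - 1) * (b / (2 * (γ - 1))) = a := by
      field_simp
      linear_combination -hE
    simp [hX y hy, ha, hb]
  · rintro ⟨r, hr⟩
    exact ⟨_, _, _, _, _, _, _, hr, by ring, rfl⟩

theorem isSymmetry_iff_of_isExpOn (hA : A ≠ 0) (hγ : 1 < γ) (h : IsRegion Ω)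
    (hS : IsEntropy Ω S) (hq : q ≠ 0) (hc : IsExpOn (sRange Ω) S S₀ q) :
    IsSymmetry Ω (system A γ S) X ↔
      SpannedOn Ω ![dt, dpsi, dchi, tdchi, extExp γ q] X := by
  have h3 : γ - 1 ≠ 0 := by linarith
  simp only [isSymmetry_system_iff hA hγ h hS, spannedOn_exp,
    hc.entropyCondition_iff h.isOpen_sRange h.nonempty_sRange hS.2 hq]
  constructor
  · rintro ⟨a, b, c, d, e, c₁, c₂, hX, rfl, hE⟩
    refine ⟨![c, e, c₂, c₁, d / (2 * (γ - 1))], fun y hy => ?_⟩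
    have hb : 2 * (γ - 1) * (d / (2 * (γ - 1))) = d := by field_simp
    have ha : q * (d / (2 * (γ - 1))) = a := by
      field_simp
      linear_combination -hE
    simp [hX y hy, ha, hb]
  · rintro ⟨r, hr⟩
    exact ⟨_, _, _, _, _, _, _, hr, rfl, by ring⟩

theorem SpannedOn.of_mem {n : ℕ} {G : Fin n → VF} (i : Fin n) : SpannedOn Ω G (G i) :=
  ⟨Pi.single i 1, fun y _ => by simp [Pi.single_apply]⟩

/-- A field with a component along `∂_s` is not in the kernel. -/
theorem not_spannedOn_kernel (h : IsRegion Ω) {b d : ℝ} (hbd : ¬ (b = 0 ∧ d = 0))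
    (hX : ∀ y ∈ Ω, (X y).1 1 = b * y.1 1 + d) :
    ¬ SpannedOn Ω ![dt, dpsi, dchi, tdchi] X := by
  rw [spannedOn_kernel]
  rintro ⟨r, hr⟩
  refine hbd (h.sRange_eq_zero fun y hy => ?_)
  rw [← hX y hy, hr y hy]
  simp [affineField]

theorem spannedOn_kernel_of_spannedOn_three (hX : SpannedOn Ω ![dt, dpsi, dchi] X) :
    SpannedOn Ω ![dt, dpsi, dchi, tdchi] X := by
  obtain ⟨r, hr⟩ := spannedOn_three.1 hX
  exact spannedOn_kernel.2 ⟨![r 0, r 1, r 2, 0], by simpa using hr⟩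

theorem not_spannedOn_kernel_ds (h : IsRegion Ω) :
    ¬ SpannedOn Ω ![dt, dpsi, dchi, tdchi] ds :=
  not_spannedOn_kernel h (b := 0) (d := 1) (by simp) fun y _ => by simp [ds]

theorem not_spannedOn_kernel_extPow (hγ : 1 < γ) (h : IsRegion Ω) :
    ¬ SpannedOn Ω ![dt, dpsi, dchi, tdchi] (extPow γ q s₀) := by
  refine not_spannedOn_kernel h (b := 2 * (γ - 1)) (d := -(2 * (γ - 1) * s₀)) ?_ fun y _ => ?_
  · rintro ⟨h1, -⟩
    linarith
  · simp [extPow, tdt, sds, scl]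
    ring

theorem not_spannedOn_kernel_extExp (hγ : 1 < γ) (h : IsRegion Ω) :
    ¬ SpannedOn Ω ![dt, dpsi, dchi, tdchi] (extExp γ q) := by
  refine not_spannedOn_kernel h (b := 0) (d := 2 * (γ - 1)) ?_ fun y _ => ?_
  · rintro ⟨-, h1⟩
    linarith
  · simp [extExp, tdt, ds, scl]

theorem not_spannedOn_kernel_extVar (h : IsRegion Ω) :
    ¬ SpannedOn Ω ![dt, dpsi, dchi, tdchi] (extVar s₀) := by
  refine not_spannedOn_kernel h (b := 2) (d := -(2 * s₀)) (by simp) fun y _ => ?_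
  simp [extVar, sds, scl]
  ring

theorem exists_isSymmetry_iff (hA : A ≠ 0) (hγ : 1 < γ) (h : IsRegion Ω) (hS : IsEntropy Ω S) :
    (∃ X : VF, IsSymmetry Ω (system A γ S) X ∧ ¬ SpannedOn Ω ![dt, dpsi, dchi, tdchi] X) ↔
      (∃ S₀, IsConstOn (sRange Ω) S S₀) ∨
      (∃ S₀ s₀ q, q ≠ 0 ∧ IsPowOn (sRange Ω) S S₀ s₀ q) ∨
      (∃ S₀ q, q ≠ 0 ∧ IsExpOn (sRange Ω) S S₀ q) := by
  constructor
  · rintro ⟨X, hX, hn⟩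
    obtain ⟨a, b, c, d, e, c₁, c₂, h1, hE⟩ := (isSymmetry_system_iff hA hγ h hS).1 hX
    refine entropy_cases h hS hE ?_
    rintro ⟨rfl, rfl⟩
    obtain ⟨s, hs⟩ := h.nonempty_sRange
    have e1 := hE s hs
    -- For `b = d = 0` the entropy condition is `(2 γ - 2) a S = 0`, so the field lies in the
    -- kernel.
    have ha : a = 0 := by
      have h3 : (2 * γ - 2) * S s ≠ 0 := mul_ne_zero (by linarith) (hS.2 s hs)
      exact (mul_eq_zero.1 (by linear_combination -e1)).resolve_left h3
    subst ha
    exact hn (spannedOn_kernel.2 ⟨![c, e, c₂, c₁], h1⟩)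
  · rintro (⟨S₀, hc⟩ | ⟨S₀, s₀, q, hq, hc⟩ | ⟨S₀, q, hq, hc⟩)
    · refine ⟨ds, (isSymmetry_iff_of_isConstOn hA hγ h hS hc).2 ?_, not_spannedOn_kernel_ds h⟩
      refine ⟨![0, 0, 0, 0, 1, 0], fun y _ => ?_⟩
      simp [Fin.sum_univ_succ]
    · exact ⟨_, (isSymmetry_iff_of_isPowOn hA hγ h hS hq hc).2 (SpannedOn.of_mem 4),
        not_spannedOn_kernel_extPow hγ h⟩
    · exact ⟨_, (isSymmetry_iff_of_isExpOn hA hγ h hS hq hc).2 (SpannedOn.of_mem 4),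
        not_spannedOn_kernel_extExp hγ h⟩

/-! ### Symmetries of the Lagrangian -/

/-- Lets the classification of variational symmetries be read off from that of divergence
symmetries. -/
theorem isVariational_iff_isDivergenceWith_zero {L : J1 → ℝ} :
    IsVariational Ω L X ↔ IsDivergenceWith Ω L X fun _ _ => 0 := by
  have h0 : ∀ i z, D0 i (fun _ => 0) z = 0 := fun i z =>
    (HasDir.const (0 : ℝ) z.1 _).fderiv_eq
  simp only [IsVariational, IsDivergenceWith, h0, Finset.sum_const_zero]
  exact ⟨fun hX => ⟨hX.1, fun _ => contDiffOn_const, hX.2⟩, fun hX => ⟨hX.1, hX.2.2⟩⟩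

theorem isDivergenceWith_affineField {b c d e c₁ c₂ : ℝ} (hγ : 1 < γ) (h : IsRegion Ω)
    (hS : IsEntropy Ω S) (hE : EntropyCondition (sRange Ω) γ S 0 b d)
    (hX : ∀ y ∈ Ω, X y = affineField 0 b c d e c₁ c₂ y) :
    IsDivergenceWith Ω (lagrangian A γ S) X ![fun y => c₁ * y.2 2, fun _ => 0] := by
  refine ⟨(contDiff_affineField 0 b c d e c₁ c₂).contDiffOn.congr hX, fun i => ?_, fun z hz => ?_⟩
  · fin_cases i
    · exact ContDiff.contDiffOn (by simp; fun_prop)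
    · exact contDiffOn_const
  · rw [actionVariation_affineField hγ h hS hE hX hz, Fin.sum_univ_two]
    have e0 : D0 0 (fun y : J0 => c₁ * y.2 2) z = c₁ * chi_t z :=
      (((HasDir.const c₁ z.1 _).mul (hasDir_uc 2 z.1 (dir0 0 z))).congr_val
        (by simp [dir0])).fderiv_eq
    have e1 : D0 1 (fun _ : J0 => (0 : ℝ)) z = 0 := (HasDir.const (0 : ℝ) z.1 _).fderiv_eq
    simp [e0, e1]

theorem exists_isDivergenceWith_iff (hA : A ≠ 0) (hγ : 1 < γ) (h : IsRegion Ω)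
    (hS : IsEntropy Ω S) :
    (∃ B, IsDivergenceWith Ω (lagrangian A γ S) X B) ↔
      ∃ b c d e c₁ c₂, (∀ y ∈ Ω, X y = affineField 0 b c d e c₁ c₂ y) ∧
        EntropyCondition (sRange Ω) γ S 0 b d := by
  constructor
  · rintro ⟨B, hB⟩
    obtain ⟨b, c, d, e, c₁, c₂, h1, h2, -⟩ := hB.exists_affineField hA hγ h hS
    exact ⟨b, c, d, e, c₁, c₂, h1, h2⟩
  · rintro ⟨b, c, d, e, c₁, c₂, h1, h2⟩
    exact ⟨_, isDivergenceWith_affineField hγ h hS h2 h1⟩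

theorem isVariational_iff (hA : A ≠ 0) (hγ : 1 < γ) (h : IsRegion Ω) (hS : IsEntropy Ω S) :
    IsVariational Ω (lagrangian A γ S) X ↔
      ∃ b c d e c₂, (∀ y ∈ Ω, X y = affineField 0 b c d e 0 c₂ y) ∧
        EntropyCondition (sRange Ω) γ S 0 b d := by
  constructor
  · intro hX
    obtain ⟨b, c, d, e, c₁, c₂, h1, h2, h3⟩ :=
      (isVariational_iff_isDivergenceWith_zero.1 hX).exists_affineField hA hγ h hS
    obtain ⟨y, hy⟩ := h.isConnected.nonempty
    have hc : (0 : ℝ) = c₁ := (HasDir.const (0 : ℝ) y _).fderiv_eq.symm.trans (h3 y hy)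
    subst hc
    exact ⟨b, c, d, e, c₂, h1, h2⟩
  · rintro ⟨b, c, d, e, c₂, h1, h2⟩
    refine ⟨(contDiff_affineField 0 b c d e 0 c₂).contDiffOn.congr h1, fun z hz => ?_⟩
    rw [actionVariation_affineField hγ h hS h2 h1 hz, zero_mul]

theorem isVariational_of_spannedOn_three (hA : A ≠ 0) (hγ : 1 < γ) (h : IsRegion Ω)
    (hS : IsEntropy Ω S) (hX : SpannedOn Ω ![dt, dpsi, dchi] X) :
    IsVariational Ω (lagrangian A γ S) X := by
  obtain ⟨r, hr⟩ := spannedOn_three.1 hX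
  exact (isVariational_iff hA hγ h hS).2 ⟨_, _, _, _, _, hr, entropyCondition_zero _ _ _⟩

theorem isDivergenceWith_tdchi (hγ : 1 < γ) (h : IsRegion Ω) (hS : IsEntropy Ω S) :
    IsDivergenceWith Ω (lagrangian A γ S) tdchi ![fun y => y.2 2, fun _ => 0] := by
  have := isDivergenceWith_affineField (A := A) (X := tdchi) (c := 0) (e := 0) (c₁ := 1) (c₂ := 0)
    hγ h hS (entropyCondition_zero _ _ _)
    (fun y _ => by ext i <;> fin_cases i <;> simp [affineField, tdchi])
  simpa using this

theorem isVariational_iff_of_isConstOn (hA : A ≠ 0) (hγ : 1 < γ) (h : IsRegion Ω)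
    (hS : IsEntropy Ω S) (hc : IsConstOn (sRange Ω) S S₀) :
    IsVariational Ω (lagrangian A γ S) X ↔ SpannedOn Ω ![dt, dpsi, dchi, ds] X := by
  simp only [isVariational_iff hA hγ h hS, spannedOn_three_ds,
    hc.entropyCondition_iff h.isOpen_sRange h.nonempty_sRange]
  constructor
  · rintro ⟨b, c, d, e, c₂, hX, hE⟩
    have hb : b = 0 := (mul_eq_zero.1 (by linear_combination -hE)).resolve_left
      (show 2 * γ - 1 ≠ 0 by linarith)
    subst hb
    exact ⟨![c, e, c₂, d], hX⟩
  · rintro ⟨r, hr⟩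
    exact ⟨_, _, _, _, _, hr, by ring⟩

theorem exists_isDivergenceWith_iff_of_isConstOn (hA : A ≠ 0) (hγ : 1 < γ) (h : IsRegion Ω)
    (hS : IsEntropy Ω S) (hc : IsConstOn (sRange Ω) S S₀) :
    (∃ B, IsDivergenceWith Ω (lagrangian A γ S) X B) ↔
      SpannedOn Ω ![dt, dpsi, dchi, tdchi, ds] X := by
  simp only [exists_isDivergenceWith_iff hA hγ h hS, spannedOn_kernel_ds,
    hc.entropyCondition_iff h.isOpen_sRange h.nonempty_sRange]
  constructor
  · rintro ⟨b, c, d, e, c₁, c₂, hX, hE⟩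
    have hb : b = 0 := (mul_eq_zero.1 (by linear_combination -hE)).resolve_left
      (show 2 * γ - 1 ≠ 0 by linarith)
    subst hb
    exact ⟨![c, e, c₂, c₁, d], hX⟩
  · rintro ⟨r, hr⟩
    exact ⟨_, _, _, _, _, _, hr, by ring⟩

theorem isVariational_iff_of_isPowOn (hA : A ≠ 0) (hγ : 1 < γ) (h : IsRegion Ω)
    (hS : IsEntropy Ω S) (hc : IsPowOn (sRange Ω) S S₀ s₀ (1 - 2 * γ)) :
    IsVariational Ω (lagrangian A γ S) X ↔ SpannedOn Ω ![dt, dpsi, dchi, extVar s₀] X := by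
  simp only [isVariational_iff hA hγ h hS, spannedOn_three_extVar,
    hc.entropyCondition_iff h.isOpen_sRange h.nonempty_sRange hS.2
      (show 1 - 2 * γ ≠ 0 by linarith)]
  constructor
  · rintro ⟨b, c, d, e, c₂, hX, -, rfl⟩
    refine ⟨![c, e, c₂, b / 2], fun y hy => ?_⟩
    have hb : 2 * (b / 2) = b := by ring
    simp [hX y hy, hb]
  · rintro ⟨r, hr⟩
    exact ⟨_, _, _, _, _, hr, by ring, rfl⟩

theorem exists_isDivergenceWith_iff_of_isPowOn (hA : A ≠ 0) (hγ : 1 < γ) (h : IsRegion Ω)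
    (hS : IsEntropy Ω S) (hc : IsPowOn (sRange Ω) S S₀ s₀ (1 - 2 * γ)) :
    (∃ B, IsDivergenceWith Ω (lagrangian A γ S) X B) ↔
      SpannedOn Ω ![dt, dpsi, dchi, tdchi, extVar s₀] X := by
  simp only [exists_isDivergenceWith_iff hA hγ h hS, spannedOn_kernel_extVar,
    hc.entropyCondition_iff h.isOpen_sRange h.nonempty_sRange hS.2
      (show 1 - 2 * γ ≠ 0 by linarith)]
  constructor
  · rintro ⟨b, c, d, e, c₁, c₂, hX, -, rfl⟩
    refine ⟨![c, e, c₂, c₁, b / 2], fun y hy => ?_⟩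
    have hb : 2 * (b / 2) = b := by ring
    simp [hX y hy, hb]
  · rintro ⟨r, hr⟩
    exact ⟨_, _, _, _, _, _, hr, by ring, rfl⟩

theorem exists_isVariational_not_spannedOn_iff (hA : A ≠ 0) (hγ : 1 < γ) (h : IsRegion Ω)
    (hS : IsEntropy Ω S) :
    (∃ X : VF, IsVariational Ω (lagrangian A γ S) X ∧ ¬ SpannedOn Ω ![dt, dpsi, dchi] X) ↔
      (∃ S₀, IsConstOn (sRange Ω) S S₀) ∨
      (∃ S₀ s₀, IsPowOn (sRange Ω) S S₀ s₀ (1 - 2 * γ)) := by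
  constructor
  · rintro ⟨X, hX, hn⟩
    obtain ⟨b, c, d, e, c₂, h1, hE⟩ := (isVariational_iff hA hγ h hS).1 hX
    refine entropy_cases_variational hγ h hS hE ?_
    rintro ⟨rfl, rfl⟩
    exact hn (spannedOn_three.2 ⟨![c, e, c₂], h1⟩)
  · rintro (⟨S₀, hc⟩ | ⟨S₀, s₀, hc⟩)
    · exact ⟨ds, (isVariational_iff_of_isConstOn hA hγ h hS hc).2 (SpannedOn.of_mem 3),
        fun hX => not_spannedOn_kernel_ds h (spannedOn_kernel_of_spannedOn_three hX)⟩
    · exact ⟨extVar s₀, (isVariational_iff_of_isPowOn hA hγ h hS hc).2 (SpannedOn.of_mem 3),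
        fun hX => not_spannedOn_kernel_extVar h (spannedOn_kernel_of_spannedOn_three hX)⟩

theorem exists_isDivergenceWith_not_spannedOn_iff (hA : A ≠ 0) (hγ : 1 < γ) (h : IsRegion Ω)
    (hS : IsEntropy Ω S) :
    (∃ X B, IsDivergenceWith Ω (lagrangian A γ S) X B ∧
        ¬ SpannedOn Ω ![dt, dpsi, dchi, tdchi] X) ↔
      (∃ S₀, IsConstOn (sRange Ω) S S₀) ∨
      (∃ S₀ s₀, IsPowOn (sRange Ω) S S₀ s₀ (1 - 2 * γ)) := by
  constructor
  · rintro ⟨X, B, hX, hn⟩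
    obtain ⟨b, c, d, e, c₁, c₂, h1, hE⟩ := (exists_isDivergenceWith_iff hA hγ h hS).1 ⟨B, hX⟩
    refine entropy_cases_variational hγ h hS hE ?_
    rintro ⟨rfl, rfl⟩
    exact hn (spannedOn_kernel.2 ⟨![c, e, c₂, c₁], h1⟩)
  · rintro (⟨S₀, hc⟩ | ⟨S₀, s₀, hc⟩)
    · obtain ⟨B, hB⟩ := (exists_isDivergenceWith_iff_of_isConstOn hA hγ h hS hc).2
        (SpannedOn.of_mem 4)
      exact ⟨ds, B, hB, not_spannedOn_kernel_ds h⟩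
    · obtain ⟨B, hB⟩ := (exists_isDivergenceWith_iff_of_isPowOn hA hγ h hS hc).2
        (SpannedOn.of_mem 4)
      exact ⟨extVar s₀, B, hB, not_spannedOn_kernel_extVar h⟩

end CylMHD

end

noncomputable section

namespace CylMHD

variable {A γ : ℝ} {S : ℝ → ℝ} {w : J2} {z : J1} {Ω : Set J0} {S₀ s₀ : ℝ}

/-! ### Conservation laws from Noether's theorem -/

theorem noether_ds_zero (hγ : γ ≠ 1) (h : Regular S z) :
    noether (lagrangian A γ S) ds 0 z =
      -(phi_t z * phi_s z + phi z ^ 2 * psi_t z * psi_s z + chi_t z * chi_s z) := by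
  simp only [noether, Fin.sum_univ_three, Fin.sum_univ_two, dP_lagrangian hγ h]
  simp [ds, VF.xi, VF.eta]
  ring

theorem noether_ds_one (hγ : γ ≠ 1) (h : Regular S z) :
    noether (lagrangian A γ S) ds 1 z =
      1 / 2 * (phi_t z ^ 2 + phi z ^ 2 * psi_t z ^ 2 + chi_t z ^ 2)
        - γ / (γ - 1) * (S (ss z) * (phi z * phi_s z) / (phi z ^ γ * phi_s z ^ γ)) := by
  have h1 := h.phi_pos.ne'
  have h2 := h.phi_s_pos.ne'
  have h3 := (h.rpow_pos γ).ne'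
  have h4 := (h.rpow_pos' γ).ne'
  have h5 := sub_ne_zero.2 hγ
  simp only [noether, Fin.sum_univ_three, Fin.sum_univ_two, dP_lagrangian hγ h, lagrangian,
    Real.rpow_sub h.phi_pos, Real.rpow_sub h.phi_s_pos, Real.rpow_one]
  simp only [ds, VF.xi, VF.eta, Matrix.cons_val_zero, Matrix.cons_val_one, Matrix.cons_val]
  field_simp
  ring

theorem noether_extVar (i : Fin 2) (L : J1 → ℝ) :
    noether L (extVar s₀) i z =
      2 * (ss z - s₀) * noether L ds i z - phi z * dP L 0 i z - chi z * dP L 2 i z := by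
  simp only [noether, Fin.sum_univ_three, Fin.sum_univ_two]
  fin_cases i <;> simp [ds, extVar, sds, scl, VF.xi, VF.eta, ss, phi, chi] <;> ring

theorem noether_extVar_zero (hγ : γ ≠ 1) (h : Regular S z) :
    noether (lagrangian A γ S) (extVar s₀) 0 z =
      2 * (ss z - s₀) *
          -(phi_t z * phi_s z + phi z ^ 2 * psi_t z * psi_s z + chi_t z * chi_s z)
        - (phi z * phi_t z + chi z * chi_t z) := by
  rw [noether_extVar, noether_ds_zero hγ h, dP_lagrangian hγ h, dP_lagrangian hγ h]
  simp
  ring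

theorem noether_extVar_one (hγ : γ ≠ 1) (h : Regular S z) :
    noether (lagrangian A γ S) (extVar s₀) 1 z =
      2 * (ss z - s₀) * (1 / 2 * (phi_t z ^ 2 + phi z ^ 2 * psi_t z ^ 2 + chi_t z ^ 2)
        - γ / (γ - 1) * (S (ss z) * (phi z * phi_s z) / (phi z ^ γ * phi_s z ^ γ)))
        - (phi z ^ 2 * S (ss z) / (phi z ^ γ * phi_s z ^ γ)
          + A ^ 2 / 2 * ((phi z * psi_s z) ^ 2 / phi_s z ^ 2 + chi_s z ^ 2 / phi_s z ^ 2)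
          - A ^ 2 * (chi z * chi_s z / (phi z * phi_s z))) := by
  have h1 := h.phi_pos.ne'
  have h2 := h.phi_s_pos.ne'
  have h3 := (h.rpow_pos γ).ne'
  have h4 := (h.rpow_pos' γ).ne'
  rw [noether_extVar, noether_ds_one hγ h, dP_lagrangian hγ h, dP_lagrangian hγ h]
  simp only [Matrix.cons_val_zero, Matrix.cons_val_one, Matrix.cons_val]
  field_simp
  ring

theorem Regular.D1_congr {f g : J1 → ℝ} (h : Regular S w.1) (hfg : ∀ z, Regular S z → f z = g z)
    {i : Fin 2} {d : ℝ} (hg : HasDir g w.1 (dir1 i w) d) : D1 i f w = d :=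
  (hg.congr_fun (h.eventually.mono hfg)).D1_eq

/-- Noether's identity for `∂_s` off the solution manifold. The first term is the explicit
`s`-derivative of `L`; the others are the characteristics `-u^k_s` times the Euler-Lagrange
expressions. Symmetry of the mixed derivatives is essential. -/
theorem sum_D1_noether_ds (hγ : γ ≠ 1) (h : Regular S w.1)
    (hw : ∀ k i j, w.2 k i j = w.2 k j i) :
    ∑ i, D1 i (noether (lagrangian A γ S) ds i) w =
      -(deriv S (ss w.1) * (phi w.1 * phi_s w.1) / ((γ - 1) * (phi w.1 ^ γ * phi_s w.1 ^ γ)))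
        - (phi_s w.1 * explicitSystem A γ S 0 w + phi w.1 * psi_s w.1 * explicitSystem A γ S 1 w
          + chi_s w.1 * explicitSystem A γ S 2 w) := by
  have h1 := h.phi_pos.ne'
  have h2 := h.phi_s_pos.ne'
  have h3 := (h.rpow_pos γ).ne'
  have h4 := (h.rpow_pos' γ).ne'
  have h5 := sub_ne_zero.2 hγ
  have e0 := h.D1_congr (fun z hz => noether_ds_zero (A := A) hγ hz)
    ((((hasDir_phi_t w.1 (dir1 0 w)).mul (hasDir_phi_s w.1 (dir1 0 w))).add
      (((hasDir_phi w.1 (dir1 0 w)).sq.mul (hasDir_psi_t w.1 (dir1 0 w))).mul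
        (hasDir_psi_s w.1 (dir1 0 w)))).add
      ((hasDir_chi_t w.1 (dir1 0 w)).mul (hasDir_chi_s w.1 (dir1 0 w)))).neg
  have e1 := h.D1_congr (fun z hz => noether_ds_one (A := A) hγ hz)
    (((HasDir.const (1 / 2) w.1 (dir1 1 w)).mul
      (((hasDir_phi_t w.1 (dir1 1 w)).sq.add
        ((hasDir_phi w.1 (dir1 1 w)).sq.mul (hasDir_psi_t w.1 (dir1 1 w)).sq)).add
        (hasDir_chi_t w.1 (dir1 1 w)).sq)).sub
      ((HasDir.const (γ / (γ - 1)) w.1 (dir1 1 w)).mul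
        ((((hasDir_ss w.1 (dir1 1 w)).comp h.hasDerivAt).mul
          ((hasDir_phi w.1 (dir1 1 w)).mul (hasDir_phi_s w.1 (dir1 1 w)))).div
            (((hasDir_phi w.1 (dir1 1 w)).rpow h.phi_pos γ).mul
              ((hasDir_phi_s w.1 (dir1 1 w)).rpow h.phi_s_pos γ)) (mul_ne_zero h3 h4))))
  rw [Fin.sum_univ_two, e0, e1]
  simp only [explicitSystem, ss_dir1_one, phi_dir1, psi_dir1, chi_dir1, phi_t_dir1, phi_s_dir1,
    psi_t_dir1, psi_s_dir1, chi_t_dir1, chi_s_dir1, Matrix.cons_val_zero, Matrix.cons_val_one,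
    Matrix.cons_val, hw _ 1 0]
  field_simp
  ring

/-- The same identity for the scaling field. The obstruction `S' (s - s₀) - (1 - 2 γ) S` vanishes
exactly when the entropy condition for this field holds. -/
theorem sum_D1_noether_extVar (hγ : γ ≠ 1) (h : Regular S w.1)
    (hw : ∀ k i j, w.2 k i j = w.2 k j i) :
    ∑ i, D1 i (noether (lagrangian A γ S) (extVar s₀) i) w =
      -(2 * (deriv S (ss w.1) * (ss w.1 - s₀) - (1 - 2 * γ) * S (ss w.1))
          * (phi w.1 * phi_s w.1) / ((γ - 1) * (phi w.1 ^ γ * phi_s w.1 ^ γ)))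
        - ((2 * (ss w.1 - s₀) * phi_s w.1 + phi w.1) * explicitSystem A γ S 0 w
          + 2 * (ss w.1 - s₀) * phi w.1 * psi_s w.1 * explicitSystem A γ S 1 w
          + (2 * (ss w.1 - s₀) * chi_s w.1 + chi w.1) * explicitSystem A γ S 2 w) := by
  have h1 := h.phi_pos.ne'
  have h2 := h.phi_s_pos.ne'
  have h3 := (h.rpow_pos γ).ne'
  have h4 := (h.rpow_pos' γ).ne'
  have h5 := sub_ne_zero.2 hγ
  have hs := fun i => (HasDir.const 2 w.1 (dir1 i w)).mul
    ((hasDir_ss w.1 (dir1 i w)).sub (HasDir.const s₀ w.1 (dir1 i w)))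
  have hr := ((hasDir_phi w.1 (dir1 1 w)).rpow h.phi_pos γ).mul
    ((hasDir_phi_s w.1 (dir1 1 w)).rpow h.phi_s_pos γ)
  have hS := (hasDir_ss w.1 (dir1 1 w)).comp h.hasDerivAt
  have e0 := h.D1_congr (fun z hz => noether_extVar_zero (A := A) (s₀ := s₀) hγ hz)
    (((hs 0).mul (((((hasDir_phi_t w.1 (dir1 0 w)).mul (hasDir_phi_s w.1 (dir1 0 w))).add
      (((hasDir_phi w.1 (dir1 0 w)).sq.mul (hasDir_psi_t w.1 (dir1 0 w))).mul
        (hasDir_psi_s w.1 (dir1 0 w)))).add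
      ((hasDir_chi_t w.1 (dir1 0 w)).mul (hasDir_chi_s w.1 (dir1 0 w)))).neg)).sub
      (((hasDir_phi w.1 (dir1 0 w)).mul (hasDir_phi_t w.1 (dir1 0 w))).add
        ((hasDir_chi w.1 (dir1 0 w)).mul (hasDir_chi_t w.1 (dir1 0 w)))))
  have e1 := h.D1_congr (fun z hz => noether_extVar_one (A := A) (s₀ := s₀) hγ hz)
    (((hs 1).mul (((HasDir.const (1 / 2) w.1 (dir1 1 w)).mul
      (((hasDir_phi_t w.1 (dir1 1 w)).sq.add
        ((hasDir_phi w.1 (dir1 1 w)).sq.mul (hasDir_psi_t w.1 (dir1 1 w)).sq)).add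
        (hasDir_chi_t w.1 (dir1 1 w)).sq)).sub
      ((HasDir.const (γ / (γ - 1)) w.1 (dir1 1 w)).mul
        ((hS.mul ((hasDir_phi w.1 (dir1 1 w)).mul (hasDir_phi_s w.1 (dir1 1 w)))).div
            hr (mul_ne_zero h3 h4))))).sub
      (((((hasDir_phi w.1 (dir1 1 w)).sq.mul hS).div hr (mul_ne_zero h3 h4)).add
        ((HasDir.const (A ^ 2 / 2) w.1 (dir1 1 w)).mul
          ((((hasDir_phi w.1 (dir1 1 w)).mul (hasDir_psi_s w.1 (dir1 1 w))).sq.div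
            (hasDir_phi_s w.1 (dir1 1 w)).sq (pow_ne_zero 2 h2)).add
            ((hasDir_chi_s w.1 (dir1 1 w)).sq.div (hasDir_phi_s w.1 (dir1 1 w)).sq
              (pow_ne_zero 2 h2))))).sub
        ((HasDir.const (A ^ 2) w.1 (dir1 1 w)).mul
          (((hasDir_chi w.1 (dir1 1 w)).mul (hasDir_chi_s w.1 (dir1 1 w))).div
            ((hasDir_phi w.1 (dir1 1 w)).mul (hasDir_phi_s w.1 (dir1 1 w)))
            (mul_ne_zero h1 h2)))))
  rw [Fin.sum_univ_two, e0, e1]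
  simp only [explicitSystem, ss_dir1_one, ss_dir1_zero, phi_dir1, psi_dir1, chi_dir1, phi_t_dir1,
    phi_s_dir1, psi_t_dir1, psi_s_dir1, chi_t_dir1, chi_s_dir1, Matrix.cons_val_zero,
    Matrix.cons_val_one, Matrix.cons_val, hw _ 1 0]
  field_simp
  ring

theorem isConserved_noether_ds (hγ : γ ≠ 1) (h : IsRegion Ω) (hS : IsEntropy Ω S)
    (hc : IsConstOn (sRange Ω) S S₀) :
    IsConserved Ω (system A γ S) (noether (lagrangian A γ S) ds) := by
  intro w hw h0
  have hr := hS.regular h hw.1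
  have hs : ss w.1 ∈ sRange Ω := ⟨w.1.1, hw.1.1, rfl⟩
  rw [sum_D1_noether_ds hγ hr hw.2, hc.deriv_eq h.isOpen_sRange hs]
  simp [← system_eq_explicit hr, h0]

theorem isConserved_noether_extVar (hγ : γ ≠ 1) (h : IsRegion Ω) (hS : IsEntropy Ω S)
    (hc : IsPowOn (sRange Ω) S S₀ s₀ (1 - 2 * γ)) :
    IsConserved Ω (system A γ S) (noether (lagrangian A γ S) (extVar s₀)) := by
  intro w hw h0
  have hr := hS.regular h hw.1
  have hs : ss w.1 ∈ sRange Ω := ⟨w.1.1, hw.1.1, rfl⟩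
  rw [sum_D1_noether_extVar hγ hr hw.2, hc.deriv_eq h.isOpen_sRange hs]
  simp [← system_eq_explicit hr, h0]

theorem physOfJet_rho_rpow (h : Regular S z) (q : ℝ) :
    (physOfJet A S z).ρ ^ q = 1 / (phi z ^ q * phi_s z ^ q) := by
  have h1 := h.phi_pos.le
  have h2 := h.phi_s_pos.le
  rw [← Real.mul_rpow h1 h2, one_div, ← Real.inv_rpow (mul_nonneg h1 h2)]
  simp [physOfJet]

theorem noether_ds_eq_law1 (hA : A ≠ 0) (hγ : γ ≠ 1) (h : Regular S z) (i : Fin 2) :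
    noether (lagrangian A γ S) ds i z = -law1 A γ (physOfJet A S z) i := by
  have h1 := h.phi_pos.ne'
  have h2 := h.phi_s_pos.ne'
  have h3 := (h.rpow_pos γ).ne'
  have h4 := (h.rpow_pos' γ).ne'
  have h5 := sub_ne_zero.2 hγ
  fin_cases i
  · refine (noether_ds_zero hγ h).trans ?_
    simp only [law1, physOfJet, Phys.Hr, Fin.zero_eta, Matrix.cons_val_zero]
    field_simp
  · refine (noether_ds_one hγ h).trans ?_
    simp only [law1, physOfJet_rho_rpow h, Fin.mk_one, Matrix.cons_val_one, Matrix.cons_val_zero,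
      Real.rpow_sub h.phi_pos, Real.rpow_sub h.phi_s_pos, Real.rpow_one]
    simp only [physOfJet]
    field_simp
    ring

/-- The scaling law is `2 s` times the law of `∂_s` plus the contribution of `-(φ ∂_φ + χ ∂_χ)`, so
computations for the first law can be reused. -/
theorem law2_eq (A γ s : ℝ) (f : Phys) (i : Fin 2) :
    law2 A γ s f i = 2 * s * law1 A γ f i + (![f.r * f.u + f.z * f.w,
      f.r ^ 2 * (f.S * f.ρ ^ γ + (f.Hθ ^ 2 + f.Hz ^ 2) / 2) - f.r * f.Hr A * f.z * f.Hz] :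
        Fin 2 → ℝ) i := by
  fin_cases i <;> simp [law1, law2] <;> ring

theorem noether_extVar_eq_law2 (hA : A ≠ 0) (hγ : γ ≠ 1) (h : Regular S z) (i : Fin 2) :
    noether (lagrangian A γ S) (extVar s₀) i z =
      -law2 A γ (ss z - s₀) (physOfJet A S z) i := by
  have h1 := h.phi_pos.ne'
  have h2 := h.phi_s_pos.ne'
  have h3 := (h.rpow_pos γ).ne'
  have h4 := (h.rpow_pos' γ).ne'
  rw [noether_extVar, noether_ds_eq_law1 hA hγ h, law2_eq, dP_lagrangian hγ h, dP_lagrangian hγ h,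
    physOfJet_rho_rpow h]
  fin_cases i
  · simp [physOfJet]
    ring
  · simp only [physOfJet, Phys.Hr, Fin.mk_one, Matrix.cons_val_one, Matrix.cons_val_zero,
      Matrix.cons_val]
    field_simp
    ring

end CylMHD

end

noncomputable section

namespace CylMHD

variable {A γ : ℝ} {D : Set (ℝ × ℝ)} {f : ℝ → ℝ → Phys} {t s d : ℝ} {F : ℝ → ℝ → ℝ}

/-! ### Conservation laws along flows -/

theorem HasDir.pt_eq (h : HasDir (fun x : ℝ × ℝ => F x.1 x.2) (t, s) (1, 0) d) :
    pt F t s = d := by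
  obtain ⟨F', hF, rfl⟩ := h
  exact (HasFDerivAt.comp_hasDerivAt t (f := fun τ => (τ, s)) hF
    ((hasDerivAt_id t).prodMk (hasDerivAt_const t s))).deriv

theorem HasDir.ps_eq (h : HasDir (fun x : ℝ × ℝ => F x.1 x.2) (t, s) (0, 1) d) :
    ps F t s = d := by
  obtain ⟨F', hF, rfl⟩ := h
  exact (HasFDerivAt.comp_hasDerivAt s (f := fun σ => (t, σ)) hF
    ((hasDerivAt_const s t).prodMk (hasDerivAt_id s))).deriv

theorem IsFlow.exists_hasDir (hf : IsFlow A γ D f) (hx : (t, s) ∈ D) {g : Phys → ℝ}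
    (hg : g ∈ ([Phys.r, Phys.θ, Phys.z, Phys.u, Phys.v, Phys.w, Phys.ρ, Phys.S, Phys.Hθ, Phys.Hz] :
      List (Phys → ℝ))) (v : ℝ × ℝ) :
    ∃ d, HasDir (fun x : ℝ × ℝ => g (f x.1 x.2)) (t, s) v d :=
  ⟨_, HasDir.of_differentiableAt (((hf.c1 g hg).contDiffAt
    (hf.isOpen.mem_nhds hx)).differentiableAt (by norm_num)) v⟩

/-- The law of `∂_s` along flows with variable entropy. -/
theorem IsFlow.exists_law1 (hA : A ≠ 0) (hγ : γ ≠ 1) (hf : IsFlow A γ D f) (hx : (t, s) ∈ D)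
    {Ss : ℝ} (hSs : HasDir (fun x : ℝ × ℝ => (f x.1 x.2).S) (t, s) (0, 1) Ss) :
    ∃ d₀ d₁, HasDir (fun x : ℝ × ℝ => law1 A γ (f x.1 x.2) 0) (t, s) (1, 0) d₀ ∧
      HasDir (fun x : ℝ × ℝ => law1 A γ (f x.1 x.2) 1) (t, s) (0, 1) d₁ ∧
      d₀ + d₁ = Ss * ((f t s).ρ ^ γ / (f t s).ρ) / (γ - 1) := by
  have h1 := (hf.r_pos t s hx).ne'
  have h2 := (hf.rho_pos t s hx).ne'
  have h3 := sub_ne_zero.2 hγ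
  obtain ⟨rt, hrt⟩ := hf.exists_hasDir hx (g := Phys.r) (by simp) (1, 0)
  obtain ⟨rs, hrs⟩ := hf.exists_hasDir hx (g := Phys.r) (by simp) (0, 1)
  obtain ⟨ut, hut⟩ := hf.exists_hasDir hx (g := Phys.u) (by simp) (1, 0)
  obtain ⟨us, hus⟩ := hf.exists_hasDir hx (g := Phys.u) (by simp) (0, 1)
  obtain ⟨vt, hvt⟩ := hf.exists_hasDir hx (g := Phys.v) (by simp) (1, 0)
  obtain ⟨vs, hvs⟩ := hf.exists_hasDir hx (g := Phys.v) (by simp) (0, 1)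
  obtain ⟨wt, hwt⟩ := hf.exists_hasDir hx (g := Phys.w) (by simp) (1, 0)
  obtain ⟨ws, hws⟩ := hf.exists_hasDir hx (g := Phys.w) (by simp) (0, 1)
  obtain ⟨ρt, hρt⟩ := hf.exists_hasDir hx (g := Phys.ρ) (by simp) (1, 0)
  obtain ⟨ρs, hρs⟩ := hf.exists_hasDir hx (g := Phys.ρ) (by simp) (0, 1)
  obtain ⟨at', hat⟩ := hf.exists_hasDir hx (g := Phys.Hθ) (by simp) (1, 0)
  obtain ⟨as', has⟩ := hf.exists_hasDir hx (g := Phys.Hθ) (by simp) (0, 1)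
  obtain ⟨bt, hbt⟩ := hf.exists_hasDir hx (g := Phys.Hz) (by simp) (1, 0)
  obtain ⟨bs, hbs⟩ := hf.exists_hasDir hx (g := Phys.Hz) (by simp) (0, 1)
  have hHt := (HasDir.const A (t, s) (1, 0)).div hrt h1
  have hHs := (HasDir.const A (t, s) (0, 1)).div hrs h1
  have d0 := (((hut.mul hHt).add (hvt.mul hat)).add (hwt.mul hbt)).div ((hrt.mul hρt).mul hHt)
    (mul_ne_zero (mul_ne_zero h1 h2) (div_ne_zero hA h1))
  have d1 := ((HasDir.const (-(1 / 2)) (t, s) (0, 1)).mul ((hus.sq.add hvs.sq).add hws.sq)).add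
    ((((HasDir.const γ (t, s) (0, 1)).mul hSs).div (HasDir.const (γ - 1) (t, s) (0, 1)) h3).mul
      (hρs.rpow (hf.rho_pos t s hx) (γ - 1)))
  refine ⟨_, _, d0, d1, ?_⟩
  have e_rt := (hf.r_t t s hx).symm.trans hrt.pt_eq
  have e_rs := hrs.ps_eq.symm.trans (hf.r_s t s hx)
  have e_ρ := hf.eq_rho t s hx
  rw [((HasDir.const 1 (t, s) (1, 0)).div hρt h2).pt_eq, (hrs.mul hus).ps_eq] at e_ρ
  have e_u := hf.eq_u t s hx
  rw [hut.pt_eq, (hSs.mul (hρs.rpow (hf.rho_pos t s hx) γ)).ps_eq, (hrs.sq.mul has.sq).ps_eq,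
    hbs.sq.ps_eq] at e_u
  have e_v := hf.eq_v t s hx
  rw [hvt.pt_eq, (hrs.mul has).ps_eq] at e_v
  have e_w := hf.eq_w t s hx
  rw [hwt.pt_eq, hbs.ps_eq] at e_w
  have e_a := hf.eq_Hθ t s hx
  rw [(hat.div (hrt.mul hρt) (mul_ne_zero h1 h2)).pt_eq, (hvs.mul hHs).ps_eq] at e_a
  have e_b := hf.eq_Hz t s hx
  rw [(hbt.div hρt h2).pt_eq, ((hrs.mul hws).mul hHs).ps_eq] at e_b
  simp only [Phys.Hr, Real.rpow_sub (hf.rho_pos t s hx), Real.rpow_one] at *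
  generalize (f t s).r = r at *
  generalize (f t s).u = u at *
  generalize (f t s).v = v at *
  generalize (f t s).w = w at *
  generalize (f t s).Hθ = a at *
  generalize (f t s).Hz = b at *
  generalize (f t s).S = S at *
  generalize (f t s).ρ ^ γ = R at *
  generalize (f t s).ρ = ρ at *
  clear hrt hrs hut hus hvt hvs hwt hws hρt hρs hat has hbt hbs hHt hHs d0 d1 hSs
  subst e_rt e_rs
  -- The continuity equation solved for `ρ_t`, so that `ρ_t` can be substituted away.
  have f_ρ : ρt = -ρ ^ 2 * (1 / (r * ρ) * u + r * us) := by
    rw [← e_ρ]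
    field_simp
    ring
  subst f_ρ
  rw [sub_eq_iff_eq_add] at e_u
  rw [← eq_sub_iff_add_eq] at e_v
  subst e_u e_v e_w
  field_simp at e_a e_b ⊢
  -- The remaining time derivatives are those of `H^θ` and `H^z`. The density contains `v H^θ` and
  -- `w H^z`, so the induction equations enter with factors proportional to `v` and `w`.
  linear_combination ρ * v * A * (γ - 1) ^ 2 * e_a + ρ * A * w * (γ - 1) ^ 2 * e_b

/-- The law of `2 (s - s₀) ∂_s - (φ ∂_φ + χ ∂_χ)` along flows with variable entropy. -/
theorem IsFlow.exists_law2 (hA : A ≠ 0) (hγ : γ ≠ 1) (hf : IsFlow A γ D f) (hx : (t, s) ∈ D)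
    {Ss : ℝ} (hSs : HasDir (fun x : ℝ × ℝ => (f x.1 x.2).S) (t, s) (0, 1) Ss) (s₀ : ℝ)
    (hz : ps (fun t s => (f t s).z) t s = (f t s).Hz / ((f t s).r * (f t s).ρ * (f t s).Hr A)) :
    ∃ d₀ d₁, HasDir (fun x : ℝ × ℝ => law2 A γ (s - s₀) (f x.1 x.2) 0) (t, s) (1, 0) d₀ ∧
      HasDir (fun x : ℝ × ℝ => law2 A γ (x.2 - s₀) (f x.1 x.2) 1) (t, s) (0, 1) d₁ ∧
      d₀ + d₁ = 2 * (Ss * (s - s₀) - (1 - 2 * γ) * (f t s).S) * ((f t s).ρ ^ γ / (f t s).ρ)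
        / (γ - 1) := by
  have h1 := (hf.r_pos t s hx).ne'
  have h2 := (hf.rho_pos t s hx).ne'
  have h3 := sub_ne_zero.2 hγ
  -- The part carrying `s - s₀` is inherited from the first law. The remainder needs only the
  -- momentum equations for `u` and `w`, the kinematic relations for `r` and `z`, and `z_s`.
  obtain ⟨d₀, d₁, hd₀, hd₁, hd⟩ := hf.exists_law1 hA hγ hx hSs
  obtain ⟨rt, hrt⟩ := hf.exists_hasDir hx (g := Phys.r) (by simp) (1, 0)
  obtain ⟨rs, hrs⟩ := hf.exists_hasDir hx (g := Phys.r) (by simp) (0, 1)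
  obtain ⟨zt, hzt⟩ := hf.exists_hasDir hx (g := Phys.z) (by simp) (1, 0)
  obtain ⟨zs, hzs⟩ := hf.exists_hasDir hx (g := Phys.z) (by simp) (0, 1)
  obtain ⟨ut, hut⟩ := hf.exists_hasDir hx (g := Phys.u) (by simp) (1, 0)
  obtain ⟨wt, hwt⟩ := hf.exists_hasDir hx (g := Phys.w) (by simp) (1, 0)
  obtain ⟨ρs, hρs⟩ := hf.exists_hasDir hx (g := Phys.ρ) (by simp) (0, 1)
  obtain ⟨as', has⟩ := hf.exists_hasDir hx (g := Phys.Hθ) (by simp) (0, 1)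
  obtain ⟨bs, hbs⟩ := hf.exists_hasDir hx (g := Phys.Hz) (by simp) (0, 1)
  have hR := hSs.mul (hρs.rpow (hf.rho_pos t s hx) γ)
  have hs := (HasDir.const 2 (t, s) (0, 1)).mul
    ((HasDir.clm (ContinuousLinearMap.snd ℝ ℝ ℝ) (t, s) (0, 1)).sub
      (HasDir.const s₀ (t, s) (0, 1)))
  have e0 := ((HasDir.const (2 * (s - s₀)) (t, s) (1, 0)).mul hd₀).add
    ((hrt.mul hut).add (hzt.mul hwt))
  have e1 := (hs.mul hd₁).add ((hrs.sq.mul (hR.add ((has.sq.add hbs.sq).div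
    (HasDir.const 2 (t, s) (0, 1)) two_ne_zero))).sub
      (((hrs.mul ((HasDir.const A (t, s) (0, 1)).div hrs h1)).mul hzs).mul hbs))
  refine ⟨_, _, e0.congr_fun (.of_forall fun x => law2_eq _ _ _ _ _),
    e1.congr_fun (.of_forall fun x => law2_eq _ _ _ _ _), ?_⟩
  have e_rt := (hf.r_t t s hx).symm.trans hrt.pt_eq
  have e_rs := hrs.ps_eq.symm.trans (hf.r_s t s hx)
  have e_zt := hzt.pt_eq.symm.trans (hf.z_t t s hx)
  have e_zs := hzs.ps_eq.symm.trans hz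
  have e_u := hf.eq_u t s hx
  rw [hut.pt_eq, hR.ps_eq, (hrs.sq.mul has.sq).ps_eq, hbs.sq.ps_eq] at e_u
  have e_w := hf.eq_w t s hx
  rw [hwt.pt_eq, hbs.ps_eq] at e_w
  have e_l : law1 A γ (f t s) 1 = -(1 / 2) * ((f t s).u ^ 2 + (f t s).v ^ 2 + (f t s).w ^ 2) +
      γ * (f t s).S / (γ - 1) * (f t s).ρ ^ (γ - 1) := rfl
  simp only [e_l, Phys.Hr, Real.rpow_sub (hf.rho_pos t s hx), Real.rpow_one,
    ContinuousLinearMap.coe_snd'] at *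
  rw [eq_sub_of_add_eq hd]
  generalize (f t s).r = r at *
  generalize (f t s).u = u at *
  generalize (f t s).v = v at *
  generalize (f t s).w = w at *
  generalize (f t s).z = z at *
  generalize (f t s).Hθ = a at *
  generalize (f t s).Hz = b at *
  generalize (f t s).S = S at *
  generalize (f t s).ρ ^ γ = R at *
  generalize (f t s).ρ = ρ at *
  clear hrt hrs hzt hzs hut hwt hρs has hbs hR hs e0 e1 hd₀ hd₁ hSs hz e_l hd
  rw [sub_eq_iff_eq_add] at e_u
  subst e_rt e_rs e_zt e_zs e_u e_w
  field_simp
  ring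

theorem IsFlow.law1_conserved (hA : A ≠ 0) (hγ : γ ≠ 1) (hf : IsFlow A γ D f) {S₀ : ℝ}
    (hS : ∀ t s, (t, s) ∈ D → (f t s).S = S₀) (hx : (t, s) ∈ D) :
    pt (fun t s => law1 A γ (f t s) 0) t s + ps (fun t s => law1 A γ (f t s) 1) t s = 0 := by
  obtain ⟨d₀, d₁, h0, h1, hd⟩ := hf.exists_law1 hA hγ hx
    ((HasDir.const S₀ (t, s) (0, 1)).congr_fun
      (Filter.eventually_of_mem (hf.isOpen.mem_nhds hx) fun x hx => hS x.1 x.2 hx))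
  rw [h0.pt_eq, h1.ps_eq, hd, zero_mul, zero_div]

theorem IsFlow.law2_conserved (hA : A ≠ 0) (hγ : γ ≠ 1) (hf : IsFlow A γ D f) {S₀ s₀ : ℝ}
    (hS : ∀ t s, (t, s) ∈ D → s ≠ s₀ ∧ (f t s).S = S₀ * |s - s₀| ^ (1 - 2 * γ))
    (hz : ∀ t s, (t, s) ∈ D →
      ps (fun t s => (f t s).z) t s = (f t s).Hz / ((f t s).r * (f t s).ρ * (f t s).Hr A))
    (hx : (t, s) ∈ D) :
    pt (fun t s => law2 A γ (s - s₀) (f t s) 0) t s +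
      ps (fun t s => law2 A γ (s - s₀) (f t s) 1) t s = 0 := by
  have h0 : s - s₀ ≠ 0 := sub_ne_zero.2 (hS t s hx).1
  obtain ⟨d₀, d₁, hd₀, hd₁, hd⟩ := hf.exists_law2 hA hγ hx
    (((HasDir.clm (ContinuousLinearMap.snd ℝ ℝ ℝ) (t, s) (0, 1)).comp
      ((hasDerivAt_abs_sub_rpow (hS t s hx).1 (1 - 2 * γ)).const_mul S₀)).congr_fun
      (Filter.eventually_of_mem (hf.isOpen.mem_nhds hx) fun x hx => (hS x.1 x.2 hx).2)) s₀
      (hz t s hx)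
  -- The time derivative is taken at fixed `s`, so the factor `s - s₀` in the density is a constant;
  -- in the flux it varies.
  have e : pt (fun t s => law2 A γ (s - s₀) (f t s) 0) t s =
      pt (fun t σ => law2 A γ (s - s₀) (f t σ) 0) t s := rfl
  rw [e, hd₀.pt_eq, hd₁.ps_eq, hd, (hS t s hx).2]
  simp only [ContinuousLinearMap.coe_snd']
  field_simp
  ring

end CylMHD

end

/-! ### Assembly of the classifications and the conservation laws -/

theorem mainTheorem7 (A γ : ℝ) (hA : A ≠ 0) (hγ : 1 < γ) :
    -- the system, its symmetries and the symmetries of the Lagrangian on a region `Ω`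
    (∀ Ω : Set CylMHD.J0, CylMHD.IsRegion Ω →
      -- the kernel of the admitted Lie algebras
      (∀ X : CylMHD.VF,
        (∀ S : ℝ → ℝ, CylMHD.IsEntropy Ω S →
            CylMHD.IsSymmetry Ω (CylMHD.system A γ S) X) ↔
          CylMHD.SpannedOn Ω ![CylMHD.dt, CylMHD.dpsi, CylMHD.dchi, CylMHD.tdchi] X) ∧
      ∀ S : ℝ → ℝ, CylMHD.IsEntropy Ω S →
        -- the system consists of the Euler-Lagrange equations of the Lagrangian
        (∀ w ∈ CylMHD.adm2 Ω,
          (∀ k, CylMHD.system A γ S k w = 0) ↔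
            ∀ k, CylMHD.eulerLagrange (CylMHD.lagrangian A γ S) k w = 0) ∧
        -- extensions of the kernel occur exactly for constant, power and exponential entropy
        ((∃ X : CylMHD.VF, CylMHD.IsSymmetry Ω (CylMHD.system A γ S) X ∧
            ¬ CylMHD.SpannedOn Ω ![CylMHD.dt, CylMHD.dpsi, CylMHD.dchi, CylMHD.tdchi] X) ↔
          (∃ S₀, CylMHD.IsConstOn (CylMHD.sRange Ω) S S₀) ∨
          (∃ S₀ s₀ q, q ≠ 0 ∧ CylMHD.IsPowOn (CylMHD.sRange Ω) S S₀ s₀ q) ∨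
          (∃ S₀ q, q ≠ 0 ∧ CylMHD.IsExpOn (CylMHD.sRange Ω) S S₀ q)) ∧
        (∀ S₀, CylMHD.IsConstOn (CylMHD.sRange Ω) S S₀ →
          ∀ X : CylMHD.VF, CylMHD.IsSymmetry Ω (CylMHD.system A γ S) X ↔
            CylMHD.SpannedOn Ω ![CylMHD.dt, CylMHD.dpsi, CylMHD.dchi, CylMHD.tdchi,
              CylMHD.ds, CylMHD.extConst γ] X) ∧
        (∀ S₀ s₀ q, q ≠ 0 → CylMHD.IsPowOn (CylMHD.sRange Ω) S S₀ s₀ q →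
          ∀ X : CylMHD.VF, CylMHD.IsSymmetry Ω (CylMHD.system A γ S) X ↔
            CylMHD.SpannedOn Ω ![CylMHD.dt, CylMHD.dpsi, CylMHD.dchi, CylMHD.tdchi,
              CylMHD.extPow γ q s₀] X) ∧
        (∀ S₀ q, q ≠ 0 → CylMHD.IsExpOn (CylMHD.sRange Ω) S S₀ q →
          ∀ X : CylMHD.VF, CylMHD.IsSymmetry Ω (CylMHD.system A γ S) X ↔
            CylMHD.SpannedOn Ω ![CylMHD.dt, CylMHD.dpsi, CylMHD.dchi, CylMHD.tdchi,
              CylMHD.extExp γ q] X) ∧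
        -- symmetries of the Lagrangian that exist for every entropy function
        CylMHD.IsVariational Ω (CylMHD.lagrangian A γ S) CylMHD.dt ∧
        CylMHD.IsVariational Ω (CylMHD.lagrangian A γ S) CylMHD.dpsi ∧
        CylMHD.IsVariational Ω (CylMHD.lagrangian A γ S) CylMHD.dchi ∧
        CylMHD.IsDivergenceWith Ω (CylMHD.lagrangian A γ S) CylMHD.tdchi
          ![fun y => y.2 2, fun _ => 0] ∧
        -- additional variational symmetries
        ((∃ X : CylMHD.VF, CylMHD.IsVariational Ω (CylMHD.lagrangian A γ S) X ∧
            ¬ CylMHD.SpannedOn Ω ![CylMHD.dt, CylMHD.dpsi, CylMHD.dchi] X) ↔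
          (∃ S₀, CylMHD.IsConstOn (CylMHD.sRange Ω) S S₀) ∨
          (∃ S₀ s₀, CylMHD.IsPowOn (CylMHD.sRange Ω) S S₀ s₀ (1 - 2 * γ))) ∧
        -- no further additional symmetries arise when divergence symmetries are admitted
        ((∃ X B, CylMHD.IsDivergenceWith Ω (CylMHD.lagrangian A γ S) X B ∧
            ¬ CylMHD.SpannedOn Ω ![CylMHD.dt, CylMHD.dpsi, CylMHD.dchi, CylMHD.tdchi] X) ↔
          (∃ S₀, CylMHD.IsConstOn (CylMHD.sRange Ω) S S₀) ∨
          (∃ S₀ s₀, CylMHD.IsPowOn (CylMHD.sRange Ω) S S₀ s₀ (1 - 2 * γ))) ∧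
        -- constant entropy: all symmetries of the Lagrangian, and the law that Noether's
        -- theorem assigns to the additional one, in the physical variables
        (∀ S₀, CylMHD.IsConstOn (CylMHD.sRange Ω) S S₀ →
          (∀ X : CylMHD.VF,
            CylMHD.IsVariational Ω (CylMHD.lagrangian A γ S) X ↔
              CylMHD.SpannedOn Ω ![CylMHD.dt, CylMHD.dpsi, CylMHD.dchi, CylMHD.ds] X) ∧
          (∀ X : CylMHD.VF,
            (∃ B, CylMHD.IsDivergenceWith Ω (CylMHD.lagrangian A γ S) X B) ↔
              CylMHD.SpannedOn Ω ![CylMHD.dt, CylMHD.dpsi, CylMHD.dchi, CylMHD.tdchi,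
                CylMHD.ds] X) ∧
          CylMHD.IsConserved Ω (CylMHD.system A γ S)
            (CylMHD.noether (CylMHD.lagrangian A γ S) CylMHD.ds) ∧
          ∀ j ∈ CylMHD.adm1 Ω, ∀ i,
            CylMHD.noether (CylMHD.lagrangian A γ S) CylMHD.ds i j =
              - CylMHD.law1 A γ (CylMHD.physOfJet A S j) i) ∧
        -- the same for `S = S₀ |s - s₀| ^ (1 - 2 γ)`
        (∀ S₀ s₀, CylMHD.IsPowOn (CylMHD.sRange Ω) S S₀ s₀ (1 - 2 * γ) →
          (∀ X : CylMHD.VF,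
            CylMHD.IsVariational Ω (CylMHD.lagrangian A γ S) X ↔
              CylMHD.SpannedOn Ω ![CylMHD.dt, CylMHD.dpsi, CylMHD.dchi,
                CylMHD.extVar s₀] X) ∧
          (∀ X : CylMHD.VF,
            (∃ B, CylMHD.IsDivergenceWith Ω (CylMHD.lagrangian A γ S) X B) ↔
              CylMHD.SpannedOn Ω ![CylMHD.dt, CylMHD.dpsi, CylMHD.dchi, CylMHD.tdchi,
                CylMHD.extVar s₀] X) ∧
          CylMHD.IsConserved Ω (CylMHD.system A γ S)
            (CylMHD.noether (CylMHD.lagrangian A γ S) (CylMHD.extVar s₀)) ∧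
          ∀ j ∈ CylMHD.adm1 Ω, ∀ i,
            CylMHD.noether (CylMHD.lagrangian A γ S) (CylMHD.extVar s₀) i j =
              - CylMHD.law2 A γ (CylMHD.ss j - s₀) (CylMHD.physOfJet A S j) i)) ∧
    -- the two conservation laws along flows, in the physical variables
    (∀ (D : Set (ℝ × ℝ)) (f : ℝ → ℝ → CylMHD.Phys), CylMHD.IsFlow A γ D f →
      (∀ S₀ : ℝ, S₀ ≠ 0 → (∀ t s, (t, s) ∈ D → (f t s).S = S₀) →
        ∀ t s, (t, s) ∈ D →
          CylMHD.pt (fun t s => CylMHD.law1 A γ (f t s) 0) t s +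
            CylMHD.ps (fun t s => CylMHD.law1 A γ (f t s) 1) t s = 0) ∧
      (∀ S₀ s₀ : ℝ, S₀ ≠ 0 →
        (∀ t s, (t, s) ∈ D → s ≠ s₀ ∧ (f t s).S = S₀ * |s - s₀| ^ (1 - 2 * γ)) →
        (∀ t s, (t, s) ∈ D →
          CylMHD.ps (fun t s => (f t s).z) t s =
            (f t s).Hz / ((f t s).r * (f t s).ρ * (f t s).Hr A)) →
        ∀ t s, (t, s) ∈ D →
          CylMHD.pt (fun t s => CylMHD.law2 A γ (s - s₀) (f t s) 0) t s +
            CylMHD.ps (fun t s => CylMHD.law2 A γ (s - s₀) (f t s) 1) t s = 0)) := by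
  refine ⟨fun Ω h => ⟨fun X => CylMHD.isSymmetry_forall_iff hA hγ h, fun S hS => ?_⟩,
    fun D f hf => ⟨fun S₀ _ hc t s hx => hf.law1_conserved hA hγ.ne' hc hx,
      fun S₀ s₀ _ hc hz t s hx => hf.law2_conserved hA hγ.ne' hc hz hx⟩⟩
  have h3 := fun X hX => CylMHD.isVariational_of_spannedOn_three (X := X) hA hγ h hS hX
  exact ⟨fun w hw => CylMHD.system_iff_eulerLagrange hγ h hS hw,
    CylMHD.exists_isSymmetry_iff hA hγ h hS,
    fun S₀ hc X => CylMHD.isSymmetry_iff_of_isConstOn hA hγ h hS hc,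
    fun S₀ s₀ q hq hc X => CylMHD.isSymmetry_iff_of_isPowOn hA hγ h hS hq hc,
    fun S₀ q hq hc X => CylMHD.isSymmetry_iff_of_isExpOn hA hγ h hS hq hc,
    h3 _ (CylMHD.SpannedOn.of_mem 0), h3 _ (CylMHD.SpannedOn.of_mem 1),
    h3 _ (CylMHD.SpannedOn.of_mem 2), CylMHD.isDivergenceWith_tdchi hγ h hS,
    CylMHD.exists_isVariational_not_spannedOn_iff hA hγ h hS,
    CylMHD.exists_isDivergenceWith_not_spannedOn_iff hA hγ h hS,
    fun S₀ hc => ⟨fun X => CylMHD.isVariational_iff_of_isConstOn hA hγ h hS hc,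
      fun X => CylMHD.exists_isDivergenceWith_iff_of_isConstOn hA hγ h hS hc,
      CylMHD.isConserved_noether_ds hγ.ne' h hS hc,
      fun z hz i => CylMHD.noether_ds_eq_law1 hA hγ.ne' (hS.regular h hz) i⟩,
    fun S₀ s₀ hc => ⟨fun X => CylMHD.isVariational_iff_of_isPowOn hA hγ h hS hc,
      fun X => CylMHD.exists_isDivergenceWith_iff_of_isPowOn hA hγ h hS hc,
      CylMHD.isConserved_noether_extVar hγ.ne' h hS hc,
      fun z hz i => CylMHD.noether_extVar_eq_law2 hA hγ.ne' (hS.regular h hz) i⟩⟩
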